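/- Let $n\ge 1$ and consider hyperbolic space in the half-space model $\mathbb H^{n+1}=\left(\{x\in\mathbb R^{n+1}:x_{n+1}>0\},\ \langle\cdot,\cdot\rangle=x_{n+1}^{-2}\langle\cdot,\cdot\rangle_\delta\right)$, where $\langle\cdot,\cdot\rangle_\delta$ is the Euclidean metric. Let $E_1,\dots,E_{n+1}$ be the Euclidean coordinate vectors, let $P=\{x_1=0\}$ be a totally geodesic hyperplane, let $P_+=\{x_1>0\}$, and let $\bar N=-x_{n+1}E_1$ be the unit normal of $P$ pointing out of $P_+$. Let $M$ be a compact smooth $n$-dimensional manifold, possibly with boundary, and let $\theta\in[0,\pi]$. A $\theta$-capillary hypersurface supported on $P$ is a smooth immersion $x:M\to\mathbb H^{n+1}$ with a smooth unit normal field $\nu$ along $x$ such that $x(\operatorname{int}M)\subset P_+$, $x(\partial M)\subset P$ and $\langle\nu,\bar N\rangle=-\cos\theta$ along $\partial M$. Let $h(X,Y)=\langle\bar\nabla_X\nu,Y\rangle$ be its second fundamental form, where $\bar\nabla$ is the Levi-Civita connection of $\mathbb H^{n+1}$; let $\kappa_1,\dots,\kappa_n$ be its principal curvatures, i.e. the eigenvalues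 of $h$ with respect to the induced metric; and let $H_k=\binom nk^{-1}\sum_{i_1<\dots<i_k}\kappa_{i_1}\cdots\kappa_{i_k}$ (so $H_0=1$), $H=nH_1$, and $dA$ the area element of the induced metric. Let $c>0$. (1) For every $\theta$-capillary hypersurface supported on $P$ and every $k=1,\dots,n$, the integrand below is integrable and $$\int_M\left[c\,H_{k-1}\left(\frac1{x_{n+1}}-\cos\theta\,\langle E_1,\nu\rangle\right)-H_k\,\langle x-cE_{n+1},\nu\rangle\right]dA=0,$$ where $x$ also denotes the position vector. (2) Let $x:M\times[0,T)\to\mathbb H^{n+1}$ be a family which is $C^1$ on $M\times[0,T)$ and smooth on $M\times(0,T)$, such that each $x(\cdot,t)$ is a smooth embedding and a $\theta$-capillary hypersurface supported on $P$ with unit normal $\nu(\cdot,t)$, where $\nu$ is continuous on $M\times[0,T)$, and such that $$(\partial_t x)^{\perp}=\left[\frac{nc}{x_{n+1}}-nc\cos\theta\,\langle E_1,\nu\rangle-H\,\langle x-cE_{n+1},\nu\rangle\right]\nu\qquad\text{on }M\times[0,T).$$ Suppose that, for each $t\in[0,T)$, $\Omega_t\subset P_+$ is the domain enclosed by $\Sigma_t=x(M,t)$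 and $P$, with outer normal $\nu(\cdot,t)$ along $\Sigma_t$; that is, $\Omega_t$ is open and relatively compact in $\mathbb H^{n+1}$, $\partial\Omega_t\cap P_+=\Sigma_t\cap P_+$, and $\nu(\cdot,t)$ points out of $\Omega_t$ along $\Sigma_t\cap P_+$. Then the hyperbolic volume of $\Omega_t$ equals that of $\Omega_0$ for all $t\in[0,T)$. -/

import Mathlib

open scoped Manifold ContDiff

noncomputable section

namespace HypCapillary

/-- The coordinate space `ℝ^{n+1}`.  The coordinate `x_i` (`1 ≤ i ≤ n+1`) has index `i - 1`, so
`x_1` is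
`x 0` and `x_{n+1}` is `x (Fin.last n)`. -/
abbrev E (n : ℕ) : Type := EuclideanSpace ℝ (Fin (n + 1))

/-- The constant vector field `E_1`. -/
def E₁ (n : ℕ) : E n := EuclideanSpace.single 0 1

/-- The constant vector field `E_{n+1}`. -/
def Eₗ (n : ℕ) : E n := EuclideanSpace.single (Fin.last n) 1

/-- The half-space `ℝ^{n+1}_+ = {x_{n+1} > 0}` carrying the hyperbolic metric. -/
def upperHalf (n : ℕ) : Set (E n) := {y | 0 < y (Fin.last n)}

/-- The hyperbolic metric `⟨u, v⟩ = ⟨u, v⟩_δ / x_{n+1}²` at the point `y`. -/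
def hypInner {n : ℕ} (y u v : E n) : ℝ := inner ℝ u v / y (Fin.last n) ^ 2

/-- The Christoffel term of the Levi-Civita connection of the hyperbolic metric at `y`:
`∇̄_u V = D_u V + Γ_y(u, V)`, where
`Γ_y(u, v) = -(u_{n+1} v + v_{n+1} u - ⟨u, v⟩_δ E_{n+1}) / y_{n+1}`, as for every conformal metric
`e^{2w} δ`, here with `w = -log x_{n+1}`. -/
def christoffel {n : ℕ} (y u v : E n) : E n :=
  -((y (Fin.last n))⁻¹ •
    (u (Fin.last n) • v + v (Fin.last n) • u - (inner ℝ u v : ℝ) • Eₗ n))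

/-- `christoffel` is symmetric (the connection has no torsion). -/
theorem christoffel_comm {n : ℕ} (y u v : E n) : christoffel y u v = christoffel y v u := by
  unfold christoffel
  rw [real_inner_comm, add_comm (u (Fin.last n) • v)]

/-- The connection is metric: the derivative of the metric coefficients in the direction `w`, which
is `-2 w_{n+1} ⟨u, v⟩_δ / y_{n+1}³`, is `⟨Γ(w, u), v⟩ + ⟨u, Γ(w, v)⟩`.  Together with symmetry
this determines `christoffel`. -/
theorem christoffel_metric {n : ℕ} (y u v w : E n) :
    hypInner y (christoffel y w u) v + hypInner y u (christoffel y w v) =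
      -2 * w (Fin.last n) * inner ℝ u v / y (Fin.last n) ^ 3 := by
  have h1 : ∀ z : E n, (inner ℝ (Eₗ n) z : ℝ) = z (Fin.last n) := by
    intro z; simp [Eₗ, EuclideanSpace.inner_single_left]
  have h2 : ∀ z : E n, (inner ℝ z (Eₗ n) : ℝ) = z (Fin.last n) := by
    intro z; rw [real_inner_comm]; exact h1 z
  simp only [hypInner, christoffel, inner_neg_left, inner_neg_right, inner_smul_left,
    inner_smul_right, inner_sub_left, inner_sub_right, inner_add_left, inner_add_right, h1, h2,
    RCLike.conj_to_real]
  rw [real_inner_comm w u]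
  ring

/-- Outer unit normal `N̄ = -x_{n+1} E_1` of the totally geodesic hyperplane `P = {x_1 = 0}`, the
interior side being `P_+ = {x_1 > 0}`. -/
def normalP {n : ℕ} (y : E n) : E n := -(y (Fin.last n) • E₁ n)

section Hypersurface

variable {n : ℕ} [NeZero n] {M : Type*} [TopologicalSpace M]
  [ChartedSpace (EuclideanHalfSpace n) M]

/-- `dx_p(e_i)`, where `e_i` is the `i`-th coordinate vector of the preferred chart at `p`. -/
def frame (x : M → E n) (p : M) (i : Fin n) : E n :=
  mfderiv (𝓡∂ n) 𝓘(ℝ, E n) x p (EuclideanSpace.single i (1 : ℝ) : EuclideanSpace ℝ (Fin n))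

/-- A smooth immersion `x` of the manifold with boundary `M` in the half-space model, with unit
normal field `ν`, is a `θ`-capillary hypersurface supported on `P`.  The contact angle `θ` is the
angle between `-ν` and `N̄`. -/
structure IsCapillary (θ : ℝ) (x ν : M → E n) : Prop where
  smooth : ContMDiff (𝓡∂ n) 𝓘(ℝ, E n) ∞ x
  mem_half : ∀ p, x p ∈ upperHalf n
  immersion : ∀ p, Function.Injective (mfderiv (𝓡∂ n) 𝓘(ℝ, E n) x p)
  normal_smooth : ContMDiff (𝓡∂ n) 𝓘(ℝ, E n) ∞ ν
  normal_unit : ∀ p, hypInner (x p) (ν p) (ν p) = 1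
  normal_orth : ∀ p i, hypInner (x p) (ν p) (frame x p i) = 0
  interior_pos : ∀ p ∈ (𝓡∂ n).interior M, 0 < x p 0
  boundary_zero : ∀ p ∈ (𝓡∂ n).boundary M, x p 0 = 0
  contact : ∀ p ∈ (𝓡∂ n).boundary M, hypInner (x p) (ν p) (normalP (x p)) = -Real.cos θ

/-- First fundamental form `g_{ij} = ⟨e_i, e_j⟩` at `p`. -/
def firstForm (x : M → E n) (p : M) : Matrix (Fin n) (Fin n) ℝ :=
  Matrix.of fun i j => hypInner (x p) (frame x p i) (frame x p j)

/-- The covariant derivative `∇̄_{e_i} ν` of the field `ν` along `x`. -/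
def covDerivNormal (x ν : M → E n) (p : M) (i : Fin n) : E n :=
  frame ν p i + christoffel (x p) (frame x p i) (ν p)

/-- Second fundamental form `h_{ij} = ⟨∇̄_{e_i} ν, e_j⟩` at `p`. -/
def secondForm (x ν : M → E n) (p : M) : Matrix (Fin n) (Fin n) ℝ :=
  Matrix.of fun i j => hypInner (x p) (covDerivNormal x ν p i) (frame x p j)

/-- The principal curvatures at `p`, with multiplicity: the eigenvalues of `h` with respect to `g`,
that is, those of the Weingarten map `g⁻¹ h`. -/
def principalCurvatures (x ν : M → E n) (p : M) : Multiset ℝ :=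
  ((firstForm x p)⁻¹ * secondForm x ν p).charpoly.roots

/-- `S_k`, the `k`-th elementary symmetric function of the principal curvatures. -/
def symCurvature (x ν : M → E n) (k : ℕ) (p : M) : ℝ := (principalCurvatures x ν p).esymm k

/-- The normalized `k`-th mean curvature `H_k = S_k / binom(n, k)`. -/
def normCurvature (x ν : M → E n) (k : ℕ) (p : M) : ℝ := symCurvature x ν k p / (n.choose k : ℝ)

/-- The area density `√det(g_{ij})` of `x` in the chart around `q`, at the point `y` of that
chart. -/
def areaDensity (x : M → E n) (q : M) (y : EuclideanSpace ℝ (Fin n)) : ℝ :=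
  Real.sqrt (Matrix.det (Matrix.of fun i j : Fin n =>
    let f : EuclideanSpace ℝ (Fin n) → E n := x ∘ (extChartAt (𝓡∂ n) q).symm
    let D := fderivWithin ℝ f (Set.range (𝓡∂ n)) y
    hypInner (f y) (D (EuclideanSpace.single i 1)) (D (EuclideanSpace.single j 1))))

/-- The area measure on the domain of the chart around `q`: `√det(g_{ij}) dy`, transported
to `M`. -/
def chartArea [MeasurableSpace M] (x : M → E n) (q : M) : MeasureTheory.Measure M :=
  ((MeasureTheory.volume.restrict (extChartAt (𝓡∂ n) q).target).withDensity
    fun y => ENNReal.ofReal (areaDensity x q y)).map (extChartAt (𝓡∂ n) q).symm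

/-- The area measure `dA` on `M` of the metric induced by the immersion `x`.  The measures
`chartArea x q` agree on overlaps of charts, so their supremum is the unique measure which equals
`√det(g_{ij}) dy` in each chart. -/
def area [MeasurableSpace M] (x : M → E n) : MeasureTheory.Measure M := ⨆ q : M, chartArea x q

/-- The Minkowski integrand
`c H_{k-1} (1/x_{n+1} - cos θ ⟨E_1, ν⟩) - H_k ⟨x - c E_{n+1}, ν⟩`. -/
def minkowskiIntegrand (θ c : ℝ) (x ν : M → E n) (k : ℕ) (p : M) : ℝ :=
  c * normCurvature x ν (k - 1) p *
      (1 / x p (Fin.last n) - Real.cos θ * hypInner (x p) (E₁ n) (ν p)) -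
    normCurvature x ν k p * hypInner (x p) (x p - c • Eₗ n) (ν p)

/-- The speed `q_c = n c / x_{n+1} - n c cos θ ⟨E_1, ν⟩ - H ⟨x - c E_{n+1}, ν⟩`, where `H` is the
sum of the principal curvatures. -/
def flowSpeed (θ c : ℝ) (x ν : M → E n) (p : M) : ℝ :=
  n * c / x p (Fin.last n) - n * c * Real.cos θ * hypInner (x p) (E₁ n) (ν p) -
    symCurvature x ν 1 p * hypInner (x p) (x p - c • Eₗ n) (ν p)

/-- A solution on `[0, T)` of the flow `(∂_t x)^⊥ = q_c ν` by embedded `θ`-capillary hypersurfaces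
(of a compact `M`) supported on `P`: smooth for `t > 0`, and `C^1` up to `t = 0`. -/
structure IsCapillaryFlow (θ c T : ℝ) (x ν : ℝ → M → E n) : Prop where
  capillary : ∀ t ∈ Set.Ico 0 T, IsCapillary θ (x t) (ν t)
  injective : ∀ t ∈ Set.Ico 0 T, Function.Injective (x t)
  joint_C1 : ContMDiffOn (𝓘(ℝ, ℝ).prod (𝓡∂ n)) 𝓘(ℝ, E n) 1
    (fun z : ℝ × M => x z.1 z.2) (Set.Ico 0 T ×ˢ Set.univ)
  joint_smooth : ContMDiffOn (𝓘(ℝ, ℝ).prod (𝓡∂ n)) 𝓘(ℝ, E n) ∞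
    (fun z : ℝ × M => x z.1 z.2) (Set.Ioo 0 T ×ˢ Set.univ)
  normal_cont : ContinuousOn (fun z : ℝ × M => ν z.1 z.2) (Set.Ico 0 T ×ˢ Set.univ)
  evolution : ∀ t ∈ Set.Ico 0 T, ∀ p,
    hypInner (x t p) (derivWithin (fun s => x s p) (Set.Ico 0 T) t) (ν t p) • ν t p =
      flowSpeed θ c (x t) (ν t) p • ν t p

/-- `Ω` is the domain enclosed by the embedded hypersurface `Σ = x(M)` and `P`, and `ν` is the outer
normal field: `Ω ⊆ P_+` is open and relatively compact in the half-space, its boundary inside `P_+`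
is `Σ ∩ P_+`, and `ν` points out of `Ω`.  There is at most one such `Ω`. -/
structure IsEnclosedDomain (x ν : M → E n) (Ω : Set (E n)) : Prop where
  isOpen : IsOpen Ω
  subset_pos : Ω ⊆ {y | 0 < y 0}
  compact_closure : IsCompact (closure Ω)
  closure_subset : closure Ω ⊆ upperHalf n
  frontier_eq : frontier Ω ∩ {y | 0 < y 0} = Set.range x ∩ {y | 0 < y 0}
  outer : ∀ p ∈ (𝓡∂ n).interior M, ∀ᶠ s in nhdsWithin (0 : ℝ) (Set.Ioi 0),
    x p - s • ν p ∈ Ω ∧ x p + s • ν p ∉ Ω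

end Hypersurface

/-- The hyperbolic volume `∫_Ω x_{n+1}^{-(n+1)} dx`. -/
def hypVolume {n : ℕ} (Ω : Set (E n)) : ENNReal :=
  ∫⁻ y in Ω, ENNReal.ofReal (1 / y (Fin.last n) ^ (n + 1))

end HypCapillary

end

open scoped Manifold ContDiff

noncomputable section

namespace HypCapillary

set_option linter.unusedSectionVars false

section

open Function MeasureTheory Set

/-! The Minkowski formulas come from Stokes' theorem in Lorentz space. Let `X = hypPoint x` be the
image of the hypersurface on the hyperboloid and `N = hypLift x ν` its normal, let `D` be a constant
volume form on the ambient `(n+2)`-dimensional space, and put `Y = X + sN` for a real parameter `s`.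
The form `D(X, N, w, dY, …, dY)` has degree `n-1`, and because `d(dY) = 0` its exterior derivative
contains no second derivatives of `Y`; so neither the Codazzi equation nor divergence-free Newton
tensors appear.

The field `w` is `capField`, namely `m + cos θ (⟨m,N⟩ a - ⟨a,N⟩ m + ⟨a,X⟩ R N)`, where `m` lifts `x
- c E_{n+1}`, the constant vector `a` cuts out `P` as `⟨a,X⟩ = 0`, and `R` is the skew generator of
dilations. Its components `⟨w,N⟩ = ⟨x - c E_{n+1}, ν⟩` and `⟨w,X⟩ = c (1/x_{n+1} - cos θ ⟨E_1,ν⟩)`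
are the two functions in the formula. Its derivative along the hypersurface has tangential matrix
`K₀ + A K₁` with `K₀`, `K₁` antisymmetric and `A = h g⁻¹`, and this drops out when traced against
the adjugate of `g + s h` (`trace_mul_adjugate_pencil`). Finally `⟨a - cos θ N, w⟩ = 0`, which
together with the contact angle condition makes the flux through the boundary vanish
(`IsCapillary.insertTwo_capField_eq_zero`).

What remains after division by the area form is `⟨w,X⟩ tr adj(1 + sA) - ⟨w,N⟩ tr(A adj(1 + sA))`.
With `P(s) = det(1 + sA) = ∑ S_k s^k` the two traces are `nP - sP'` and `P'`, so the coefficient of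
`s^k` is `(n-k) S_k ⟨w,X⟩ - (k+1) S_{k+1} ⟨w,N⟩`, a multiple of the Minkowski integrand of index
`k+1`. The integral vanishes for every `s`, and a coefficient is a fixed linear combination of
values, so every coefficient integrates to zero (`IsCapillary.integral_minkowskiIntegrand`).

For the volume, the field `x_1 x_{n+1}^{-(n+1)} E_1` has the hyperbolic density as Euclidean
divergence and vanishes on `P`. Hence the volume of `Ω_t` is `∫ x_1 ⟨E_1,ν⟩ dA` over the
hypersurface alone (`IsEnclosedDomain.hypVolume_eq`). By Cartan's formula the time derivative of
this integral is `∫ ⟨∂_t x, ν⟩ dA` plus an exact term whose boundary flux carries the factor `x_1 =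
0`. The prescribed speed turns it into `n` times the first Minkowski integral, which is zero. The
integral is continuous at `t = 0`, so the mean value theorem concludes
(`IsCapillaryFlow.integral_eq`). -/

/-- The coordinate vectors of `ℝ^n`. -/
abbrev stdVec (n : ℕ) (i : Fin n) : EuclideanSpace ℝ (Fin n) := EuclideanSpace.single i 1

/-! ### Exterior derivatives of cofactor forms and their change of variables. -/

section Forms

variable {V : Type*} [NormedAddCommGroup V] [NormedSpace ℝ V] {n : ℕ}

/-- The value on the coordinate frame of the exterior derivative of the `(n-1)`-form
`β(w, dY, …, dY)`, where the `n`-form-valued function `β` and the vector-valued functions `Y`, `w`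
have differentials `dβ`, `A`, `dw`. -/
def stokesSum (β : V [⋀^Fin n]→L[ℝ] ℝ)
    (dβ : EuclideanSpace ℝ (Fin n) →L[ℝ] V [⋀^Fin n]→L[ℝ] ℝ)
    (A : EuclideanSpace ℝ (Fin n) →L[ℝ] V) (w : V) (dw : EuclideanSpace ℝ (Fin n) →L[ℝ] V) : ℝ :=
  ∑ i, (dβ (stdVec n i) (update (fun j => A (stdVec n j)) i w) +
    β (update (fun j => A (stdVec n j)) i (dw (stdVec n i))))

/-- Alternation against symmetry: exchanging the slots `i` and `k` flips the sign of the `(i, k)`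
term and, as `S i k = S k i`, turns it into the `(k, i)` term, so the double sum equals its own
negative. With `S` the second derivative of `Y` this is `d(dY) = 0`. -/
theorem sum_update_update_eq_zero (β : V [⋀^Fin n]→L[ℝ] ℝ) (v : Fin n → V) (w : V)
    (S : Fin n → Fin n → V) (hS : ∀ i k, S i k = S k i) :
    ∑ i, ∑ k, (if k = i then 0 else β (update (update v i w) k (S i k))) = 0 := by
  have key : ∀ i k, (if k = i then 0 else β (update (update v i w) k (S i k))) =
      -(if i = k then 0 else β (update (update v k w) i (S k i))) := by
    intro i k
    by_cases h : k = i
    · simp [h]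
    · rw [if_neg h, if_neg (Ne.symm h)]
      refine Eq.trans ?_ (β.toAlternatingMap.map_swap (update (update v k w) i (S k i)) (Ne.symm h))
      refine congrArg β (funext fun j => ?_)
      by_cases hj : j = i
      · subst hj; simp [update_of_ne h, update_of_ne (Ne.symm h)]
      · by_cases hk : j = k
        · subst hk; simp [hS]
        · simp [Equiv.swap_apply_of_ne_of_ne hj hk, hj, hk]
  have : ∑ i, ∑ k, (if k = i then 0 else β (update (update v i w) k (S i k))) =
      -∑ i, ∑ k, (if k = i then 0 else β (update (update v i w) k (S i k))) := by
    conv_lhs => rw [Finset.sum_comm]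
    rw [← Finset.sum_neg_distrib]
    refine Finset.sum_congr rfl fun i _ => ?_
    rw [← Finset.sum_neg_distrib]
    exact Finset.sum_congr rfl fun k _ => key k i
  linarith

/-- The divergence of the cofactor field `β(dY, …, w, …, dY)`: second derivatives of `Y` cancel. -/
theorem exists_hasFDerivAt_cofactor {β : EuclideanSpace ℝ (Fin n) → V [⋀^Fin n]→L[ℝ] ℝ}
    {dβ : EuclideanSpace ℝ (Fin n) →L[ℝ] V [⋀^Fin n]→L[ℝ] ℝ}
    {Y' : EuclideanSpace ℝ (Fin n) → EuclideanSpace ℝ (Fin n) →L[ℝ] V}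
    {Y'' : EuclideanSpace ℝ (Fin n) →L[ℝ] EuclideanSpace ℝ (Fin n) →L[ℝ] V}
    {w : EuclideanSpace ℝ (Fin n) → V} {dw : EuclideanSpace ℝ (Fin n) →L[ℝ] V}
    {y : EuclideanSpace ℝ (Fin n)}
    (hβ : HasFDerivAt β dβ y) (hY : HasFDerivAt Y' Y'' y) (hw : HasFDerivAt w dw y)
    (hs : ∀ u v, Y'' u v = Y'' v u) :
    ∃ η' : Fin n → EuclideanSpace ℝ (Fin n) →L[ℝ] ℝ,
      (∀ i, HasFDerivAt (fun z => β z (update (fun j => Y' z (stdVec n j)) i (w z))) (η' i) y) ∧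
      ∑ i, η' i (stdVec n i) = stokesSum (β y) dβ (Y' y) (w y) dw := by
  let g : Fin n → Fin n → EuclideanSpace ℝ (Fin n) → V :=
    fun i k z => update (fun j => Y' z (stdVec n j)) i (w z) k
  let g' : Fin n → Fin n → EuclideanSpace ℝ (Fin n) →L[ℝ] V :=
    fun i k => if k = i then dw else Y''.flip (stdVec n k)
  have hg : ∀ i k, HasFDerivAt (g i k) (g' i k) y := by
    intro i k
    by_cases h : k = i
    · subst h
      simpa [g, g'] using hw
    · have : HasFDerivAt (fun z => Y' z (stdVec n k)) (Y''.flip (stdVec n k)) y := by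
        have := hY.clm_apply (hasFDerivAt_const (stdVec n k) y)
        simpa using this
      simpa [g, g', h] using this
  refine ⟨fun i => _, fun i => hβ.continuousAlternatingMap_apply (hg i), ?_⟩
  unfold stokesSum
  simp only [add_apply, ContinuousLinearMap.coe_comp,
    Function.comp_apply, sum_apply, Finset.sum_add_distrib]
  congr 1
  -- The diagonal terms differentiate `w`; the off-diagonal ones carry `Y'' e_i e_k` and make up the
  -- vanishing double sum, which is inserted here as a zero.
  rw [← add_zero (∑ i, (β y) (update (fun j => Y' y (stdVec n j)) i (dw (stdVec n i)))),
    ← sum_update_update_eq_zero (β y) (fun j => Y' y (stdVec n j)) (w y)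
      (fun i k => Y'' (stdVec n i) (stdVec n k)) (fun i k => hs _ _), ← Finset.sum_add_distrib]
  refine Finset.sum_congr rfl fun i _ => ?_
  rw [← Finset.add_sum_erase _ _ (Finset.mem_univ i),
    ← Finset.add_sum_erase (Finset.univ) (fun k => if k = i then (0:ℝ) else _) (Finset.mem_univ i)]
  simp only [if_true, zero_add]
  congr 1
  · simp [g']
  · refine Finset.sum_congr rfl fun k hk => ?_
    have hk' : k ≠ i := Finset.ne_of_mem_erase hk
    simp [g', hk']

/-- The pullback of `β` along `A` is a top-degree form on `ℝ^n`, hence a multiple of the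
determinant. -/
theorem alternating_comp_eq_det_mul (β : V [⋀^Fin n]→L[ℝ] ℝ)
    (A : EuclideanSpace ℝ (Fin n) →L[ℝ] V)
    (C : EuclideanSpace ℝ (Fin n) →L[ℝ] EuclideanSpace ℝ (Fin n)) :
    β (fun j => A (C (stdVec n j))) = C.det * β (fun j => A (stdVec n j)) := by
  let b := (EuclideanSpace.basisFun (Fin n) ℝ).toBasis
  have hb : ∀ j, b j = stdVec n j := by intro j; simp [b]
  let f : EuclideanSpace ℝ (Fin n) [⋀^Fin n]→ₗ[ℝ] ℝ :=
    β.toAlternatingMap.compLinearMap A.toLinearMap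
  have h1 := f.eq_smul_basis_det b
  have h2 : f (C ∘ b) = f b * (C.det * b.det b) := by
    conv_lhs => rw [h1]
    have := b.det_comp (C : EuclideanSpace ℝ (Fin n) →ₗ[ℝ] EuclideanSpace ℝ (Fin n)) b
    rw [AlternatingMap.smul_apply, smul_eq_mul]
    congr 1
  rw [b.det_self] at h2
  have e1 : f (C ∘ b) = β (fun j => A (C (stdVec n j))) := by
    simp [f, hb]
  have e2 : f b = β (fun j => A (stdVec n j)) := by
    simp [f, hb]
  rw [← e1, ← e2, h2]; ring

/-- This is the derivative at `t = 0` of `alternating_comp_eq_det_mul` for `A + tL`; uniqueness of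
derivatives replaces an expansion of the sum. -/
theorem sum_update_comp_eq_det_mul (β : V [⋀^Fin n]→L[ℝ] ℝ)
    (A L : EuclideanSpace ℝ (Fin n) →L[ℝ] V)
    (C : EuclideanSpace ℝ (Fin n) →L[ℝ] EuclideanSpace ℝ (Fin n)) :
    ∑ i, β (update (fun j => A (C (stdVec n j))) i (L (C (stdVec n i)))) =
      C.det * ∑ i, β (update (fun j => A (stdVec n j)) i (L (stdVec n i))) := by
  have key : ∀ e : Fin n → EuclideanSpace ℝ (Fin n),
      HasDerivAt (fun t : ℝ => β (fun j => (A + t • L) (e j)))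
        (∑ i, β (update (fun j => A (e j)) i (L (e i)))) 0 := by
    intro e
    have h1 : HasFDerivAt β (β.1.linearDeriv (fun j => A (e j) + (0:ℝ) • L (e j)))
        (fun j => A (e j) + (0:ℝ) • L (e j)) := β.hasFDerivAt _
    have h2 : HasDerivAt (fun t : ℝ => fun j => A (e j) + t • L (e j)) (fun j => L (e j)) 0 := by
      refine hasDerivAt_pi.2 fun j => ?_
      have := ((hasDerivAt_id (0:ℝ)).smul_const (L (e j))).const_add (A (e j))
      simpa using this
    have h3 := h1.comp_hasDerivAt (0:ℝ) h2
    simpa [ContinuousMultilinearMap.linearDeriv_apply, Function.comp_def] using h3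
  have h1 := key (fun j => C (stdVec n j))
  have h2 := (key (stdVec n)).const_mul C.det
  refine h1.unique ?_
  refine h2.congr_of_eventuallyEq (Filter.Eventually.of_forall fun t => ?_)
  exact alternating_comp_eq_det_mul β (A + t • L) C

theorem eq_sum_stdVec (v : EuclideanSpace ℝ (Fin n)) : v = ∑ k, v k • stdVec n k := by
  ext j
  simp [stdVec, Pi.single_apply]

/-- An exterior derivative of degree `n` picks up the Jacobian determinant under a change of chart.
The `dβ` terms do not have the shape required by `sum_update_comp_eq_det_mul`; expanding `C e_i` in
coordinates splits them into `n` sums that do, with `L` the rank-one map `v ↦ v_k w`. -/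
theorem stokesSum_comp (β : V [⋀^Fin n]→L[ℝ] ℝ)
    (dβ : EuclideanSpace ℝ (Fin n) →L[ℝ] V [⋀^Fin n]→L[ℝ] ℝ)
    (A : EuclideanSpace ℝ (Fin n) →L[ℝ] V) (w : V) (dw : EuclideanSpace ℝ (Fin n) →L[ℝ] V)
    (C : EuclideanSpace ℝ (Fin n) →L[ℝ] EuclideanSpace ℝ (Fin n)) :
    stokesSum β (dβ.comp C) (A.comp C) w (dw.comp C) = C.det * stokesSum β dβ A w dw := by
  have expand : ∀ (B : EuclideanSpace ℝ (Fin n) →L[ℝ] EuclideanSpace ℝ (Fin n)) (v : Fin n → V),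
      ∑ i, dβ (B (stdVec n i)) (update v i w) =
        ∑ k, ∑ i, dβ (stdVec n k)
          (update v i (((EuclideanSpace.proj k : EuclideanSpace ℝ (Fin n) →L[ℝ] ℝ).smulRight w)
            (B (stdVec n i)))) := by
    intro B v
    rw [Finset.sum_comm]
    refine Finset.sum_congr rfl fun i _ => ?_
    conv_lhs => rw [eq_sum_stdVec (B (stdVec n i))]
    simp only [map_sum, map_smul, ContinuousLinearMap.smulRight_apply,
      ContinuousAlternatingMap.map_update_smul]
    simp [ContinuousAlternatingMap.sum_apply]
  unfold stokesSum
  simp only [ContinuousLinearMap.comp_apply]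
  rw [Finset.sum_add_distrib, Finset.sum_add_distrib, mul_add, sum_update_comp_eq_det_mul]
  congr 1
  rw [expand C]
  have := expand (ContinuousLinearMap.id ℝ _) (fun j => A (stdVec n j))
  simp only [ContinuousLinearMap.id_apply] at this
  rw [this, Finset.mul_sum]
  exact Finset.sum_congr rfl fun k _ => sum_update_comp_eq_det_mul _ _ _ _

theorem stokesSum_add_right (β : V [⋀^Fin n]→L[ℝ] ℝ)
    (dβ : EuclideanSpace ℝ (Fin n) →L[ℝ] V [⋀^Fin n]→L[ℝ] ℝ)
    (A : EuclideanSpace ℝ (Fin n) →L[ℝ] V) (w w' : V)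
    (dw dw' : EuclideanSpace ℝ (Fin n) →L[ℝ] V) :
    stokesSum β dβ A (w + w') (dw + dw') =
      stokesSum β dβ A w dw + stokesSum β dβ A w' dw' := by
  simp only [stokesSum, add_apply, ContinuousAlternatingMap.map_update_add,
    ← Finset.sum_add_distrib]
  exact Finset.sum_congr rfl fun i _ => by ring

end Forms

/-! ### The divergence theorem on a half-space. -/

theorem setIntegral_Icc_divergence_halfSpace {m : ℕ} {R : ℝ} (hR : 0 < R)
    (f : Fin (m + 1) → (Fin (m + 1) → ℝ) → ℝ)
    (f' : Fin (m + 1) → (Fin (m + 1) → ℝ) → (Fin (m + 1) → ℝ) →L[ℝ] ℝ)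
    (d : (Fin (m + 1) → ℝ) → ℝ)
    (hfar : ∀ i y, 0 ≤ y 0 → (∃ j, R ≤ |y j|) → f i y = 0)
    (hc : ∀ i, ContinuousOn (f i) {y | 0 ≤ y 0})
    (hd : ∀ y, 0 < y 0 → ∀ i, HasFDerivAt (f i) (f' i y) y)
    (hdd : ∀ y, 0 < y 0 → ∑ i, f' i y (Pi.single i 1) = d y)
    (hint : IntegrableOn d {y | 0 ≤ y 0}) (hdfar : ∀ y, (∃ j, R ≤ |y j|) → d y = 0) :
    ∫ y in {y | 0 ≤ y 0}, d y = -∫ z : Fin m → ℝ, f 0 (Fin.cons 0 z) := by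
  -- The box is `[0, R] × [-R, R]^m`; the field vanishes on all its faces except the one in `y 0 =
  -- 0`.
  let a : Fin (m + 1) → ℝ := Fin.cons 0 fun _ => -R
  let b : Fin (m + 1) → ℝ := fun _ => R
  have hle : a ≤ b := by
    intro i
    refine Fin.cases ?_ (fun j => ?_) i
    · simp [a, b, hR.le]
    · simp only [a, b, Fin.cons_succ]; linarith
  have hsub : Icc a b ⊆ {y | 0 ≤ y 0} := fun y hy => by simpa [a] using hy.1 0
  -- Nothing is known about `f'` on the face `y 0 = 0`, so it is replaced by zero there; the face is
  -- a null set and the divergence is unchanged almost everywhere.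
  let F' : Fin (m + 1) → (Fin (m + 1) → ℝ) → (Fin (m + 1) → ℝ) →L[ℝ] ℝ := fun i y =>
    if 0 < y 0 then f' i y else 0
  have hnull : (volume : Measure (Fin (m + 1) → ℝ)) {y | y 0 = 0} = 0 :=
    Measure.pi_hyperplane (fun _ : Fin (m + 1) => (volume : Measure ℝ)) 0 0
  have hae : (fun y => ∑ i, F' i y (Pi.single i 1)) =ᵐ[volume.restrict {y | 0 ≤ y 0}] d := by
    have hm : MeasurableSet {y : Fin (m + 1) → ℝ | 0 ≤ y 0} :=
      (isClosed_le continuous_const (continuous_apply 0)).measurableSet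
    have h0 : ∀ᵐ y : Fin (m + 1) → ℝ, y 0 ≠ 0 := by
      rw [ae_iff]; simpa using hnull
    filter_upwards [ae_restrict_mem hm, ae_restrict_of_ae h0] with y hy hy0
    have : 0 < y 0 := lt_of_le_of_ne hy (Ne.symm hy0)
    simp [F', this, hdd]
  have hbox := integral_divergence_of_hasFDerivAt_off_countable' a b hle f F' ∅ countable_empty
    (fun i => (hc i).mono hsub) ?_ ?_
  rotate_left
  · intro x hx i
    have h0 : 0 < x 0 := by simpa [a] using (hx.1 0 (mem_univ _)).1
    simpa [F', h0] using hd x h0 i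
  · exact ((hint.congr_fun_ae hae.symm)).mono_set hsub
  have hL : ∫ y in Icc a b, ∑ i, F' i y (Pi.single i 1) = ∫ y in {y | 0 ≤ y 0}, d y := by
    rw [integral_congr_ae (ae_restrict_of_ae_restrict_of_subset hsub hae)]
    refine (setIntegral_eq_of_subset_of_forall_sdiff_eq_zero
      (isClosed_le continuous_const (continuous_apply 0)).measurableSet hsub ?_).symm
    rintro y ⟨hy0, hy⟩
    refine hdfar y ?_
    by_contra hcon
    push Not at hcon
    refine hy ⟨fun i => ?_, fun i => ((abs_lt.1 (hcon i)).2).le⟩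
    refine Fin.cases ?_ (fun j => ?_) i
    · simpa [a] using hy0
    · simpa [a] using (abs_lt.1 (hcon j.succ)).1.le
  rw [hL] at hbox
  rw [hbox, Fin.sum_univ_succ]
  have hz : ∀ i : Fin m, (∫ x in Icc (a ∘ i.succ.succAbove) (b ∘ i.succ.succAbove),
      f i.succ (i.succ.insertNth (b i.succ) x)) -
      ∫ x in Icc (a ∘ i.succ.succAbove) (b ∘ i.succ.succAbove),
        f i.succ (i.succ.insertNth (a i.succ) x) = 0 := by
    intro i
    have h0 : ∀ (c : ℝ) (x : Fin m → ℝ), |c| = R →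
        x ∈ Icc (a ∘ i.succ.succAbove) (b ∘ i.succ.succAbove) →
        f i.succ (i.succ.insertNth c x) = 0 := by
      intro c x hcR hx
      refine hfar _ _ ?_ ⟨i.succ, by simp [hcR]⟩
      obtain ⟨k, hk⟩ := Fin.exists_succAbove_eq (Fin.succ_ne_zero i).symm
      have := hx.1 k
      rw [← hk, Fin.insertNth_apply_succAbove]
      simpa [a, hk] using this
    rw [setIntegral_eq_zero_of_forall_eq_zero, setIntegral_eq_zero_of_forall_eq_zero, sub_zero]
    · exact fun x hx => h0 _ x (by simp [a, abs_of_pos hR]) hx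
    · exact fun x hx => h0 _ x (by simp [b, abs_of_pos hR]) hx
  rw [Finset.sum_eq_zero fun i _ => hz i, add_zero]
  have h1 : ∫ x in Icc (a ∘ Fin.succAbove 0) (b ∘ Fin.succAbove 0),
      f 0 (Fin.insertNth 0 (b 0) x) = 0 := by
    refine setIntegral_eq_zero_of_forall_eq_zero fun x _ => ?_
    exact hfar _ _ (by simp [b, hR.le]) ⟨0, by simp [b, abs_of_pos hR]⟩
  rw [h1, zero_sub]
  congr 1
  symm
  have : ∀ x : Fin m → ℝ, (Fin.insertNth 0 (a 0) x : Fin (m + 1) → ℝ) = Fin.cons 0 x := by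
    intro x; simp [a, Fin.insertNth_zero']
  simp only [this]
  rw [← setIntegral_univ (f := fun z : Fin m → ℝ => f 0 (Fin.cons 0 z))]
  refine setIntegral_eq_of_subset_of_forall_sdiff_eq_zero MeasurableSet.univ (subset_univ _) ?_
  rintro x ⟨-, hx⟩
  refine hfar _ _ (by simp) ?_
  by_contra hcon
  push Not at hcon
  refine hx ⟨fun i => ?_, fun i => ?_⟩
  · simpa [a] using (abs_lt.1 (hcon i.succ)).1.le
  · simpa [b] using (abs_lt.1 (hcon i.succ)).2.le

/-- The divergence theorem on the half-space `{y₀ ≥ 0}` for compactly supported fields. -/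
theorem setIntegral_divergence_halfSpace {m : ℕ} {K : Set (EuclideanSpace ℝ (Fin (m + 1)))}
    (hK : IsCompact K) (η : Fin (m + 1) → EuclideanSpace ℝ (Fin (m + 1)) → ℝ)
    (η' : Fin (m + 1) → EuclideanSpace ℝ (Fin (m + 1)) → EuclideanSpace ℝ (Fin (m + 1)) →L[ℝ] ℝ)
    (d : EuclideanSpace ℝ (Fin (m + 1)) → ℝ)
    (hηK : ∀ i y, 0 ≤ y 0 → y ∉ K → η i y = 0)
    (hc : ∀ i, ContinuousOn (η i) {y | 0 ≤ y 0})
    (hd : ∀ y, 0 < y 0 → ∀ i, HasFDerivAt (η i) (η' i y) y)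
    (hdd : ∀ y, 0 < y 0 → ∑ i, η' i y (stdVec (m + 1) i) = d y)
    (hint : IntegrableOn d {y | 0 ≤ y 0}) (hdK : ∀ y, y ∉ K → d y = 0) :
    ∫ y in {y | 0 ≤ y 0}, d y =
      -∫ z : Fin m → ℝ, η 0 (WithLp.toLp 2 (Fin.cons 0 z : Fin (m + 1) → ℝ)) := by
  obtain ⟨R, hR, hKR⟩ : ∃ R > 0, ∀ y ∈ K, ∀ j, |y j| < R := by
    obtain ⟨R, hR⟩ := hK.isBounded.exists_norm_le
    refine ⟨max R 0 + 1, by positivity, fun y hy j => ?_⟩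
    have h1 := EuclideanSpace.norm_eq y
    have h2 : |y j| ≤ ‖y‖ := PiLp.norm_apply_le y j
    have := hR y hy
    have := le_max_left R 0
    linarith
  have hfar : ∀ y : EuclideanSpace ℝ (Fin (m + 1)), (∃ j, R ≤ |y j|) → y ∉ K := by
    rintro y ⟨j, hj⟩ hy
    exact absurd (hKR y hy j) (not_lt.2 hj)
  have mp := PiLp.volume_preserving_toLp (Fin (m + 1))
  let L : (Fin (m + 1) → ℝ) ≃L[ℝ] EuclideanSpace ℝ (Fin (m + 1)) :=
    (PiLp.continuousLinearEquiv 2 ℝ fun _ : Fin (m + 1) => ℝ).symm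
  have hL : ∀ y, L y = WithLp.toLp 2 y := fun y => rfl
  have hemb : MeasurableEmbedding (WithLp.toLp 2 : (Fin (m + 1) → ℝ) → EuclideanSpace ℝ _) :=
    L.toHomeomorph.measurableEmbedding
  have hpre : (WithLp.toLp 2 : (Fin (m + 1) → ℝ) → EuclideanSpace ℝ _) ⁻¹' {y | 0 ≤ y 0} =
    {y | 0 ≤ y 0} := rfl
  rw [← mp.setIntegral_preimage_emb hemb, hpre]
  refine setIntegral_Icc_divergence_halfSpace hR (fun i y => η i (WithLp.toLp 2 y))
    (fun i y => (η' i (L y)).comp (L : (Fin (m + 1) → ℝ) →L[ℝ] EuclideanSpace ℝ (Fin (m + 1))))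
    _ ?_ ?_ ?_ ?_ ?_ ?_
  · exact fun i y hy hj => hηK i _ hy (hfar _ hj)
  · exact fun i => (hc i).comp L.continuous.continuousOn fun y hy => hy
  · exact fun y hy i => (hd (L y) hy i).comp y L.hasFDerivAt
  · intro y hy
    change _ = d (L y)
    rw [← hdd (L y) hy]
    refine Finset.sum_congr rfl fun i _ => ?_
    simp [hL, stdVec]
  · have := (mp.integrableOn_comp_preimage hemb (f := d) (s := {y | 0 ≤ y 0})).2 hint
    exact this
  · exact fun y hj => hdK _ (hfar _ hj)

end

section

open Function MeasureTheory Set Filter Topology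

/-- The divergence theorem on the half-space for compactly supported fields which are tangent to the
boundary. -/
theorem setIntegral_divergence_halfSpace_eq_zero {n : ℕ} [NeZero n]
    {K : Set (EuclideanSpace ℝ (Fin n))}
    (hK : IsCompact K) (η : Fin n → EuclideanSpace ℝ (Fin n) → ℝ)
    (η' : Fin n → EuclideanSpace ℝ (Fin n) → EuclideanSpace ℝ (Fin n) →L[ℝ] ℝ)
    (d : EuclideanSpace ℝ (Fin n) → ℝ)
    (hηK : ∀ i y, 0 ≤ y 0 → y ∉ K → η i y = 0)
    (hc : ∀ i, ContinuousOn (η i) {y | 0 ≤ y 0})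
    (hd : ∀ y, 0 < y 0 → ∀ i, HasFDerivAt (η i) (η' i y) y)
    (hdd : ∀ y, 0 < y 0 → ∑ i, η' i y (stdVec n i) = d y)
    (hint : IntegrableOn d {y | 0 ≤ y 0}) (hdK : ∀ y, y ∉ K → d y = 0)
    (hη0 : ∀ y, y 0 = 0 → η 0 y = 0) :
    ∫ y in {y | 0 ≤ y 0}, d y = 0 := by
  obtain ⟨m, rfl⟩ := Nat.exists_eq_succ_of_ne_zero (NeZero.ne n)
  have h := setIntegral_divergence_halfSpace hK η η' d hηK hc hd hdd hint hdK
  refine h.trans ?_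
  rw [neg_eq_zero]
  exact integral_eq_zero_of_ae (Eventually.of_forall fun z => hη0 _ rfl)

/-! ### Derivatives read in charts. -/

section Charts

variable {n : ℕ} [NeZero n] {M : Type*} [TopologicalSpace M]
  [ChartedSpace (EuclideanHalfSpace n) M]
  {V : Type*} [NormedAddCommGroup V] [NormedSpace ℝ V]

/-- The differential of a vector-valued function at `p`, in the preferred chart at `p`. -/
def diffAt (f : M → V) (p : M) : EuclideanSpace ℝ (Fin n) →L[ℝ] V :=
  mfderiv (𝓡∂ n) 𝓘(ℝ, V) f p

/-- The differential of a vector-valued function read in the chart around `q`. -/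
def chartDeriv (q : M) (f : M → V) (y : EuclideanSpace ℝ (Fin n)) :
    EuclideanSpace ℝ (Fin n) →L[ℝ] V :=
  fderivWithin ℝ (f ∘ (extChartAt (𝓡∂ n) q).symm) (range (𝓡∂ n)) y

/-- The differential of the inverse of the chart around `q`. -/
def chartJac (q : M) (y : EuclideanSpace ℝ (Fin n)) :
    EuclideanSpace ℝ (Fin n) →L[ℝ] EuclideanSpace ℝ (Fin n) :=
  mfderivWithin 𝓘(ℝ, EuclideanSpace ℝ (Fin n)) (𝓡∂ n) (extChartAt (𝓡∂ n) q).symm (range (𝓡∂ n)) y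

theorem frame_eq_diffAt (x : M → E n) (p : M) (i : Fin n) : frame x p i = diffAt x p (stdVec n i) :=
  rfl

theorem range_model : range (𝓡∂ n) = {y : EuclideanSpace ℝ (Fin n) | 0 ≤ y 0} :=
  range_modelWithCornersEuclideanHalfSpace n

theorem uniqueDiffOn_target (q : M) : UniqueDiffOn ℝ (extChartAt (𝓡∂ n) q).target :=
  uniqueDiffOn_extChartAt_target q

theorem measurableSet_target (q : M) : MeasurableSet (extChartAt (𝓡∂ n) q).target := by
  rw [extChartAt_target]
  refine MeasurableSet.inter ?_ (𝓡∂ n).isClosed_range.measurableSet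
  exact ((chartAt _ q).open_target.preimage (𝓡∂ n).continuous_symm).measurableSet

theorem target_mem_nhdsWithin {q : M} {y : EuclideanSpace ℝ (Fin n)}
    (hy : y ∈ (extChartAt (𝓡∂ n) q).target) :
    (extChartAt (𝓡∂ n) q).target ∈ 𝓝[range (𝓡∂ n)] y :=
  extChartAt_target_mem_nhdsWithin_of_mem hy

theorem range_mem_nhds {y : EuclideanSpace ℝ (Fin n)} (hy : 0 < y 0) :
    range (𝓡∂ n) ∈ 𝓝 y := by
  rw [range_model]
  have : Continuous fun z : EuclideanSpace ℝ (Fin n) => z 0 := by fun_prop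
  filter_upwards [this.continuousAt.eventually (lt_mem_nhds hy)] with z hz using hz.le

theorem target_mem_nhds {q : M} {y : EuclideanSpace ℝ (Fin n)}
    (hy : y ∈ (extChartAt (𝓡∂ n) q).target) (hy0 : 0 < y 0) :
    (extChartAt (𝓡∂ n) q).target ∈ 𝓝 y := by
  have := target_mem_nhdsWithin hy
  rwa [nhdsWithin_eq_nhds.2 (range_mem_nhds hy0)] at this

theorem chartDeriv_self {f : M → V} {p : M} (hf : MDifferentiableAt (𝓡∂ n) 𝓘(ℝ, V) f p) :
    chartDeriv p f (extChartAt (𝓡∂ n) p p) = diffAt f p :=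
  hf.mfderiv.symm

theorem chartDeriv_eq {f : M → V} {q : M} {y : EuclideanSpace ℝ (Fin n)}
    (hy : y ∈ (extChartAt (𝓡∂ n) q).target) [IsManifold (𝓡∂ n) 1 M]
    (hf : MDifferentiableAt (𝓡∂ n) 𝓘(ℝ, V) f ((extChartAt (𝓡∂ n) q).symm y)) :
    chartDeriv q f y = (diffAt f ((extChartAt (𝓡∂ n) q).symm y)).comp (chartJac q y) := by
  have h1 := hf.hasMFDerivAt.comp_hasMFDerivWithinAt y
    (mdifferentiableWithinAt_extChartAt_symm hy).hasMFDerivWithinAt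
  have h2 : HasFDerivWithinAt (f ∘ (extChartAt (𝓡∂ n) q).symm)
    ((diffAt f ((extChartAt (𝓡∂ n) q).symm y)).comp (chartJac q y)) (range (𝓡∂ n)) y :=
    h1.hasFDerivWithinAt
  exact h2.fderivWithin ((𝓡∂ n).uniqueDiffOn _ (extChartAt_target_subset_range q hy))

theorem chartJac_det_ne_zero {q : M} {y : EuclideanSpace ℝ (Fin n)}
    (hy : y ∈ (extChartAt (𝓡∂ n) q).target) [IsManifold (𝓡∂ n) 1 M] :
    (chartJac q y).det ≠ 0 := by
  have h1 : (diffAt (extChartAt (𝓡∂ n) q) ((extChartAt (𝓡∂ n) q).symm y)).comp (chartJac q y) =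
      ContinuousLinearMap.id ℝ (EuclideanSpace ℝ (Fin n)) :=
    mfderiv_extChartAt_comp_mfderivWithin_extChartAt_symm hy
  intro h0
  have h2 := LinearMap.det_comp (diffAt (extChartAt (𝓡∂ n) q)
    ((extChartAt (𝓡∂ n) q).symm y)).toLinearMap (chartJac q y).toLinearMap
  rw [show LinearMap.det (chartJac q y).toLinearMap = 0 from h0, mul_zero,
    show (diffAt (extChartAt (𝓡∂ n) q) ((extChartAt (𝓡∂ n) q).symm y)).toLinearMap ∘ₗ
      (chartJac q y).toLinearMap = LinearMap.id from congrArg ContinuousLinearMap.toLinearMap h1,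
    LinearMap.det_id] at h2
  exact one_ne_zero h2

theorem contDiffOn_chart {k : WithTop ℕ∞} [IsManifold (𝓡∂ n) k M] {f : M → V}
    (hf : ContMDiff (𝓡∂ n) 𝓘(ℝ, V) k f) (q : M) :
    ContDiffOn ℝ k (f ∘ (extChartAt (𝓡∂ n) q).symm) (extChartAt (𝓡∂ n) q).target :=
  (hf.comp_contMDiffOn (contMDiffOn_extChartAt_symm q)).contDiffOn

theorem chartDeriv_eq_fderivWithin_target {f : M → V} {q : M} {y : EuclideanSpace ℝ (Fin n)}
    (hy : y ∈ (extChartAt (𝓡∂ n) q).target) :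
    chartDeriv q f y =
      fderivWithin ℝ (f ∘ (extChartAt (𝓡∂ n) q).symm) (extChartAt (𝓡∂ n) q).target y :=
  fderivWithin_congr_set (extChartAt_target_eventuallyEq_of_mem hy).symm

theorem contDiffOn_chartDeriv {k m : WithTop ℕ∞} [IsManifold (𝓡∂ n) k M] {f : M → V}
    (hf : ContMDiff (𝓡∂ n) 𝓘(ℝ, V) k f) (hm : m + 1 ≤ k) (q : M) :
    ContDiffOn ℝ m (chartDeriv q f) (extChartAt (𝓡∂ n) q).target :=
  ((contDiffOn_chart hf q).fderivWithin (uniqueDiffOn_target q) hm).congr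
    fun _ hy => chartDeriv_eq_fderivWithin_target hy

theorem hasFDerivAt_chart [IsManifold (𝓡∂ n) 1 M] {f : M → V}
    (hf : ContMDiff (𝓡∂ n) 𝓘(ℝ, V) 1 f) {q : M} {y : EuclideanSpace ℝ (Fin n)}
    (hy : y ∈ (extChartAt (𝓡∂ n) q).target) (hy0 : 0 < y 0) :
    HasFDerivAt (f ∘ (extChartAt (𝓡∂ n) q).symm) (chartDeriv q f y) y := by
  have h := (((contDiffOn_chart hf q).contDiffAt (target_mem_nhds hy hy0)).differentiableAt
    one_ne_zero).hasFDerivAt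
  rwa [chartDeriv, fderivWithin_of_mem_nhds (range_mem_nhds hy0)]

theorem hasFDerivWithinAt_chart [IsManifold (𝓡∂ n) 1 M] {f : M → V}
    (hf : ContMDiff (𝓡∂ n) 𝓘(ℝ, V) 1 f) {q : M} {y : EuclideanSpace ℝ (Fin n)}
    (hy : y ∈ (extChartAt (𝓡∂ n) q).target) :
    HasFDerivWithinAt (f ∘ (extChartAt (𝓡∂ n) q).symm) (chartDeriv q f y)
      (extChartAt (𝓡∂ n) q).target y := by
  rw [chartDeriv_eq_fderivWithin_target hy]
  exact (((contDiffOn_chart hf q) y hy).differentiableWithinAt one_ne_zero).hasFDerivWithinAt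

/-- Symmetry of the second differential in a chart, up to the boundary. -/
theorem exists_hasFDerivWithinAt_chartDeriv [IsManifold (𝓡∂ n) 2 M] {f : M → V}
    (hf : ContMDiff (𝓡∂ n) 𝓘(ℝ, V) 2 f) {q : M} {y : EuclideanSpace ℝ (Fin n)}
    (hy : y ∈ (extChartAt (𝓡∂ n) q).target) :
    ∃ Y'' : EuclideanSpace ℝ (Fin n) →L[ℝ] EuclideanSpace ℝ (Fin n) →L[ℝ] V,
      HasFDerivWithinAt (chartDeriv q f) Y'' (extChartAt (𝓡∂ n) q).target y ∧
      ∀ u v, Y'' u v = Y'' v u := by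
  have h1 := contDiffOn_chartDeriv hf (m := 1) (by norm_num) q
  refine ⟨fderivWithin ℝ (chartDeriv q f) (extChartAt (𝓡∂ n) q).target y,
    ((h1 y hy).differentiableWithinAt one_ne_zero).hasFDerivWithinAt, fun u v => ?_⟩
  -- Points of the model boundary are included: the chart target lies in the closure of its
  -- interior, which is what symmetry of the second derivative within a set requires.
  have hs : IsSymmSndFDerivWithinAt ℝ (f ∘ (extChartAt (𝓡∂ n) q).symm)
      (extChartAt (𝓡∂ n) q).target y :=
    (contDiffOn_chart hf q y hy).isSymmSndFDerivWithinAt (by simp) (uniqueDiffOn_target q)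
      (extChartAt_target_subset_closure_interior hy) hy
  have := hs u v
  rwa [← fderivWithin_congr (fun z hz => chartDeriv_eq_fderivWithin_target hz)
    (chartDeriv_eq_fderivWithin_target hy)] at this

end Charts

theorem exists_finite_cover_charts {n : ℕ} [NeZero n] (M : Type*) [TopologicalSpace M] [CompactSpace M]
    [ChartedSpace (EuclideanHalfSpace n) M] :
    ∃ t : Finset M, (⋃ q ∈ t, (extChartAt (𝓡∂ n) q).source) = univ := by
  obtain ⟨t, ht⟩ := isCompact_univ.elim_finite_subcover
    (fun q : M => (extChartAt (𝓡∂ n) q).source) (fun q => isOpen_extChartAt_source q)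
    (fun p _ => mem_iUnion.2 ⟨p, mem_extChartAt_source p⟩)
  exact ⟨t, univ_subset_iff.1 ht⟩

/-! ### The area measure and its expression in charts. -/

section ChartArea

variable {n : ℕ} [NeZero n] {M : Type*} [TopologicalSpace M]
  [ChartedSpace (EuclideanHalfSpace n) M]
variable [MeasurableSpace M] [BorelSpace M]

theorem aemeasurable_extChartAt_symm (q : M) : AEMeasurable (extChartAt (𝓡∂ n) q).symm
    (volume.restrict (extChartAt (𝓡∂ n) q).target) :=
  (continuousOn_extChartAt_symm q).aemeasurable (measurableSet_target q)

theorem chartArea_apply (x : M → E n) (q : M) {S : Set M} (hS : MeasurableSet S) :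
    chartArea x q S = ∫⁻ y in (extChartAt (𝓡∂ n) q).symm ⁻¹' S ∩ (extChartAt (𝓡∂ n) q).target,
      ENNReal.ofReal (areaDensity x q y) := by
  unfold chartArea
  rw [Measure.map_apply_of_aemeasurable
    ((aemeasurable_extChartAt_symm q).mono_ac (withDensity_absolutelyContinuous _ _)) hS,
    withDensity_apply', Measure.restrict_restrict' (measurableSet_target q)]

theorem chartArea_inter_source (x : M → E n) (q : M) {S : Set M} (hS : MeasurableSet S) :
    chartArea x q (S ∩ (extChartAt (𝓡∂ n) q).source) = chartArea x q S := by
  rw [chartArea_apply x q hS,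
    chartArea_apply x q (hS.inter (isOpen_extChartAt_source q).measurableSet)]
  congr 2
  ext y
  constructor
  · exact fun h => ⟨h.1.1, h.2⟩
  · exact fun h => ⟨⟨h.1, (extChartAt (𝓡∂ n) q).map_target h.2⟩, h.2⟩

end ChartArea

section Area

variable {n : ℕ} [NeZero n] {M : Type*} [TopologicalSpace M]
  [ChartedSpace (EuclideanHalfSpace n) M] [IsManifold (𝓡∂ n) 1 M]

/-- The Gram matrix in the chart is `C g Cᵀ`, with `C` the matrix of the chart Jacobian. The density
thus splits into a factor depending on the chart and one depending only on the point. -/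
theorem areaDensity_eq {x : M → E n} (hx : ContMDiff (𝓡∂ n) 𝓘(ℝ, E n) 1 x) {q : M}
    {y : EuclideanSpace ℝ (Fin n)} (hy : y ∈ (extChartAt (𝓡∂ n) q).target) :
    areaDensity x q y = |(chartJac q y).det| *
      Real.sqrt (firstForm x ((extChartAt (𝓡∂ n) q).symm y)).det := by
  set p := (extChartAt (𝓡∂ n) q).symm y with hp
  have hd : chartDeriv q x y = (diffAt x p).comp (chartJac q y) :=
    chartDeriv_eq hy ((hx p).mdifferentiableAt one_ne_zero)
  let C : Matrix (Fin n) (Fin n) ℝ := Matrix.of fun i j => chartJac q y (stdVec n i) j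
  have hC : C.det = (chartJac q y).det := by
    let b := (EuclideanSpace.basisFun (Fin n) ℝ).toBasis
    have h1 : (LinearMap.toMatrix b b (chartJac q y : EuclideanSpace ℝ (Fin n) →ₗ[ℝ] _)).det =
      (chartJac q y).det := LinearMap.det_toMatrix b _
    rw [← h1, ← Matrix.det_transpose]
    congr 1
  have hmat : (Matrix.of fun i j : Fin n =>
      hypInner (x p) (chartDeriv q x y (stdVec n i)) (chartDeriv q x y (stdVec n j))) =
      C * firstForm x p * C.transpose := by
    ext i j
    have hexp : ∀ i, chartDeriv q x y (stdVec n i) = ∑ k, C i k • frame x p k := by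
      intro i
      rw [hd, ContinuousLinearMap.comp_apply, eq_sum_stdVec (chartJac q y (stdVec n i)), map_sum]
      simp only [map_smul]
      rfl
    simp only [Matrix.of_apply, Matrix.mul_apply, firstForm, Matrix.transpose_apply, hexp,
      hypInner, sum_inner, inner_sum, inner_smul_left, inner_smul_right, RCLike.conj_to_real,
      Finset.sum_mul, Finset.sum_div]
    refine Finset.sum_congr rfl fun a _ => ?_
    rw [Finset.mul_sum, Finset.sum_div]
    exact Finset.sum_congr rfl fun b _ => by ring
  have : areaDensity x q y = Real.sqrt (C * firstForm x p * C.transpose).det := by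
    rw [← hmat]; rfl
  rw [this, Matrix.det_mul, Matrix.det_mul, Matrix.det_transpose, hC, ← Real.sqrt_sq_eq_abs,
    ← Real.sqrt_mul (sq_nonneg _)]
  congr 1
  ring

theorem continuousOn_areaDensity {x : M → E n} (hx : ContMDiff (𝓡∂ n) 𝓘(ℝ, E n) 1 x)
    (hU : ∀ p, x p ∈ upperHalf n) (q : M) :
    ContinuousOn (areaDensity x q) (extChartAt (𝓡∂ n) q).target := by
  have h1 : ContinuousOn (x ∘ (extChartAt (𝓡∂ n) q).symm) (extChartAt (𝓡∂ n) q).target :=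
    (contDiffOn_chart hx q).continuousOn
  have h2 : ContinuousOn (chartDeriv q x) (extChartAt (𝓡∂ n) q).target :=
    (contDiffOn_chartDeriv (m := 0) hx (by norm_num) q).continuousOn
  have h3 : ContinuousOn (fun y => (Matrix.of fun i j : Fin n =>
      hypInner (x ((extChartAt (𝓡∂ n) q).symm y)) (chartDeriv q x y (stdVec n i))
        (chartDeriv q x y (stdVec n j)))) (extChartAt (𝓡∂ n) q).target := by
    refine continuousOn_pi.2 fun i => continuousOn_pi.2 fun j => ?_
    simp only [Matrix.of_apply, hypInner]
    refine ContinuousOn.div (ContinuousOn.inner (𝕜 := ℝ) (h2.clm_apply continuousOn_const)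
      (h2.clm_apply continuousOn_const)) ?_ ?_
    · have : Continuous fun z : E n => z (Fin.last n) ^ 2 := by fun_prop
      exact this.comp_continuousOn h1
    · intro y _
      exact pow_ne_zero _ (ne_of_gt (hU _))
  exact ((continuous_id.matrix_det).comp_continuousOn h3).sqrt

variable [MeasurableSpace M] [BorelSpace M]

/-- The area measures of two charts agree on the overlap of their domains. -/
theorem chartArea_eq_of_subset {x : M → E n} (hx : ContMDiff (𝓡∂ n) 𝓘(ℝ, E n) 1 x) {q q' : M}
    {S : Set M} (hS : MeasurableSet S) (hq : S ⊆ (extChartAt (𝓡∂ n) q).source)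
    (hq' : S ⊆ (extChartAt (𝓡∂ n) q').source) : chartArea x q S = chartArea x q' S := by
  rw [chartArea_apply x q hS, chartArea_apply x q' hS]
  set s := (extChartAt (𝓡∂ n) q).symm ⁻¹' S ∩ (extChartAt (𝓡∂ n) q).target with hs
  -- The inverse chart is continuous only on its target, so measurability is obtained on the subtype
  -- and pushed forward.
  have hsm : MeasurableSet s := by
    have h := (MeasurableSet.subtype_image (measurableSet_target q)
      ((continuousOn_extChartAt_symm (I := 𝓡∂ n) q).domRestrict.measurable hS))
    convert h using 1
    ext y
    simp [hs, and_comm]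
  let ψ := extChartAt (𝓡∂ n) q' ∘ (extChartAt (𝓡∂ n) q).symm
  let ψ' : EuclideanSpace ℝ (Fin n) → EuclideanSpace ℝ (Fin n) →L[ℝ] EuclideanSpace ℝ (Fin n) :=
    fun y => (diffAt (extChartAt (𝓡∂ n) q') ((extChartAt (𝓡∂ n) q).symm y)).comp (chartJac q y)
  have himg : ψ '' s =
      (extChartAt (𝓡∂ n) q').symm ⁻¹' S ∩ (extChartAt (𝓡∂ n) q').target := by
    ext z
    constructor
    · rintro ⟨y, ⟨hyS, hyt⟩, rfl⟩
      have h := hq' hyS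
      refine ⟨?_, (extChartAt (𝓡∂ n) q').map_source h⟩
      rw [mem_preimage, show ψ y = extChartAt (𝓡∂ n) q' ((extChartAt (𝓡∂ n) q).symm y) from rfl,
        (extChartAt (𝓡∂ n) q').left_inv h]
      exact hyS
    · rintro ⟨hzS, hzt⟩
      have h := hq hzS
      refine ⟨extChartAt (𝓡∂ n) q ((extChartAt (𝓡∂ n) q').symm z), ⟨?_,
        (extChartAt (𝓡∂ n) q).map_source h⟩, ?_⟩
      · rw [mem_preimage, (extChartAt (𝓡∂ n) q).left_inv h]; exact hzS
      · simp only [ψ, comp_apply]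
        rw [(extChartAt (𝓡∂ n) q).left_inv h, (extChartAt (𝓡∂ n) q').right_inv hzt]
  have hinj : InjOn ψ s := by
    intro y hy z hz hyz
    have h1 := (extChartAt (𝓡∂ n) q').injOn (hq' hy.1) (hq' hz.1) hyz
    rw [← (extChartAt (𝓡∂ n) q).right_inv hy.2, h1, (extChartAt (𝓡∂ n) q).right_inv hz.2]
  have hder : ∀ y ∈ s, HasFDerivWithinAt ψ (ψ' y) s y := by
    intro y hy
    have h1 : MDifferentiableAt (𝓡∂ n) 𝓘(ℝ, EuclideanSpace ℝ (Fin n)) (extChartAt (𝓡∂ n) q')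
        ((extChartAt (𝓡∂ n) q).symm y) :=
      mdifferentiableAt_extChartAt (by simpa using hq' hy.1)
    have h2 := h1.hasMFDerivAt.comp_hasMFDerivWithinAt y
      (mdifferentiableWithinAt_extChartAt_symm hy.2).hasMFDerivWithinAt
    exact h2.hasFDerivWithinAt.mono fun z hz => extChartAt_target_subset_range q hz.2
  rw [← himg, lintegral_image_eq_lintegral_abs_det_fderiv_mul _ hsm hder hinj]
  refine setLIntegral_congr_fun hsm fun y hy => ?_
  rw [← ENNReal.ofReal_mul (abs_nonneg _), areaDensity_eq hx hy.2]
  have hp := hq' hy.1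
  have hψt : ψ y ∈ (extChartAt (𝓡∂ n) q').target := (extChartAt (𝓡∂ n) q').map_source hp
  have hback : (extChartAt (𝓡∂ n) q').symm (ψ y) = (extChartAt (𝓡∂ n) q).symm y :=
    (extChartAt (𝓡∂ n) q').left_inv hp
  rw [areaDensity_eq hx hψt, hback, ← mul_assoc, ← abs_mul]
  congr 3
  -- Chain rule: the second inverse chart after the transition map is the first inverse chart, so
  -- the Jacobian factors of the two densities match.
  have hcomp : (chartJac q' (ψ y)).comp (ψ' y) = chartJac q y := by
    have h1 := mfderivWithin_extChartAt_symm_comp_mfderiv_extChartAt' (I := 𝓡∂ n) hp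
    have h2 : (chartJac q' (ψ y)).comp
        (diffAt (extChartAt (𝓡∂ n) q') ((extChartAt (𝓡∂ n) q).symm y)) =
        ContinuousLinearMap.id ℝ (EuclideanSpace ℝ (Fin n)) := h1
    rw [← ContinuousLinearMap.comp_assoc, h2, ContinuousLinearMap.id_comp]
  rw [← hcomp, mul_comm]
  exact LinearMap.det_comp _ _

/-- The supremum defining `area` is a gluing. A finite chart cover is made disjoint and the chart
measures are summed over the pieces. By agreement on overlaps this sum dominates every `chartArea`,
and piece by piece it is dominated by the supremum, so it equals `area`. -/
theorem area_restrict_source [CompactSpace M] {x : M → E n}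
    (hx : ContMDiff (𝓡∂ n) 𝓘(ℝ, E n) 1 x) (q : M) :
    (area x).restrict (extChartAt (𝓡∂ n) q).source = chartArea x q := by
  have hle : ∀ q, chartArea x q ≤ area x := fun q => le_iSup (chartArea x) q
  obtain ⟨t, ht⟩ := exists_finite_cover_charts (n := n) M
  let U : M → Set M := fun q => (extChartAt (𝓡∂ n) q).source
  have hUm : ∀ q, MeasurableSet (U q) := fun q => (isOpen_extChartAt_source q).measurableSet
  let N := t.card
  let e : Fin N ≃ t := t.equivFin.symm
  let D : Fin N → Set M := disjointed fun i => U (e i)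
  have hDm : ∀ i, MeasurableSet (D i) := by
    intro i
    simp only [D, disjointed_apply, Finset.sup_set_eq_biUnion]
    exact (hUm _).diff (Finset.measurableSet_biUnion _ fun j _ => hUm _)
  have hDU : ∀ i, D i ⊆ U (e i) := fun i => disjointed_subset _ i
  have hDu : ⋃ i, D i = univ := by
    rw [iUnion_disjointed, ← univ_subset_iff, ← ht]
    refine iUnion₂_subset fun q hq => ?_
    intro p hp
    refine mem_iUnion.2 ⟨e.symm ⟨q, hq⟩, ?_⟩
    simpa [U] using hp
  have hDd : Pairwise (Disjoint on D) := disjoint_disjointed _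
  let μ : Measure M := Measure.sum fun i => (chartArea x (e i)).restrict (D i)
  have hsplit : ∀ (ν : Measure M) (S : Set M), MeasurableSet S → ν S = ∑' i, ν (S ∩ D i) := by
    intro ν S hS
    rw [← measure_iUnion (fun i j hij => (hDd hij).mono inter_subset_right inter_subset_right)
      (fun i => hS.inter (hDm i)), ← inter_iUnion, hDu, inter_univ]
  have hqμ : ∀ q (S : Set M), MeasurableSet S → chartArea x q S = μ (S ∩ U q) := by
    intro q S hS
    rw [← chartArea_inter_source x q hS, Measure.sum_apply _ (hS.inter (hUm q)),
      hsplit _ _ (hS.inter (hUm q))]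
    refine tsum_congr fun i => ?_
    rw [Measure.restrict_apply (hS.inter (hUm q))]
    exact chartArea_eq_of_subset hx ((hS.inter (hUm q)).inter (hDm i))
      (fun p hp => hp.1.2) (fun p hp => hDU i hp.2)
  have hμ : area x = μ := by
    refine le_antisymm (iSup_le fun q => Measure.le_iff.2 fun S hS => ?_)
      (Measure.le_iff.2 fun S hS => ?_)
    · rw [hqμ q S hS]; exact measure_mono inter_subset_left
    · rw [Measure.sum_apply _ hS, hsplit (area x) S hS]
      refine ENNReal.tsum_le_tsum fun i => ?_
      rw [Measure.restrict_apply hS]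
      exact hle _ _
  ext S hS
  rw [Measure.restrict_apply hS, hμ, hqμ q S hS]

end Area

/-! ### Integration over the manifold through charts and a partition of unity. -/

section Integration

variable {n : ℕ} [NeZero n] {M : Type*} [TopologicalSpace M] [CompactSpace M]
  [ChartedSpace (EuclideanHalfSpace n) M] [IsManifold (𝓡∂ n) 1 M]
  [MeasurableSpace M] [BorelSpace M]

/-- For a function vanishing outside one chart domain `area` can be replaced by `chartArea`, a
pushforward of a density, so both assertions become statements about Lebesgue measure on the target.
-/
theorem integrable_area_iff {x : M → E n} (hx : ContMDiff (𝓡∂ n) 𝓘(ℝ, E n) 1 x)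
    (hU : ∀ p, x p ∈ upperHalf n) {q : M} {f : M → ℝ}
    (hf : ContinuousOn f (extChartAt (𝓡∂ n) q).source)
    (h0 : ∀ p, p ∉ (extChartAt (𝓡∂ n) q).source → f p = 0) :
    (Integrable f (area x) ↔ IntegrableOn
      (fun y => areaDensity x q y * f ((extChartAt (𝓡∂ n) q).symm y))
      (extChartAt (𝓡∂ n) q).target) ∧
    ∫ p, f p ∂(area x) = ∫ y in (extChartAt (𝓡∂ n) q).target,
      areaDensity x q y * f ((extChartAt (𝓡∂ n) q).symm y) := by
  have hsm : MeasurableSet (extChartAt (𝓡∂ n) q).source :=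
    (isOpen_extChartAt_source q).measurableSet
  have hdens : AEMeasurable (fun y => (areaDensity x q y).toNNReal)
      (volume.restrict (extChartAt (𝓡∂ n) q).target) :=
    ((continuousOn_areaDensity hx hU q).aemeasurable (measurableSet_target q)).real_toNNReal
  have hsymm : AEMeasurable (extChartAt (𝓡∂ n) q).symm
      ((volume.restrict (extChartAt (𝓡∂ n) q).target).withDensity
        fun y => ENNReal.ofReal (areaDensity x q y)) :=
    (aemeasurable_extChartAt_symm q).mono_ac (withDensity_absolutelyContinuous _ _)
  have hres := area_restrict_source hx q
  have hfm : AEStronglyMeasurable f (chartArea x q) := by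
    rw [← hres]
    exact hf.aestronglyMeasurable hsm
  have hsmul : ∀ y, (areaDensity x q y).toNNReal • f ((extChartAt (𝓡∂ n) q).symm y) =
      areaDensity x q y * f ((extChartAt (𝓡∂ n) q).symm y) := by
    intro y
    have h : 0 ≤ areaDensity x q y := Real.sqrt_nonneg _
    rw [NNReal.smul_def, Real.coe_toNNReal _ h, smul_eq_mul]
  constructor
  · rw [← integrableOn_iff_integrable_of_support_subset
      (s := (extChartAt (𝓡∂ n) q).source) (f := f)]
    · rw [IntegrableOn, hres]
      unfold chartArea at hfm ⊢
      rw [integrable_map_measure hfm hsymm]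
      refine (integrable_withDensity_iff_integrable_smul₀ hdens).trans ?_
      simp only [comp_apply, hsmul]
      rfl
    · intro p hp
      by_contra hcon
      exact hp (h0 p hcon)
  · rw [← setIntegral_eq_integral_of_forall_compl_eq_zero h0, hres]
    unfold chartArea at hfm ⊢
    rw [integral_map hsymm hfm]
    refine (integral_withDensity_eq_integral_smul₀ hdens _).trans ?_
    simp only [hsmul]

/-- The target need not be compact; integrability comes from continuity on the compact image of `K`,
outside of which `g` is zero. -/
theorem integrableOn_target_of_tsupport [T2Space M] {q : M} {K : Set M} (hK : IsCompact K)
    (hKs : K ⊆ (extChartAt (𝓡∂ n) q).source) {g : EuclideanSpace ℝ (Fin n) → ℝ}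
    (hg : ContinuousOn g (extChartAt (𝓡∂ n) q).target)
    (h0 : ∀ y ∈ (extChartAt (𝓡∂ n) q).target, (extChartAt (𝓡∂ n) q).symm y ∉ K → g y = 0) :
    IntegrableOn g (extChartAt (𝓡∂ n) q).target := by
  have hc : IsCompact (extChartAt (𝓡∂ n) q '' K) :=
    hK.image_of_continuousOn ((continuousOn_extChartAt q).mono hKs)
  have hsub : extChartAt (𝓡∂ n) q '' K ⊆ (extChartAt (𝓡∂ n) q).target := by
    rintro _ ⟨p, hp, rfl⟩
    exact (extChartAt (𝓡∂ n) q).map_source (hKs hp)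
  refine ((hg.mono hsub).integrableOn_compact hc).of_forall_sdiff_eq_zero
    (measurableSet_target q) ?_
  rintro y ⟨hy, hyK⟩
  refine h0 y hy fun hcon => hyK ⟨_, hcon, (extChartAt (𝓡∂ n) q).right_inv hy⟩

theorem exists_partition_charts (M : Type*) [TopologicalSpace M] [CompactSpace M] [T2Space M]
    [ChartedSpace (EuclideanHalfSpace n) M] [IsManifold (𝓡∂ n) ∞ M] :
    ∃ (t : Finset M) (ρ : t → M → ℝ), (∀ i, ContMDiff (𝓡∂ n) 𝓘(ℝ, ℝ) ∞ (ρ i)) ∧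
      (∀ i, tsupport (ρ i) ⊆ (extChartAt (𝓡∂ n) (i : M)).source) ∧
      ∀ p, ∑ i, ρ i p = 1 := by
  obtain ⟨t, ht⟩ := exists_finite_cover_charts (n := n) M
  obtain ⟨ρ, hρ⟩ := SmoothPartitionOfUnity.exists_isSubordinate (𝓡∂ n) (s := (univ : Set M))
    isClosed_univ (fun i : t => (extChartAt (𝓡∂ n) (i : M)).source)
    (fun i => isOpen_extChartAt_source _) (by
      rw [← ht]
      exact iUnion₂_subset fun q hq => subset_iUnion_of_subset ⟨q, hq⟩ subset_rfl)
  refine ⟨t, fun i => ρ i, fun i => (ρ i).contMDiff, hρ, fun p => ?_⟩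
  have := ρ.sum_eq_one (mem_univ p)
  rwa [finsum_eq_sum_of_fintype] at this

theorem integrable_area_of_tsupport [T2Space M] {x : M → E n}
    (hx : ContMDiff (𝓡∂ n) 𝓘(ℝ, E n) 1 x)
    (hU : ∀ p, x p ∈ upperHalf n) {q : M} {f : M → ℝ} {K : Set M} (hK : IsClosed K)
    (hKs : K ⊆ (extChartAt (𝓡∂ n) q).source)
    (hf : ContinuousOn f (extChartAt (𝓡∂ n) q).source) (h0 : ∀ p, p ∉ K → f p = 0) :
    Integrable f (area x) := by
  refine (integrable_area_iff hx hU hf fun p hp => h0 p fun h => hp (hKs h)).1.2 ?_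
  refine integrableOn_target_of_tsupport hK.isCompact hKs
    ((continuousOn_areaDensity hx hU q).mul (hf.comp (continuousOn_extChartAt_symm q)
      fun y hy => (extChartAt (𝓡∂ n) q).map_target hy)) fun y _ hy => ?_
  rw [h0 _ hy, mul_zero]

end Integration

/-! ### Stokes' theorem on a compact manifold with boundary. -/

section Stokes

variable {n : ℕ} [NeZero n] {M : Type*} [TopologicalSpace M] [CompactSpace M] [T2Space M]
  [ChartedSpace (EuclideanHalfSpace n) M] [IsManifold (𝓡∂ n) ∞ M]

theorem integrable_area_of_continuous [MeasurableSpace M] [BorelSpace M] {x : M → E n}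
    (hx : ContMDiff (𝓡∂ n) 𝓘(ℝ, E n) 1 x) (hU : ∀ p, x p ∈ upperHalf n) {f : M → ℝ}
    (hf : Continuous f) : Integrable f (area x) := by
  have : IsManifold (𝓡∂ n) 1 M := IsManifold.of_le (n := ∞) (by simp)
  obtain ⟨t, ρ, hρ, hρs, hρ1⟩ := exists_partition_charts (n := n) M
  have : f = fun p => ∑ i, ρ i p * f p := by
    funext p
    rw [← Finset.sum_mul, hρ1, one_mul]
  rw [this]
  refine integrable_finsetSum _ fun i _ => ?_
  refine integrable_area_of_tsupport hx hU (isClosed_tsupport (ρ i)) (hρs i)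
    ((hρ i).continuous.mul hf).continuousOn fun p hp => ?_
  rw [image_eq_zero_of_notMem_tsupport hp, zero_mul]

variable {V W : Type*} [NormedAddCommGroup V] [NormedSpace ℝ V]
  [NormedAddCommGroup W] [NormedSpace ℝ W]

theorem contMDiff_one_of_infty {f : M → V} (hf : ContMDiff (𝓡∂ n) 𝓘(ℝ, V) ∞ f) :
    ContMDiff (𝓡∂ n) 𝓘(ℝ, V) 1 f := hf.of_le (by simp)

theorem chartDeriv_eq_comp {f : M → V} (hf : ContMDiff (𝓡∂ n) 𝓘(ℝ, V) 1 f) {q : M}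
    {y : EuclideanSpace ℝ (Fin n)} (hy : y ∈ (extChartAt (𝓡∂ n) q).target) :
    chartDeriv q f y = (diffAt f ((extChartAt (𝓡∂ n) q).symm y)).comp (chartJac q y) := by
  have : IsManifold (𝓡∂ n) 1 M := IsManifold.of_le (n := ∞) (by simp)
  exact chartDeriv_eq hy ((hf _).mdifferentiableAt one_ne_zero)

theorem diffAt_eq_zero_of_notMem_tsupport {f : M → V} {p : M} (hp : p ∉ tsupport f) :
    diffAt (n := n) f p = 0 := by
  have h : f =ᶠ[𝓝 p] fun _ => 0 := notMem_tsupport_iff_eventuallyEq.1 hp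
  have := h.mfderiv_eq (I := 𝓡∂ n) (I' := 𝓘(ℝ, V))
  unfold diffAt
  rw [this]
  exact mfderiv_const

/-- The Stokes density `d(β(w, dY, …, dY)) / α(dX, …, dX)`, a function on `M`. -/
def stokesRatio (α : M → W [⋀^Fin n]→L[ℝ] ℝ) (X : M → W) (β : M → V [⋀^Fin n]→L[ℝ] ℝ)
    (Y w : M → V) (p : M) : ℝ :=
  stokesSum (β p) (diffAt β p) (diffAt Y p) (w p) (diffAt w p) /
    α p fun j => diffAt X p (stdVec n j)

/-- Numerator and denominator are both multiplied by the determinant of the chart Jacobian. So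
`stokesRatio`, defined at each point through its preferred chart, is computed by the same formula in
any chart. -/
theorem stokesRatio_chart {α : M → W [⋀^Fin n]→L[ℝ] ℝ} {X : M → W}
    {β : M → V [⋀^Fin n]→L[ℝ] ℝ} {Y w : M → V}
    (hX : ContMDiff (𝓡∂ n) 𝓘(ℝ, W) 1 X)
    (hβ : ContMDiff (𝓡∂ n) 𝓘(ℝ, V [⋀^Fin n]→L[ℝ] ℝ) 1 β)
    (hY : ContMDiff (𝓡∂ n) 𝓘(ℝ, V) 1 Y) (hw : ContMDiff (𝓡∂ n) 𝓘(ℝ, V) 1 w)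
    {q : M} {y : EuclideanSpace ℝ (Fin n)} (hy : y ∈ (extChartAt (𝓡∂ n) q).target) :
    stokesRatio α X β Y w ((extChartAt (𝓡∂ n) q).symm y) =
      stokesSum (β ((extChartAt (𝓡∂ n) q).symm y)) (chartDeriv q β y) (chartDeriv q Y y)
        (w ((extChartAt (𝓡∂ n) q).symm y)) (chartDeriv q w y) /
      α ((extChartAt (𝓡∂ n) q).symm y) fun j => chartDeriv q X y (stdVec n j) := by
  have : IsManifold (𝓡∂ n) 1 M := IsManifold.of_le (n := ∞) (by simp)
  rw [chartDeriv_eq_comp hX hy, chartDeriv_eq_comp hβ hy, chartDeriv_eq_comp hY hy,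
    chartDeriv_eq_comp hw hy, stokesSum_comp]
  have := alternating_comp_eq_det_mul (α ((extChartAt (𝓡∂ n) q).symm y))
    (diffAt X ((extChartAt (𝓡∂ n) q).symm y)) (chartJac q y)
  simp only [ContinuousLinearMap.comp_apply]
  rw [this, mul_div_mul_left _ _ (chartJac_det_ne_zero hy)]
  rfl

theorem abs_volume_chart {x : M → E n} (hx : ContMDiff (𝓡∂ n) 𝓘(ℝ, E n) 1 x)
    {α : M → W [⋀^Fin n]→L[ℝ] ℝ} {X : M → W} (hX : ContMDiff (𝓡∂ n) 𝓘(ℝ, W) 1 X) {κ : ℝ}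
    (hα : ∀ p, |α p fun j => diffAt X p (stdVec n j)| = κ * Real.sqrt (firstForm x p).det)
    {q : M} {y : EuclideanSpace ℝ (Fin n)} (hy : y ∈ (extChartAt (𝓡∂ n) q).target) :
    |α ((extChartAt (𝓡∂ n) q).symm y) fun j => chartDeriv q X y (stdVec n j)| =
      κ * areaDensity x q y := by
  have : IsManifold (𝓡∂ n) 1 M := IsManifold.of_le (n := ∞) (by simp)
  rw [chartDeriv_eq_comp hX hy, areaDensity_eq hx hy]
  simp only [ContinuousLinearMap.comp_apply]
  rw [alternating_comp_eq_det_mul, abs_mul, hα]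
  ring

theorem continuousOn_alternating_apply {S : Set (EuclideanSpace ℝ (Fin n))}
    {α : EuclideanSpace ℝ (Fin n) → V [⋀^Fin n]→L[ℝ] ℝ}
    {v : EuclideanSpace ℝ (Fin n) → Fin n → V}
    (hα : ContinuousOn α S) (hv : ContinuousOn v S) : ContinuousOn (fun y => α y (v y)) S := by
  have h : Continuous fun z : (V [⋀^Fin n]→L[ℝ] ℝ) × (Fin n → V) => z.1 z.2 := by
    fun_prop
  exact h.comp_continuousOn (hα.prodMk hv)

end Stokes

section Stokes

variable {n : ℕ} [NeZero n] {M : Type*} [TopologicalSpace M] [CompactSpace M] [T2Space M]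
  [ChartedSpace (EuclideanHalfSpace n) M] [IsManifold (𝓡∂ n) ∞ M]
  {V W : Type*} [NormedAddCommGroup V] [NormedSpace ℝ V]
  [NormedAddCommGroup W] [NormedSpace ℝ W]

theorem stokesSum_zero (β : V [⋀^Fin n]→L[ℝ] ℝ)
    (dβ : EuclideanSpace ℝ (Fin n) →L[ℝ] V [⋀^Fin n]→L[ℝ] ℝ)
    (A : EuclideanSpace ℝ (Fin n) →L[ℝ] V) : stokesSum β dβ A 0 0 = 0 := by
  unfold stokesSum
  refine Finset.sum_eq_zero fun i _ => ?_
  rw [zero_apply, ContinuousAlternatingMap.map_update_zero,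
    ContinuousAlternatingMap.map_update_zero, add_zero]

/-- Lets the orientation sign of a chart be treated as a constant under differentiation. -/
theorem eventually_abs_div_self_eq {T : Type*} [TopologicalSpace T] {F : T → ℝ} {y : T}
    (hF : ContinuousAt F y) (h0 : F y ≠ 0) : ∀ᶠ z in 𝓝 y, |F z| / F z = |F y| / F y := by
  rcases lt_or_gt_of_ne h0 with h | h
  · filter_upwards [hF.eventually (gt_mem_nhds h)] with z hz
    rw [abs_of_neg hz, abs_of_neg h, neg_div_self hz.ne, neg_div_self h.ne]
  · filter_upwards [hF.eventually (lt_mem_nhds h)] with z hz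
    rw [abs_of_pos hz, abs_of_pos h, div_self hz.ne', div_self h.ne']

theorem continuousOn_update {T : Type*} [TopologicalSpace T] {S : Set T} {v : T → Fin n → V}
    (hv : ContinuousOn v S) (i : Fin n) {w : T → V} (hw : ContinuousOn w S) :
    ContinuousOn (fun y => update (v y) i (w y)) S := by
  refine continuousOn_pi.2 fun j => ?_
  by_cases h : j = i
  · subst h
    simpa using hw
  · simpa [h] using continuousOn_pi.1 hv j

/-- Stokes' theorem for a field supported in the domain of one chart. -/
theorem integral_stokesRatio_of_tsupport [MeasurableSpace M] [BorelSpace M] {x : M → E n}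
    (hx : ContMDiff (𝓡∂ n) 𝓘(ℝ, E n) 1 x) (hU : ∀ p, x p ∈ upperHalf n)
    {α : M → W [⋀^Fin n]→L[ℝ] ℝ} (hαc : Continuous α) {X : M → W}
    (hX : ContMDiff (𝓡∂ n) 𝓘(ℝ, W) 1 X) {κ : ℝ} (hκ : 0 < κ)
    (hα : ∀ p, |α p fun j => diffAt X p (stdVec n j)| = κ * Real.sqrt (firstForm x p).det)
    (hα0 : ∀ p, (α p fun j => diffAt X p (stdVec n j)) ≠ 0)
    {β : M → V [⋀^Fin n]→L[ℝ] ℝ} {Y w : M → V}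
    (hβ : ContMDiff (𝓡∂ n) 𝓘(ℝ, V [⋀^Fin n]→L[ℝ] ℝ) 1 β)
    (hY : ContMDiff (𝓡∂ n) 𝓘(ℝ, V) 2 Y) (hw : ContMDiff (𝓡∂ n) 𝓘(ℝ, V) 1 w) {q : M}
    (hsupp : tsupport w ⊆ (extChartAt (𝓡∂ n) q).source)
    (hbd : ∀ y ∈ (extChartAt (𝓡∂ n) q).target, y 0 = 0 →
      β ((extChartAt (𝓡∂ n) q).symm y) (update (fun j => chartDeriv q Y y (stdVec n j)) 0
        (w ((extChartAt (𝓡∂ n) q).symm y))) = 0) :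
    Integrable (stokesRatio α X β Y w) (area x) ∧
      ∫ p, stokesRatio α X β Y w p ∂(area x) = 0 := by
  have : IsManifold (𝓡∂ n) 1 M := IsManifold.of_le (n := ∞) (by simp)
  have : IsManifold (𝓡∂ n) 2 M := IsManifold.of_le (n := ∞) (WithTop.coe_le_coe.2 le_top)
  have hY1 : ContMDiff (𝓡∂ n) 𝓘(ℝ, V) 1 Y := hY.of_le (by norm_num)
  set φ := extChartAt (𝓡∂ n) q with hφ
  let F : EuclideanSpace ℝ (Fin n) → ℝ := fun y =>
    α (φ.symm y) fun j => chartDeriv q X y (stdVec n j)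
  let N : EuclideanSpace ℝ (Fin n) → ℝ := fun y =>
    stokesSum (β (φ.symm y)) (chartDeriv q β y) (chartDeriv q Y y) (w (φ.symm y))
      (chartDeriv q w y)
  have hsymm : ContinuousOn φ.symm φ.target := continuousOn_extChartAt_symm q
  have hmaps : MapsTo φ.symm φ.target φ.source := fun y hy => φ.map_target hy
  have cβ : ContinuousOn (fun y => β (φ.symm y)) φ.target :=
    hβ.continuous.comp_continuousOn hsymm
  have cw : ContinuousOn (fun y => w (φ.symm y)) φ.target :=
    hw.continuous.comp_continuousOn hsymm
  have cα : ContinuousOn (fun y => α (φ.symm y)) φ.target := hαc.comp_continuousOn hsymm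
  have cdβ : ContinuousOn (chartDeriv q β) φ.target :=
    (contDiffOn_chartDeriv (m := 0) hβ (by norm_num) q).continuousOn
  have cdY : ContinuousOn (chartDeriv q Y) φ.target :=
    (contDiffOn_chartDeriv (m := 0) hY1 (by norm_num) q).continuousOn
  have cdw : ContinuousOn (chartDeriv q w) φ.target :=
    (contDiffOn_chartDeriv (m := 0) hw (by norm_num) q).continuousOn
  have cdX : ContinuousOn (chartDeriv q X) φ.target :=
    (contDiffOn_chartDeriv (m := 0) hX (by norm_num) q).continuousOn
  have cframe : ContinuousOn (fun y => fun j => chartDeriv q Y y (stdVec n j)) φ.target :=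
    continuousOn_pi.2 fun j => cdY.clm_apply continuousOn_const
  have cF : ContinuousOn F φ.target :=
    continuousOn_alternating_apply cα (continuousOn_pi.2 fun j => cdX.clm_apply continuousOn_const)
  have cN : ContinuousOn N φ.target := by
    refine continuousOn_finsetSum _ fun i _ => ContinuousOn.add ?_ ?_
    · exact continuousOn_alternating_apply (cdβ.clm_apply continuousOn_const)
        (continuousOn_update cframe i cw)
    · exact continuousOn_alternating_apply cβ
        (continuousOn_update cframe i (cdw.clm_apply continuousOn_const))
  have hF0 : ∀ y ∈ φ.target, F y ≠ 0 := by
    intro y hy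
    have h1 : chartDeriv q X y = _ := chartDeriv_eq_comp hX hy
    simp only [F, h1, ContinuousLinearMap.comp_apply]
    rw [alternating_comp_eq_det_mul]
    exact mul_ne_zero (chartJac_det_ne_zero hy) (hα0 _)
  have hratio : ∀ y ∈ φ.target, stokesRatio α X β Y w (φ.symm y) = N y / F y :=
    fun y hy => stokesRatio_chart hX hβ hY1 hw hy
  have hK : IsCompact (tsupport w) := (isClosed_tsupport w).isCompact
  have hNK : ∀ y ∈ φ.target, φ.symm y ∉ tsupport w → N y = 0 := by
    intro y hy hyK
    have h1 : chartDeriv q w y = (diffAt w (φ.symm y)).comp (chartJac q y) :=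
      chartDeriv_eq_comp hw hy
    simp only [N, h1, diffAt_eq_zero_of_notMem_tsupport hyK, image_eq_zero_of_notMem_tsupport hyK,
      ContinuousLinearMap.zero_comp, stokesSum_zero]
  have hf0 : ∀ p, p ∉ tsupport w → stokesRatio α X β Y w p = 0 := by
    intro p hp
    simp only [stokesRatio, diffAt_eq_zero_of_notMem_tsupport hp,
      image_eq_zero_of_notMem_tsupport hp, stokesSum_zero, zero_div]
  have hfc : ContinuousOn (stokesRatio α X β Y w) φ.source := by
    have h1 : ContinuousOn (fun p => N (φ p) / F (φ p)) φ.source :=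
      ((cN.div cF hF0).comp (continuousOn_extChartAt q) fun p hp => φ.map_source hp)
    refine h1.congr fun p hp => ?_
    change _ = N (φ p) / F (φ p)
    rw [← hratio _ (φ.map_source hp), φ.left_inv hp]
  refine ⟨integrable_area_of_tsupport hx hU (isClosed_tsupport w) hsupp hfc hf0, ?_⟩
  rw [(integrable_area_iff hx hU hfc fun p hp => hf0 p fun h => hp (hsupp h)).2]
  -- The area density is `κ⁻¹ |F|`, so the integrand is `κ⁻¹` times the sign of `F` times `N`. The
  -- sign is locally constant and passes through the divergence; no orientation of `M` is needed.
  let sg : EuclideanSpace ℝ (Fin n) → ℝ := fun y => |F y| / F y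
  have csg : ContinuousOn sg φ.target := cF.abs.div cF hF0
  have hint1 : ∀ y ∈ φ.target, areaDensity x q y * stokesRatio α X β Y w (φ.symm y) =
      κ⁻¹ * (sg y * N y) := by
    intro y hy
    have h1 : |F y| = κ * areaDensity x q y := abs_volume_chart hx hX hα hy
    have := hF0 y hy
    rw [hratio y hy]
    simp only [sg, h1]
    field_simp
  rw [setIntegral_congr_fun (measurableSet_target q) hint1, integral_const_mul]
  refine mul_eq_zero_of_right _ ?_
  classical
  let K : Set (EuclideanSpace ℝ (Fin n)) := φ '' tsupport w
  have hKc : IsCompact K := hK.image_of_continuousOn ((continuousOn_extChartAt q).mono hsupp)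
  have hnotK : ∀ y ∈ φ.target, y ∉ K → φ.symm y ∉ tsupport w :=
    fun y hy hyK hcon => hyK ⟨_, hcon, φ.right_inv hy⟩
  have hKt : ∀ y, y ∉ φ.target → y ∉ K := by
    rintro y hy ⟨p, hp, rfl⟩
    exact hy (φ.map_source (hsupp hp))
  let b : Fin n → EuclideanSpace ℝ (Fin n) → ℝ := fun i y =>
    β (φ.symm y) (update (fun j => chartDeriv q Y y (stdVec n j)) i (w (φ.symm y)))
  let η : Fin n → EuclideanSpace ℝ (Fin n) → ℝ := fun i y =>
    if y ∈ φ.target then sg y * b i y else 0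
  let d : EuclideanSpace ℝ (Fin n) → ℝ := fun y => if y ∈ φ.target then sg y * N y else 0
  have hηK : ∀ i y, y ∉ K → η i y = 0 := by
    intro i y hy
    simp only [η]
    split_ifs with h
    · simp only [b, image_eq_zero_of_notMem_tsupport (hnotK y h hy),
        ContinuousAlternatingMap.map_update_zero, mul_zero]
    · rfl
  have hdK : ∀ y, y ∉ K → d y = 0 := by
    intro y hy
    simp only [d]
    split_ifs with h
    · rw [hNK y h (hnotK y h hy), mul_zero]
    · rfl
  have cη : ∀ i, ContinuousOn (η i) φ.target := fun i =>
    (csg.mul (continuousOn_alternating_apply cβ (continuousOn_update cframe i cw))).congr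
      fun y hy => by simp [η, b, hy]
  -- `K` is closed and contained in the target, so the extension by zero vanishes near each point
  -- outside the target and is smooth there too.
  have hzero : ∀ i y, y ∉ φ.target → η i =ᶠ[𝓝 y] fun _ => 0 := fun i y hy =>
    Filter.mem_of_superset (hKc.isClosed.isOpen_compl.mem_nhds (hKt y hy)) fun z hz => hηK i z hz
  have hder : ∀ y : EuclideanSpace ℝ (Fin n), 0 < y 0 →
      ∃ η' : Fin n → EuclideanSpace ℝ (Fin n) →L[ℝ] ℝ,
        (∀ i, HasFDerivAt (η i) (η' i) y) ∧ ∑ i, η' i (stdVec n i) = d y := by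
    intro y hy0
    by_cases hy : y ∈ φ.target
    · have hnhds := target_mem_nhds hy hy0
      obtain ⟨Y'', hY'', hsym⟩ := exists_hasFDerivWithinAt_chartDeriv hY hy
      obtain ⟨b', hb', hsum⟩ := exists_hasFDerivAt_cofactor (hasFDerivAt_chart hβ hy hy0)
        (hY''.hasFDerivAt hnhds) (hasFDerivAt_chart hw hy hy0) hsym
      refine ⟨fun i => sg y • b' i, fun i => ?_, ?_⟩
      · refine ((hb' i).const_mul (sg y)).congr_of_eventuallyEq ?_
        filter_upwards [hnhds, eventually_abs_div_self_eq (cF.continuousAt hnhds) (hF0 y hy)]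
          with z hz hz2
        have hz' : z ∈ φ.target := hz
        simp only [η, if_pos hz', b]
        rw [show sg z = sg y from hz2]
        rfl
      · simp only [d, if_pos hy, _root_.smul_apply, smul_eq_mul, ← Finset.mul_sum]
        rw [hsum]
        rfl
    · refine ⟨fun i => 0, fun i => (hasFDerivAt_const (0 : ℝ) y).congr_of_eventuallyEq
        (hzero i y hy), ?_⟩
      simp only [d, if_neg hy, zero_apply, Finset.sum_const_zero]
  choose! η' hη' using hder
  have hsub : φ.target ⊆ {y : EuclideanSpace ℝ (Fin n) | 0 ≤ y 0} := by
    rw [← range_model]; exact extChartAt_target_subset_range q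
  have hHm : MeasurableSet {y : EuclideanSpace ℝ (Fin n) | 0 ≤ y 0} := by
    rw [← range_model]; exact (𝓡∂ n).isClosed_range.measurableSet
  have hdt : IntegrableOn d φ.target := by
    refine integrableOn_target_of_tsupport hK hsupp
      ((csg.mul cN).congr fun y hy => if_pos hy) fun y hy hyK => ?_
    simp only [d, hNK y hy hyK, mul_zero, ite_self]
  have hz : ∫ y in {y : EuclideanSpace ℝ (Fin n) | 0 ≤ y 0}, d y = 0 := by
    refine setIntegral_divergence_halfSpace_eq_zero hKc η (fun i y => η' y i) d
      (fun i y _ => hηK i y) (fun i y hy => ?_) (fun y hy i => (hη' y hy).1 i)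
      (fun y hy => (hη' y hy).2) (hdt.of_forall_sdiff_eq_zero hHm fun y hy => if_neg hy.2)
      hdK (fun y hy => ?_)
    · by_cases hyt : y ∈ φ.target
      · refine (cη i y hyt).mono_of_mem_nhdsWithin ?_
        have := target_mem_nhdsWithin hyt
        rwa [range_model] at this
      · exact ((hzero i y hyt).continuousAt).continuousWithinAt
    · simp only [η]
      split_ifs with h
      · simp only [b]
        rw [hbd y h hy, mul_zero]
      · rfl
  rw [← hz]
  rw [setIntegral_eq_of_subset_of_forall_sdiff_eq_zero (f := d) hHm hsub fun y hy => if_neg hy.2]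
  exact setIntegral_congr_fun (measurableSet_target q) fun y hy => (if_pos hy).symm

theorem hasFDerivWithinAt_diffAt {f : M → V} {p : M}
    (hf : MDifferentiableAt (𝓡∂ n) 𝓘(ℝ, V) f p) :
    HasFDerivWithinAt (f ∘ (extChartAt (𝓡∂ n) p).symm) (diffAt f p) (range (𝓡∂ n))
      (extChartAt (𝓡∂ n) p p) :=
  hf.hasMFDerivAt.2

theorem diffAt_eq_of_hasFDerivWithinAt {f : M → V} {p : M} (hc : ContinuousAt f p)
    {f' : EuclideanSpace ℝ (Fin n) →L[ℝ] V}
    (h : HasFDerivWithinAt (f ∘ (extChartAt (𝓡∂ n) p).symm) f' (range (𝓡∂ n))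
      (extChartAt (𝓡∂ n) p p)) : diffAt f p = f' :=
  HasMFDerivAt.mfderiv (I := 𝓡∂ n) (I' := 𝓘(ℝ, V)) ⟨hc, h⟩

theorem diffAt_comp {g : V → W} {g' : V →L[ℝ] W} {f : M → V} {p : M}
    (hg : HasFDerivAt g g' (f p)) (hf : MDifferentiableAt (𝓡∂ n) 𝓘(ℝ, V) f p) :
    diffAt (n := n) (fun p => g (f p)) p = g'.comp (diffAt f p) := by
  refine diffAt_eq_of_hasFDerivWithinAt (hg.continuousAt.comp hf.continuousAt) ?_
  refine HasFDerivAt.comp_hasFDerivWithinAt _ ?_ (hasFDerivWithinAt_diffAt hf)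
  rwa [comp_apply, extChartAt_to_inv]

theorem diffAt_smul {ρ : M → ℝ} {w : M → V} (hρ : ContMDiff (𝓡∂ n) 𝓘(ℝ, ℝ) 1 ρ)
    (hw : ContMDiff (𝓡∂ n) 𝓘(ℝ, V) 1 w) (p : M) :
    diffAt (n := n) (fun p => ρ p • w p) p = ρ p • diffAt w p + (diffAt ρ p).smulRight (w p) := by
  have h1 := hasFDerivWithinAt_diffAt ((hρ p).mdifferentiableAt one_ne_zero)
  have h2 := hasFDerivWithinAt_diffAt ((hw p).mdifferentiableAt one_ne_zero)
  refine diffAt_eq_of_hasFDerivWithinAt (hρ.smul hw).continuous.continuousAt ?_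
  have h := h1.smul h2
  rw [comp_apply, comp_apply, extChartAt_to_inv] at h
  exact h

/-- Stokes' theorem on a compact manifold with boundary, in the form
`∫ d(β(w, dY, …, dY)) = 0` when the form `β(w, dY, …, dY)` vanishes on the boundary. -/
theorem integral_stokesRatio [MeasurableSpace M] [BorelSpace M] {x : M → E n}
    (hx : ContMDiff (𝓡∂ n) 𝓘(ℝ, E n) 1 x) (hU : ∀ p, x p ∈ upperHalf n)
    {α : M → W [⋀^Fin n]→L[ℝ] ℝ} (hαc : Continuous α) {X : M → W}
    (hX : ContMDiff (𝓡∂ n) 𝓘(ℝ, W) 1 X) {κ : ℝ} (hκ : 0 < κ)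
    (hα : ∀ p, |α p fun j => diffAt X p (stdVec n j)| = κ * Real.sqrt (firstForm x p).det)
    (hα0 : ∀ p, (α p fun j => diffAt X p (stdVec n j)) ≠ 0)
    {β : M → V [⋀^Fin n]→L[ℝ] ℝ} {Y w : M → V}
    (hβ : ContMDiff (𝓡∂ n) 𝓘(ℝ, V [⋀^Fin n]→L[ℝ] ℝ) 1 β)
    (hY : ContMDiff (𝓡∂ n) 𝓘(ℝ, V) 2 Y) (hw : ContMDiff (𝓡∂ n) 𝓘(ℝ, V) 1 w)
    (hbd : ∀ q, ∀ y ∈ (extChartAt (𝓡∂ n) q).target, y 0 = 0 →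
      β ((extChartAt (𝓡∂ n) q).symm y) (update (fun j => chartDeriv q Y y (stdVec n j)) 0
        (w ((extChartAt (𝓡∂ n) q).symm y))) = 0) :
    Integrable (stokesRatio α X β Y w) (area x) ∧
      ∫ p, stokesRatio α X β Y w p ∂(area x) = 0 := by
  obtain ⟨t, ρ, hρ, hρs, hρ1⟩ := exists_partition_charts (n := n) M
  have hρw : ∀ i, ContMDiff (𝓡∂ n) 𝓘(ℝ, V) 1 fun p => ρ i p • w p := fun i =>
    (contMDiff_one_of_infty (hρ i)).smul hw
  have hloc : ∀ i, Integrable (stokesRatio α X β Y fun p => ρ i p • w p) (area x) ∧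
      ∫ p, stokesRatio α X β Y (fun p => ρ i p • w p) p ∂(area x) = 0 := by
    intro i
    refine integral_stokesRatio_of_tsupport hx hU hαc hX hκ hα hα0 hβ hY (hρw i) (q := i)
      ((tsupport_smul_subset_left (ρ i) w).trans (hρs i)) fun y hy hy0 => ?_
    rw [ContinuousAlternatingMap.map_update_smul, hbd i y hy hy0, smul_zero]
  -- The `ρ i` sum to one, so their differentials sum to zero and the terms with `dρ i` cancel when
  -- the local identities are added.
  have hd0 : ∀ p, ∑ i, diffAt (n := n) (ρ i) p = 0 := by
    intro p
    have h1 : HasFDerivWithinAt (fun y => ∑ i, (ρ i ∘ (extChartAt (𝓡∂ n) p).symm) y)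
        (∑ i, diffAt (n := n) (ρ i) p) (range (𝓡∂ n)) (extChartAt (𝓡∂ n) p p) :=
      HasFDerivWithinAt.fun_sum fun i _ => hasFDerivWithinAt_diffAt
        (((contMDiff_one_of_infty (hρ i)) p).mdifferentiableAt one_ne_zero)
    have h2 : (fun y => ∑ i, (ρ i ∘ (extChartAt (𝓡∂ n) p).symm) y) = fun _ => (1 : ℝ) :=
      funext fun y => hρ1 _
    rw [h2] at h1
    exact ((𝓡∂ n).uniqueDiffOn _ (mem_range_self _)).eq h1 (hasFDerivWithinAt_const _ _ _)
  have hsum : stokesRatio α X β Y w = fun p => ∑ i, stokesRatio α X β Y (fun p => ρ i p • w p) p := by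
    funext p
    simp only [stokesRatio, ← Finset.sum_div]
    congr 1
    -- `stokesSum` is additive in the pair `(w, dw)`, which lets the finite sum move inside.
    let S : V × (EuclideanSpace ℝ (Fin n) →L[ℝ] V) →+ ℝ :=
      { toFun := fun z => stokesSum (β p) (diffAt β p) (diffAt Y p) z.1 z.2
        map_zero' := stokesSum_zero _ _ _
        map_add' := fun z z' => stokesSum_add_right _ _ _ _ _ _ _ }
    have h1 : ∀ i, stokesSum (β p) (diffAt β p) (diffAt Y p) (ρ i p • w p)
        (diffAt (fun p => ρ i p • w p) p) =
          S (ρ i p • w p, diffAt (n := n) (fun p => ρ i p • w p) p) :=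
      fun i => rfl
    simp only [h1, ← map_sum]
    have h2 : ∑ i, (ρ i p • w p, diffAt (n := n) (fun p => ρ i p • w p) p) =
        (w p, diffAt (n := n) w p) := by
      rw [Prod.ext_iff]
      constructor
      · rw [Prod.fst_sum]
        simp only [← Finset.sum_smul, hρ1, one_smul]
      · rw [Prod.snd_sum]
        simp only [fun i => diffAt_smul (contMDiff_one_of_infty (hρ i)) hw p, Finset.sum_add_distrib,
          ← Finset.sum_smul, hρ1, one_smul]
        have : ∑ i, (diffAt (n := n) (ρ i) p).smulRight (w p) =
            (∑ i, diffAt (n := n) (ρ i) p).smulRight (w p) := by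
          ext v
          simp [Finset.sum_smul]
        rw [this, hd0]
        ext v
        simp
    rw [h2]
    rfl
  rw [hsum]
  refine ⟨integrable_finsetSum _ fun i _ => (hloc i).1, ?_⟩
  rw [integral_finsetSum _ fun i _ => (hloc i).1]
  exact Finset.sum_eq_zero fun i _ => (hloc i).2

end Stokes

end

section

open Matrix Polynomial

open scoped MatrixOrder

/-! ### Linear algebra of the pencil `g + s h`. -/

section Pencil

variable {n : ℕ}

/-- Cramer's rule: a determinant with row `i` replaced is the pairing of the new row with the
cofactors of that row. -/
theorem sum_det_updateRow_eq_trace (Q b : Matrix (Fin n) (Fin n) ℝ) :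
    ∑ i, (Q.updateRow i (b i)).det = (b * Q.adjugate).trace := by
  simp only [Matrix.trace, Matrix.diag_apply, Matrix.mul_apply]
  refine Finset.sum_congr rfl fun i _ => ?_
  rw [← Matrix.cramer_transpose_apply, Matrix.cramer_eq_adjugate_mulVec, ← Matrix.adjugate_transpose]
  simp [Matrix.mulVec, dotProduct, mul_comm]

/-- `1 + sA` commutes with its own adjugate; the identity part cancels and `s` is divided out, the
case `s = 0` being trivial. -/
theorem commute_adjugate_one_add_smul (A : Matrix (Fin n) (Fin n) ℝ) (s : ℝ) :
    A * (1 + s • A).adjugate = (1 + s • A).adjugate * A := by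
  by_cases hs : s = 0
  · simp [hs]
  have h := (Matrix.mul_adjugate (1 + s • A)).trans (Matrix.adjugate_mul (1 + s • A)).symm
  rw [add_mul, mul_add, one_mul, mul_one, Matrix.smul_mul, Matrix.mul_smul] at h
  exact smul_right_injective _ hs (add_left_cancel h)

theorem trace_mul_eq_zero_of_antisymm {K S : Matrix (Fin n) (Fin n) ℝ} (hK : Kᵀ = -K)
    (hS : Sᵀ = S) : (K * S).trace = 0 := by
  have h : (K * S).trace = -(K * S).trace := by
    conv_lhs => rw [← Matrix.trace_transpose, Matrix.transpose_mul, hK, hS, Matrix.mul_neg,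
      Matrix.trace_neg, Matrix.trace_mul_comm]
  linarith

/-- With `A = h g⁻¹` one has `adj(g + s h) = det g · g⁻¹ adj(1 + sA)`. The left side is symmetric,
so it kills `K₀` under the trace. Its product with `A` is symmetric as well, because `A` commutes
with `adj(1 + sA)`; cyclicity of the trace then kills `A K₁`. Only the terms with `σ` and `τ`
survive. -/
theorem trace_mul_adjugate_pencil {g h K₀ K₁ : Matrix (Fin n) (Fin n) ℝ} (hg : gᵀ = g)
    (hg0 : g.det ≠ 0) (hh : hᵀ = h) (hK₀ : K₀ᵀ = -K₀) (hK₁ : K₁ᵀ = -K₁) (σ τ s : ℝ) :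
    ((K₀ + h * g⁻¹ * K₁ + σ • g - τ • h) * (g + s • h).adjugate).trace =
      g.det * (σ * (1 + s • (h * g⁻¹)).adjugate.trace -
        τ * (h * g⁻¹ * (1 + s • (h * g⁻¹)).adjugate).trace) := by
  have hu : IsUnit g.det := isUnit_iff_ne_zero.2 hg0
  have hgi : (g⁻¹)ᵀ = g⁻¹ := by rw [Matrix.transpose_nonsing_inv, hg]
  set A := h * g⁻¹ with hA
  have hAg : A * g = h := by rw [hA, Matrix.mul_assoc, Matrix.nonsing_inv_mul _ hu, mul_one]
  have hQ : g + s • h = (1 + s • A) * g := by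
    rw [add_mul, one_mul, Matrix.smul_mul, hAg]
  have hadj : (g + s • h).adjugate = g.det • (g⁻¹ * (1 + s • A).adjugate) := by
    rw [hQ, Matrix.adjugate_mul_distrib, Matrix.inv_def, Ring.inverse_eq_inv',
      Matrix.smul_mul, smul_smul, mul_inv_cancel₀ hg0, one_smul]
  have hsym : ((g + s • h).adjugate)ᵀ = (g + s • h).adjugate := by
    rw [Matrix.adjugate_transpose, Matrix.transpose_add, Matrix.transpose_smul, hg, hh]
  have hcomm := commute_adjugate_one_add_smul A s
  have hsymA : ((g + s • h).adjugate * A)ᵀ = (g + s • h).adjugate * A := by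
    have h1 : ((g + s • h).adjugate * A) = g.det • (g⁻¹ * h * (g⁻¹ * (1 + s • A).adjugate)) := by
      rw [hadj, Matrix.smul_mul, Matrix.mul_assoc, ← hcomm, hA]
      simp only [Matrix.mul_assoc]
    rw [Matrix.transpose_mul, hsym, h1, hA, Matrix.transpose_mul, hgi, hh, hadj, Matrix.mul_smul]
  rw [Matrix.sub_mul, Matrix.add_mul, Matrix.add_mul, Matrix.trace_sub, Matrix.trace_add,
    Matrix.trace_add, trace_mul_eq_zero_of_antisymm hK₀ hsym, Matrix.mul_assoc A,
    Matrix.trace_mul_comm A, Matrix.mul_assoc K₁, trace_mul_eq_zero_of_antisymm hK₁ hsymA,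
    Matrix.smul_mul, Matrix.smul_mul, Matrix.trace_smul, Matrix.trace_smul, hadj,
    Matrix.mul_smul, Matrix.mul_smul, Matrix.trace_smul, Matrix.trace_smul, ← Matrix.mul_assoc,
    Matrix.mul_nonsing_inv _ hu, one_mul, ← Matrix.mul_assoc, ← hA]
  simp only [smul_eq_mul]
  ring

/-- Write `g = BᵀB`. Then `g⁻¹ h` is conjugate through `B` to the symmetric matrix `B⁻ᵀ h B⁻¹`,
which the spectral theorem diagonalizes. -/
theorem exists_diagonalization_pencil {g h : Matrix (Fin n) (Fin n) ℝ} (hg : g.PosDef)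
    (hh : hᵀ = h) : ∃ (C : (Matrix (Fin n) (Fin n) ℝ)ˣ) (d : Fin n → ℝ),
      g⁻¹ * h = C.val * Matrix.diagonal d * C⁻¹.val := by
  obtain ⟨B, hB⟩ : ∃ B : Matrix (Fin n) (Fin n) ℝ, g = Bᵀ * B := by
    have h1 := (CFC.sqrt_nonneg g).posSemidef.isHermitian
    rw [Matrix.IsHermitian, Matrix.conjTranspose_eq_transpose_of_trivial] at h1
    exact ⟨CFC.sqrt g, by rw [h1, CFC.sqrt_mul_sqrt_self g hg.posSemidef.nonneg]⟩
  have hB0 : B.det ≠ 0 := by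
    intro h0
    have := hg.det_pos
    rw [hB, Matrix.det_mul, h0, mul_zero] at this
    exact lt_irrefl _ this
  have hu : IsUnit B.det := isUnit_iff_ne_zero.2 hB0
  have hN : (B⁻¹ᵀ * h * B⁻¹).IsHermitian := by
    rw [Matrix.IsHermitian, Matrix.conjTranspose_eq_transpose_of_trivial, Matrix.transpose_mul,
      Matrix.transpose_mul, Matrix.transpose_transpose, hh, Matrix.mul_assoc]
  have hspec := hN.spectral_theorem
  let U : (Matrix (Fin n) (Fin n) ℝ)ˣ := Unitary.toUnits hN.eigenvectorUnitary
  let Bu : (Matrix (Fin n) (Fin n) ℝ)ˣ := Matrix.nonsingInvUnit B hu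
  refine ⟨Bu⁻¹ * U, hN.eigenvalues, ?_⟩
  have h1 : B⁻¹ᵀ * h * B⁻¹ = U.val * Matrix.diagonal hN.eigenvalues * U⁻¹.val := by
    conv_lhs => rw [hspec]
    rfl
  have h2 : g⁻¹ * h = B⁻¹ * (B⁻¹ᵀ * h * B⁻¹) * B := by
    rw [hB, Matrix.mul_inv_rev, ← Matrix.transpose_nonsing_inv]
    simp only [Matrix.mul_assoc]
    rw [Matrix.nonsing_inv_mul _ hu, mul_one]
  rw [h2]
  conv_lhs => rw [h1]
  have h3 : Bu⁻¹.val = B⁻¹ := rfl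
  rw [_root_.mul_inv_rev, inv_inv, Units.val_mul, Units.val_mul, h3]
  change _ = B⁻¹ * U.val * _ * (U⁻¹.val * B)
  simp only [Matrix.mul_assoc]

theorem coeff_prod_one_add_mul_X (d : Fin n → ℝ) (k : ℕ) :
    (∏ i, (1 + C (d i) * X)).coeff k = (Finset.univ.val.map d).esymm k := by
  rw [Finset.prod_one_add, Polynomial.finsetSum_coeff, Finset.esymm_map_val]
  have h1 : ∀ t : Finset (Fin n), (∏ i ∈ t, C (d i) * X).coeff k =
      if t.card = k then ∏ i ∈ t, d i else 0 := by
    intro t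
    rw [Finset.prod_mul_distrib, Finset.prod_const, ← map_prod, Polynomial.coeff_C_mul_X_pow]
    simp only [eq_comm]
  simp only [h1]
  rw [← Finset.sum_filter, Finset.powersetCard_eq_filter]

theorem trace_adjugate_one_add_diagonal (d : Fin n → ℝ) (s : ℝ) :
    (1 + s • Matrix.diagonal d).adjugate = Matrix.diagonal fun i =>
      ∏ j ∈ Finset.univ.erase i, (1 + s * d j) := by
  have : (1 + s • Matrix.diagonal d : Matrix (Fin n) (Fin n) ℝ) =
      Matrix.diagonal fun i => 1 + s * d i := by
    rw [← Matrix.diagonal_one, ← Matrix.diagonal_smul, Matrix.diagonal_add]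
    rfl
  rw [this, Matrix.adjugate_diagonal]

/-- The traces occurring in the divergence of the parallel hypersurfaces are polynomials in the
distance with coefficients given by the elementary symmetric functions of the principal
curvatures. -/
theorem exists_polynomial_trace_adjugate {g h : Matrix (Fin n) (Fin n) ℝ} (hg : g.PosDef)
    (hh : hᵀ = h) (σ τ : ℝ) : ∃ q : ℝ[X], q.natDegree ≤ n ∧
      (∀ s, q.eval s = σ * (1 + s • (h * g⁻¹)).adjugate.trace -
        τ * (h * g⁻¹ * (1 + s • (h * g⁻¹)).adjugate).trace) ∧
      ∀ k, q.coeff k = σ * ((n - k) * (g⁻¹ * h).charpoly.roots.esymm k) -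
        τ * ((k + 1) * (g⁻¹ * h).charpoly.roots.esymm (k + 1)) := by
  obtain ⟨Cm, d, hd⟩ := exists_diagonalization_pencil hg hh
  have hu : IsUnit g.det := isUnit_iff_ne_zero.2 hg.det_pos.ne'
  let gu : (Matrix (Fin n) (Fin n) ℝ)ˣ := Matrix.nonsingInvUnit g hu
  let S : (Matrix (Fin n) (Fin n) ℝ)ˣ := gu * Cm
  have hA : h * g⁻¹ = S.val * Matrix.diagonal d * S⁻¹.val := by
    have h1 : h * g⁻¹ = g * (g⁻¹ * h) * g⁻¹ := by
      rw [← Matrix.mul_assoc, Matrix.mul_nonsing_inv _ hu, one_mul]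
    rw [h1, hd]
    change _ = (g * Cm.val) * _ * (gu * Cm)⁻¹.val
    rw [_root_.mul_inv_rev, Units.val_mul]
    change _ = (g * Cm.val) * _ * (_ * g⁻¹)
    simp only [Matrix.mul_assoc]
  -- The characteristic polynomial splits over `ℝ`, so its multiset of roots lists all `n`
  -- eigenvalues and `esymm` is the full elementary symmetric function.
  have hroots : (g⁻¹ * h).charpoly.roots = Finset.univ.val.map d := by
    rw [hd, Matrix.coe_units_inv, Matrix.charpoly_units_conj, Matrix.charpoly_diagonal]
    exact Polynomial.roots_multiset_prod_X_sub_C (Finset.univ.val.map d) |>.symm ▸ by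
      rw [Multiset.map_map]; rfl
  have hadjS : ∀ s : ℝ, (1 + s • (h * g⁻¹)).adjugate =
      S.val * (1 + s • Matrix.diagonal d).adjugate * S⁻¹.val := by
    intro s
    have hSS : S.val * S⁻¹.val = 1 := S.mul_inv
    have h1 : 1 + s • (h * g⁻¹) = S.val * (1 + s • Matrix.diagonal d) * S⁻¹.val := by
      rw [hA, mul_add, add_mul, mul_one, hSS, Matrix.mul_smul, Matrix.smul_mul]
    have hdet : S.val.det * S⁻¹.val.det = 1 := by rw [← Matrix.det_mul, hSS, Matrix.det_one]
    have ha : S⁻¹.val.adjugate = S⁻¹.val.det • S.val := by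
      have h2 := Matrix.mul_adjugate S⁻¹.val
      calc S⁻¹.val.adjugate = S.val * (S⁻¹.val * S⁻¹.val.adjugate) := by
            rw [← Matrix.mul_assoc, hSS, one_mul]
        _ = _ := by rw [h2, Matrix.mul_smul, mul_one]
    have hb : S.val.adjugate = S.val.det • S⁻¹.val := by
      have h2 := Matrix.adjugate_mul S.val
      calc S.val.adjugate = S.val.adjugate * S.val * S⁻¹.val := by
            rw [Matrix.mul_assoc, hSS, mul_one]
        _ = _ := by rw [h2, Matrix.smul_mul, one_mul]
    rw [h1, Matrix.adjugate_mul_distrib, Matrix.adjugate_mul_distrib, ha, hb, Matrix.smul_mul,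
      Matrix.mul_smul, Matrix.mul_smul, smul_smul, mul_comm, hdet, one_smul, Matrix.mul_assoc]
  have htr : ∀ N : Matrix (Fin n) (Fin n) ℝ, (S.val * N * S⁻¹.val).trace = N.trace := by
    intro N
    rw [Matrix.mul_assoc, Matrix.trace_mul_comm, Matrix.mul_assoc, S.inv_mul, mul_one]
  have htr1 : ∀ s : ℝ, (1 + s • (h * g⁻¹)).adjugate.trace =
      ∑ i, ∏ j ∈ Finset.univ.erase i, (1 + s * d j) := by
    intro s
    rw [hadjS, htr, trace_adjugate_one_add_diagonal, Matrix.trace_diagonal]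
  have htr2 : ∀ s : ℝ, (h * g⁻¹ * (1 + s • (h * g⁻¹)).adjugate).trace =
      ∑ i, d i * ∏ j ∈ Finset.univ.erase i, (1 + s * d j) := by
    intro s
    have h1 : h * g⁻¹ * (1 + s • (h * g⁻¹)).adjugate =
        S.val * (Matrix.diagonal d * (1 + s • Matrix.diagonal d).adjugate) * S⁻¹.val := by
      rw [hadjS, hA]
      calc _ = S.val * Matrix.diagonal d * (S⁻¹.val * S.val) *
            (1 + s • Matrix.diagonal d).adjugate * S⁻¹.val := by simp only [Matrix.mul_assoc]
        _ = _ := by rw [S.inv_mul, mul_one]; simp only [Matrix.mul_assoc]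
    rw [h1, htr, trace_adjugate_one_add_diagonal, Matrix.diagonal_mul_diagonal,
      Matrix.trace_diagonal]
  -- `P(s) = det(1 + sA)` generates the elementary symmetric functions. The trace of `A adj(1 + sA)`
  -- is `P'(s)`; dropping one factor at a time from the product gives `n P(s) - s P'(s)` for the
  -- trace of `adj(1 + sA)`.
  let P : ℝ[X] := ∏ i, (1 + C (d i) * X)
  have hP : P = ∏ i, (1 + C (d i) * X) := rfl
  have hPdeg : P.natDegree ≤ n := by
    refine (Polynomial.natDegree_prod_le _ _).trans ?_
    refine (Finset.sum_le_card_nsmul _ _ 1 fun i _ => ?_).trans (by simp)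
    compute_degree
  have hPcoeff : ∀ k, P.coeff k = (g⁻¹ * h).charpoly.roots.esymm k := fun k => by
    rw [hroots, ← coeff_prod_one_add_mul_X]
  have hP' : ∀ s, P.derivative.eval s = ∑ i, d i * ∏ j ∈ Finset.univ.erase i, (1 + s * d j) := by
    intro s
    rw [hP, Polynomial.derivative_prod_finset, Polynomial.eval_finsetSum]
    refine Finset.sum_congr rfl fun i _ => ?_
    rw [Polynomial.eval_mul, Polynomial.eval_prod, mul_comm]
    congr 1
    · simp
    · refine Finset.prod_congr rfl fun j _ => ?_
      simp [mul_comm s]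
  have hPe : ∀ s, ∑ i, ∏ j ∈ Finset.univ.erase i, (1 + s * d j) =
      n * P.eval s - s * P.derivative.eval s := by
    intro s
    rw [hP', Finset.mul_sum]
    have h1 : ∀ i, ∏ j ∈ Finset.univ.erase i, (1 + s * d j) =
        P.eval s - s * (d i * ∏ j ∈ Finset.univ.erase i, (1 + s * d j)) := by
      intro i
      have : P.eval s = (1 + s * d i) * ∏ j ∈ Finset.univ.erase i, (1 + s * d j) := by
        rw [Finset.mul_prod_erase _ (fun j => 1 + s * d j) (Finset.mem_univ i), hP,
          Polynomial.eval_prod]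
        refine Finset.prod_congr rfl fun j _ => ?_
        simp [mul_comm s]
      rw [this]; ring
    calc _ = ∑ i, (P.eval s - s * (d i * ∏ j ∈ Finset.univ.erase i, (1 + s * d j))) :=
          Finset.sum_congr rfl fun i _ => h1 i
      _ = _ := by
          rw [Finset.sum_sub_distrib, Finset.sum_const, Finset.card_univ, Fintype.card_fin,
            nsmul_eq_mul]
  refine ⟨C σ * (C (n : ℝ) * P - X * P.derivative) - C τ * P.derivative, ?_, fun s => ?_,
    fun k => ?_⟩
  · have h0 : P.derivative.natDegree ≤ P.natDegree - 1 := Polynomial.natDegree_derivative_le P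
    have h2 : (X * P.derivative).natDegree ≤ n := by
      by_cases hz : P.natDegree = 0
      · have : P.derivative = 0 := Polynomial.derivative_of_natDegree_zero hz
        simp [this]
      · refine Polynomial.natDegree_mul_le.trans ?_
        rw [Polynomial.natDegree_X]
        omega
    refine (Polynomial.natDegree_sub_le _ _).trans (max_le ?_ ?_)
    · refine (Polynomial.natDegree_C_mul_le _ _).trans
        ((Polynomial.natDegree_sub_le _ _).trans (max_le ?_ h2))
      exact (Polynomial.natDegree_C_mul_le _ _).trans hPdeg
    · exact (Polynomial.natDegree_C_mul_le _ _).trans (by omega)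
  · rw [htr1, htr2, hPe, ← hP']
    simp
  · have hc : (X * P.derivative).coeff k = k * P.coeff k := by
      cases k with
      | zero => simp
      | succ k => rw [Polynomial.coeff_X_mul, Polynomial.coeff_derivative]; push_cast; ring
    simp only [Polynomial.coeff_sub, Polynomial.coeff_C_mul, hc, Polynomial.coeff_derivative,
      hPcoeff]
    ring

/-- A coefficient of a polynomial is a fixed linear combination of its values. -/
theorem exists_coeff_eq_sum_eval (n k : ℕ) : ∃ a : Fin (n + 1) → ℝ,
    ∀ q : ℝ[X], q.natDegree ≤ n → q.coeff k = ∑ m : Fin (n + 1), a m * q.eval (m : ℝ) := by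
  refine ⟨fun m => (Lagrange.basis Finset.univ (fun m : Fin (n + 1) => (m : ℝ)) m).coeff k,
    fun q hq => ?_⟩
  have hinj : Set.InjOn (fun m : Fin (n + 1) => ((m : ℕ) : ℝ)) (Finset.univ : Finset (Fin (n + 1))) :=
    fun a _ b _ hab => Fin.ext (Nat.cast_injective hab)
  have h := Lagrange.eq_interpolate (f := q) hinj (by
    rw [Finset.card_univ, Fintype.card_fin]
    exact (Polynomial.degree_le_natDegree).trans_lt (by exact_mod_cast Nat.lt_succ_of_le hq))
  conv_lhs => rw [h]
  rw [Lagrange.interpolate_apply, Polynomial.finsetSum_coeff]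
  refine Finset.sum_congr rfl fun m _ => ?_
  rw [Polynomial.coeff_C_mul, mul_comm]

end Pencil

end

section

open Function Matrix

/-! ### Determinants adapted to a Lorentz frame. -/

section LorentzAlgebra

variable {n : ℕ} {V : Type*} [NormedAddCommGroup V] [NormedSpace ℝ V]

/-- Vectors in a hyperplane, as many as the dimension of the space, are dependent. To see that a
determinant vanishes it therefore suffices to exhibit one functional killing all its entries, the
usual argument below. -/
theorem alternating_eq_zero_of_functional [FiniteDimensional ℝ V] {m : ℕ}
    (D : V [⋀^Fin m]→L[ℝ] ℝ) (hm : Module.finrank ℝ V = m) {l : V →L[ℝ] ℝ} (hl : l ≠ 0)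
    {v : Fin m → V} (hv : ∀ i, l (v i) = 0) : D v = 0 := by
  refine D.toAlternatingMap.map_linearDependent v fun hli => hl ?_
  have hspan := hli.span_eq_top_of_card_eq_finrank' (by simp [hm])
  ext z
  have hz : z ∈ Submodule.span ℝ (Set.range v) := hspan ▸ Submodule.mem_top
  refine Submodule.span_induction (p := fun z _ => l z = (0 : V →L[ℝ] ℝ) z) ?_ (by simp) ?_ ?_ hz
  · rintro _ ⟨i, rfl⟩
    simpa using hv i
  · intro a b _ _ ha hb
    simp_all
  · intro r a _ ha
    simp_all

/-- The determinant in a basis, as a continuous alternating map. -/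
def basisDet [FiniteDimensional ℝ V] {m : ℕ} (e : Module.Basis (Fin m) ℝ V) :
    V [⋀^Fin m]→L[ℝ] ℝ :=
  { e.det with
    cont := by
      change Continuous fun v => e.det v
      simp only [Module.Basis.det_apply]
      refine Continuous.matrix_det (continuous_matrix fun i j => ?_)
      exact ((e.coord i).continuous_of_finiteDimensional).comp (continuous_apply j) }

theorem basisDet_apply [FiniteDimensional ℝ V] {m : ℕ} (e : Module.Basis (Fin m) ℝ V)
    (v : Fin m → V) : basisDet e v = (e.toMatrix v).det := rfl

/-- The matrix `B(u_i, v_j)` factors through the coordinate matrices of `u` and `v`. Products of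
determinants can thus be read off from inner products in an arbitrary basis. -/
theorem det_gram_eq [FiniteDimensional ℝ V] {m : ℕ} (e : Module.Basis (Fin m) ℝ V)
    (B : V →L[ℝ] V →L[ℝ] ℝ) (u v : Fin m → V) :
    (Matrix.of fun i j => B (u i) (v j)).det =
      (Matrix.of fun i j => B (e i) (e j)).det * basisDet e u * basisDet e v := by
  have h : (Matrix.of fun i j => B (u i) (v j)) =
      (e.toMatrix u)ᵀ * (Matrix.of fun i j => B (e i) (e j)) * e.toMatrix v := by
    ext i j
    simp only [Matrix.mul_apply, Matrix.of_apply, Matrix.transpose_apply]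
    conv_lhs => rw [← e.sum_toMatrix_smul_self u i, ← e.sum_toMatrix_smul_self v j]
    simp only [map_sum, map_smul, FunLike.coe_sum, Finset.sum_apply,
      FunLike.coe_smul, Pi.smul_apply, smul_eq_mul, Finset.mul_sum, Finset.sum_mul]
    refine Finset.sum_congr rfl fun a _ => Finset.sum_congr rfl fun b _ => by ring
  rw [h, Matrix.det_mul, Matrix.det_mul, Matrix.det_transpose, basisDet_apply, basisDet_apply]
  ring

theorem det_eq_mul_det_of_row_zero {m : ℕ} (A : Matrix (Fin (m + 1)) (Fin (m + 1)) ℝ)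
    (h : ∀ j, A 0 (Fin.succ j) = 0) :
    A.det = A 0 0 * (A.submatrix Fin.succ Fin.succ).det := by
  rw [Matrix.det_succ_row_zero, Fin.sum_univ_succ]
  simp only [h, mul_zero, zero_mul, Finset.sum_const_zero, add_zero]
  simp

/-- Insertion of two vectors into an alternating form. -/
def insertTwo (D : V [⋀^Fin (n + 2)]→L[ℝ] ℝ) : V →L[ℝ] V →L[ℝ] V [⋀^Fin n]→L[ℝ] ℝ :=
  (ContinuousAlternatingMap.curryLeftLI.toContinuousLinearMap).comp D.curryLeft

theorem insertTwo_apply (D : V [⋀^Fin (n + 2)]→L[ℝ] ℝ) (u v : V) (Z : Fin n → V) :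
    insertTwo D u v Z = D (vecCons u (vecCons v Z)) := rfl

theorem insertTwo_swap_left (D : V [⋀^Fin (n + 2)]→L[ℝ] ℝ) (u v w : V) (Z : Fin n → V)
    (i : Fin n) : insertTwo D u v (update Z i w) = -insertTwo D w v (update Z i u) := by
  rw [insertTwo_apply, insertTwo_apply]
  have h := D.toAlternatingMap.map_swap (vecCons w (vecCons v (update Z i u)))
    (i := 0) (j := i.succ.succ) (Fin.succ_ne_zero _).symm
  refine Eq.trans (congrArg D ?_) h
  funext j
  refine Fin.cases ?_ (fun j => Fin.cases ?_ (fun j => ?_) j) j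
  · simp
  · rw [Function.comp_apply, Equiv.swap_apply_of_ne_of_ne]
    · rfl
    · exact Fin.succ_ne_zero _
    · exact fun h => (Fin.succ_ne_zero i).symm (Fin.succ_injective _ h)
  · by_cases hj : j = i
    · subst hj
      rw [Function.comp_apply, Equiv.swap_apply_right]
      simp
    · rw [Function.comp_apply, Equiv.swap_apply_of_ne_of_ne (Fin.succ_ne_zero _)
        fun h => hj (Fin.succ_injective _ (Fin.succ_injective _ h))]
      simp [hj]

theorem insertTwo_swap_right (D : V [⋀^Fin (n + 2)]→L[ℝ] ℝ) (u v w : V) (Z : Fin n → V)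
    (i : Fin n) : insertTwo D u v (update Z i w) = -insertTwo D u w (update Z i v) := by
  rw [insertTwo_apply, insertTwo_apply]
  have h := D.toAlternatingMap.map_swap (vecCons u (vecCons w (update Z i v)))
    (i := Fin.succ 0) (j := i.succ.succ) (fun h => (Fin.succ_ne_zero i).symm (Fin.succ_injective _ h))
  refine Eq.trans (congrArg D ?_) h
  funext j
  refine Fin.cases ?_ (fun j => Fin.cases ?_ (fun j => ?_) j) j
  · rw [Function.comp_apply, Equiv.swap_apply_of_ne_of_ne]
    · rfl
    · exact (Fin.succ_ne_zero _).symm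
    · exact (Fin.succ_ne_zero _).symm
  · rw [Function.comp_apply, Equiv.swap_apply_left]
    simp only [cons_val_succ, cons_val_zero, update_self]
  · by_cases hj : j = i
    · subst hj
      rw [Function.comp_apply, Equiv.swap_apply_right]
      simp only [cons_val_succ, cons_val_zero, update_self]
    · rw [Function.comp_apply, Equiv.swap_apply_of_ne_of_ne
        (fun h => (Fin.succ_ne_zero j) (Fin.succ_injective _ h))
        fun h => hj (Fin.succ_injective _ (Fin.succ_injective _ h))]
      simp [hj]

/-- Orthogonality relations for the position vector `X` on the hyperboloid, a unit normal `N`, and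
tangent vectors `X_i`, `N_i`. -/
structure IsAdaptedFrame (B : V →L[ℝ] V →L[ℝ] ℝ) (X N : V) (Xs Ns : Fin n → V) : Prop where
  symm : ∀ u v, B u v = B v u
  XX : B X X = -1
  NN : B N N = 1
  XN : B X N = 0
  X_Xs : ∀ i, B X (Xs i) = 0
  N_Xs : ∀ i, B N (Xs i) = 0
  X_Ns : ∀ i, B X (Ns i) = 0
  N_Ns : ∀ i, B N (Ns i) = 0

variable [FiniteDimensional ℝ V] {B : V →L[ℝ] V →L[ℝ] ℝ} {X N : V} {Xs Ns : Fin n → V}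

/-- As `B X X = -1`, the vector `w + B X w • X` is orthogonal to `X`, like every other entry, so its
contribution vanishes. The remaining multiple of `X` is exchanged with the first slot. -/
theorem IsAdaptedFrame.insertTwo_left (hf : IsAdaptedFrame B X N Xs Ns)
    (D : V [⋀^Fin (n + 2)]→L[ℝ] ℝ) (hV : Module.finrank ℝ V = n + 2) (Y : Fin n → V)
    (hY : ∀ i, B X (Y i) = 0) (w : V) (i : Fin n) :
    insertTwo D (Xs i) N (update Y i w) = B X w * insertTwo D X N (update Y i (Xs i)) := by
  have hw : w = (w + B X w • X) + (-B X w) • X := by module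
  have h0 : insertTwo D (Xs i) N (update Y i (w + B X w • X)) = 0 := by
    rw [insertTwo_apply]
    refine alternating_eq_zero_of_functional D hV (l := B X) (fun h => ?_) fun j => ?_
    · have := hf.XX
      rw [h] at this
      simp at this
    · refine Fin.cases ?_ (fun j => Fin.cases ?_ (fun j => ?_) j) j
      · exact hf.X_Xs i
      · exact hf.XN
      · by_cases hj : j = i
        · subst hj
          simp [hf.XX]
        · simp [hj, hY]
  conv_lhs => rw [hw]
  rw [ContinuousAlternatingMap.map_update_add, h0, ContinuousAlternatingMap.map_update_smul,
    insertTwo_swap_left, smul_eq_mul]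
  ring

/-- The argument of `insertTwo_left` with `N` in place of `X`; the sign differs because `B N N = 1`.
-/
theorem IsAdaptedFrame.insertTwo_right (hf : IsAdaptedFrame B X N Xs Ns)
    (D : V [⋀^Fin (n + 2)]→L[ℝ] ℝ) (hV : Module.finrank ℝ V = n + 2) (Y : Fin n → V)
    (hY : ∀ i, B N (Y i) = 0) (w : V) (i : Fin n) :
    insertTwo D X (Ns i) (update Y i w) = -B N w * insertTwo D X N (update Y i (Ns i)) := by
  have hw : w = (w - B N w • N) + (B N w) • N := by module
  have h0 : insertTwo D X (Ns i) (update Y i (w - B N w • N)) = 0 := by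
    rw [insertTwo_apply]
    refine alternating_eq_zero_of_functional D hV (l := B N) (fun h => ?_) fun j => ?_
    · have := hf.NN
      rw [h] at this
      simp at this
    · refine Fin.cases ?_ (fun j => Fin.cases ?_ (fun j => ?_) j) j
      · exact (hf.symm _ _).trans hf.XN
      · exact hf.N_Ns i
      · by_cases hj : j = i
        · subst hj
          simp [hf.NN]
        · simp [hj, hY]
  conv_lhs => rw [hw]
  rw [ContinuousAlternatingMap.map_update_add, h0, ContinuousAlternatingMap.map_update_smul,
    insertTwo_swap_right, smul_eq_mul]
  ring

/-- In the Gram matrix of `(X, N, Z)` against `(X, N, Xs)` the first two rows are `(-1, 0, …)` and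
`(0, 1, 0, …)`, so only the block `B(Z_i, Xs_j)` is left, with a minus sign. -/
theorem IsAdaptedFrame.insertTwo_mul (hf : IsAdaptedFrame B X N Xs Ns)
    (e : Module.Basis (Fin (n + 2)) ℝ V) (Z : Fin n → V) :
    (Matrix.of fun i j => B (e i) (e j)).det * insertTwo (basisDet e) X N Z *
      insertTwo (basisDet e) X N Xs = -(Matrix.of fun i j => B (Z i) (Xs j)).det := by
  rw [insertTwo_apply, insertTwo_apply, ← det_gram_eq, det_eq_mul_det_of_row_zero,
    det_eq_mul_det_of_row_zero]
  · have h1 : (Matrix.of fun i j => B (vecCons X (vecCons N Z) i) (vecCons X (vecCons N Xs) j)) 0 0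
        = -1 := hf.XX
    have h2 : ((Matrix.of fun i j => B (vecCons X (vecCons N Z) i)
        (vecCons X (vecCons N Xs) j)).submatrix Fin.succ Fin.succ) 0 0 = 1 := hf.NN
    rw [h1, h2, one_mul, neg_one_mul]
    rfl
  · exact fun j => hf.N_Xs j
  · refine fun j => Fin.cases hf.XN (fun j => hf.X_Xs j) j

/-- Taking `Z = Xs` gives `J F² = -G` with `G > 0`, which forces `J < 0` and `F ≠ 0`. Thus `F` is,
up to a constant factor and a sign, the area form. -/
theorem IsAdaptedFrame.insertTwo_sq (hf : IsAdaptedFrame B X N Xs Ns)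
    (e : Module.Basis (Fin (n + 2)) ℝ V) (hg : 0 < (Matrix.of fun i j => B (Xs i) (Xs j)).det) :
    (Matrix.of fun i j => B (e i) (e j)).det < 0 ∧ insertTwo (basisDet e) X N Xs ≠ 0 ∧
      insertTwo (basisDet e) X N Xs ^ 2 = (-(Matrix.of fun i j => B (e i) (e j)).det)⁻¹ *
        (Matrix.of fun i j => B (Xs i) (Xs j)).det := by
  have h := hf.insertTwo_mul e Xs
  set J := (Matrix.of fun i j => B (e i) (e j)).det
  set F := insertTwo (basisDet e) X N Xs
  set G := (Matrix.of fun i j => B (Xs i) (Xs j)).det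
  have hF : F ≠ 0 := by
    rintro h0
    rw [h0] at h
    linarith
  have hJ : J < 0 := by
    by_contra hc
    have := mul_nonneg (not_lt.1 hc) (sq_nonneg F)
    nlinarith
  refine ⟨hJ, hF, ?_⟩
  have : -J ≠ 0 := by linarith
  rw [inv_mul_eq_div, eq_div_iff this]
  linear_combination (-1) * h

/-- The divergence of the form `D(X, N, w, dY, …, dY)` along the parallel hypersurface
`Y = X + s N`. -/
theorem IsAdaptedFrame.divergence_eq (hf : IsAdaptedFrame B X N Xs Ns)
    (e : Module.Basis (Fin (n + 2)) ℝ V) {g h K₀ K₁ : Matrix (Fin n) (Fin n) ℝ}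
    (hg : ∀ i j, g i j = B (Xs i) (Xs j)) (hh : ∀ i j, h i j = B (Ns i) (Xs j))
    (hg0 : 0 < g.det) (hhs : hᵀ = h) (hK₀ : K₀ᵀ = -K₀) (hK₁ : K₁ᵀ = -K₁) (s : ℝ) (w : V)
    (dw : Fin n → V) (hdw : ∀ i j, B (dw i) (Xs j) = (K₀ + h * g⁻¹ * K₁) i j) :
    (∑ i, (insertTwo (basisDet e) (Xs i) N (update (fun j => Xs j + s • Ns j) i w) +
      insertTwo (basisDet e) X (Ns i) (update (fun j => Xs j + s • Ns j) i w) +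
      insertTwo (basisDet e) X N (update (fun j => Xs j + s • Ns j) i (dw i)))) /
        insertTwo (basisDet e) X N Xs =
      B X w * (1 + s • (h * g⁻¹)).adjugate.trace -
        B N w * (h * g⁻¹ * (1 + s • (h * g⁻¹)).adjugate).trace := by
  have hV : Module.finrank ℝ V = n + 2 := by
    rw [Module.finrank_eq_card_basis e, Fintype.card_fin]
  set Y : Fin n → V := fun j => Xs j + s • Ns j with hY
  have hgeq : (Matrix.of fun i j => B (Xs i) (Xs j)) = g := by
    ext i j; exact (hg i j).symm
  have hgs : gᵀ = g := by
    ext i j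
    rw [Matrix.transpose_apply, hg, hg, hf.symm]
  obtain ⟨hJ, hF, -⟩ := hf.insertTwo_sq e (by rwa [hgeq])
  have hmul := hf.insertTwo_mul e
  have hmulX := hmul Xs
  rw [hgeq] at hmulX
  set J := (Matrix.of fun i j => B (e i) (e j)).det
  set F := insertTwo (basisDet e) X N Xs
  -- The identity `insertTwo_mul` for `Z` is divided by the one for `Xs`, so the ambient Gram
  -- determinant `J` cancels.
  have hZ : ∀ Z, insertTwo (basisDet e) X N Z =
      F * (g.det)⁻¹ * (Matrix.of fun i j => B (Z i) (Xs j)).det := by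
    intro Z
    have h1 := hmul Z
    have : (Matrix.of fun i j => B (Z i) (Xs j)).det =
      -(J * insertTwo (basisDet e) X N Z * F) := by linarith
    have h2 : g.det = -(J * F * F) := by linarith
    rw [this, h2]
    have := hJ.ne
    field_simp
  -- The derivatives of `X`, of `N` and of `w` all end up in slot `i` of the same form `D(X, N, …)`,
  -- and `b i` collects them.
  let b : Fin n → V := fun i => dw i + B X w • Xs i - B N w • Ns i
  have hterm : ∀ i, insertTwo (basisDet e) (Xs i) N (update Y i w) +
      insertTwo (basisDet e) X (Ns i) (update Y i w) +
      insertTwo (basisDet e) X N (update Y i (dw i)) =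
      insertTwo (basisDet e) X N (update Y i (b i)) := by
    intro i
    rw [hf.insertTwo_left _ hV Y (fun i => by simp [hY, hf.X_Xs, hf.X_Ns]),
      hf.insertTwo_right _ hV Y (fun i => by simp [hY, hf.N_Xs, hf.N_Ns])]
    simp only [b, sub_eq_add_neg, ← neg_smul, ContinuousAlternatingMap.map_update_add,
      ContinuousAlternatingMap.map_update_smul, smul_eq_mul]
    ring
  -- The inner products of `b i` with the `Xs j`, in the shape treated by
  -- `trace_mul_adjugate_pencil` with `σ = B X w` and `τ = B N w`; the other rows are those of `g +
  -- s h`.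
  let bm : Matrix (Fin n) (Fin n) ℝ := K₀ + h * g⁻¹ * K₁ + B X w • g - B N w • h
  have hdet : ∀ i, (Matrix.of fun k j => B (update Y i (b i) k) (Xs j)) =
      (g + s • h).updateRow i (bm i) := by
    intro i
    ext k j
    by_cases hk : k = i
    · subst hk
      simp [b, bm, hdw, hg, hh]
    · simp [hk, hY, hg, hh]
  simp only [hterm]
  simp only [hZ, hdet]
  rw [← Finset.mul_sum, sum_det_updateRow_eq_trace, trace_mul_adjugate_pencil hgs hg0.ne' hhs hK₀ hK₁]
  field_simp

end LorentzAlgebra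

end

section

open Function Set

/-! ### The hyperboloid model and the capillary field. -/

section Hyperboloid

variable {n : ℕ}

theorem inner_Eₗ_left (z : E n) : inner ℝ (Eₗ n) z = z (Fin.last n) := by
  simp [Eₗ, EuclideanSpace.inner_single_left]

theorem inner_Eₗ_right (z : E n) : inner ℝ z (Eₗ n) = z (Fin.last n) := by
  rw [real_inner_comm, inner_Eₗ_left]

theorem Eₗ_last : Eₗ n (Fin.last n) = 1 := by simp [Eₗ]

theorem inner_E₁_left (z : E n) : inner ℝ (E₁ n) z = z 0 := by
  simp [E₁, EuclideanSpace.inner_single_left]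

theorem inner_E₁_right (z : E n) : inner ℝ z (E₁ n) = z 0 := by
  rw [real_inner_comm, inner_E₁_left]

theorem E₁_last [NeZero n] : E₁ n (Fin.last n) = 0 := by
  simp [E₁, Fin.ext_iff, NeZero.ne n]

theorem E₁_zero : E₁ n 0 = 1 := by simp [E₁]

theorem Eₗ_zero [NeZero n] : Eₗ n 0 = 0 := by
  simp [Eₗ, Fin.ext_iff, (NeZero.ne n).symm]

/-- The Lorentz form `⟨u, v⟩ - u_{n+1} v_{n+1} - (u_{n+1} v' + v_{n+1} u') / 2`
on `ℝ^{n+1} × ℝ`. -/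
def lorentz (n : ℕ) : E n × ℝ →L[ℝ] E n × ℝ →L[ℝ] ℝ :=
  (LinearMap.mk₂ ℝ (fun u v : E n × ℝ => inner ℝ u.1 v.1 - u.1 (Fin.last n) * v.1 (Fin.last n) -
      (u.1 (Fin.last n) * v.2 + v.1 (Fin.last n) * u.2) / 2)
    (fun u u' v => by simp only [Prod.fst_add, Prod.snd_add, inner_add_left, PiLp.add_apply]; ring)
    (fun r u v => by
      simp only [Prod.smul_fst, Prod.smul_snd, real_inner_smul_left, PiLp.smul_apply, smul_eq_mul]
      ring)
    (fun u v v' => by simp only [Prod.fst_add, Prod.snd_add, inner_add_right, PiLp.add_apply]; ring)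
    (fun r u v => by
      simp only [Prod.smul_fst, Prod.smul_snd, real_inner_smul_right, PiLp.smul_apply, smul_eq_mul]
      ring)).toContinuousBilinearMap

theorem lorentz_apply (u v : E n × ℝ) : lorentz n u v =
    inner ℝ u.1 v.1 - u.1 (Fin.last n) * v.1 (Fin.last n) -
      (u.1 (Fin.last n) * v.2 + v.1 (Fin.last n) * u.2) / 2 := rfl

theorem lorentz_comm (u v : E n × ℝ) : lorentz n u v = lorentz n v u := by
  rw [lorentz_apply, lorentz_apply, real_inner_comm]
  ring

/-- Nondegeneracy by three test vectors: `(0, 1)` detects the last coordinate of `u.1`, then `(u.1,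
0)` its Euclidean norm, then `(Eₗ n, 0)` the extra coordinate. -/
theorem eq_zero_of_lorentz_eq_zero {u : E n × ℝ} (h : lorentz n u = 0) : u = 0 := by
  have h1 := congrArg (fun l => l (0, 1)) h
  have h2 := congrArg (fun l => l (u.1, 0)) h
  have h3 := congrArg (fun l => l (Eₗ n, 0)) h
  simp only [lorentz_apply, inner_zero_right, inner_Eₗ_right, Eₗ_last, PiLp.zero_apply,
    zero_apply] at h1 h2 h3
  have h0 : u.1 (Fin.last n) = 0 := by linarith
  rw [h0] at h2 h3
  have h4 : u.1 = 0 := (inner_self_eq_zero (𝕜 := ℝ)).1 (by linarith)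
  exact Prod.ext h4 (show u.2 = 0 by linarith)

/-- The isometry of the half-space model onto the hyperboloid. -/
def hypPoint (z : E n) : E n × ℝ :=
  ((z (Fin.last n))⁻¹ • z + ((z (Fin.last n))⁻¹ - 1) • Eₗ n, (z (Fin.last n))⁻¹ * inner ℝ z z)

/-- The differential of `hypPoint`. -/
def hypLift (z : E n) : E n →L[ℝ] E n × ℝ :=
  LinearMap.toContinuousLinearMap
    { toFun := fun v => ((z (Fin.last n))⁻¹ • v -
          (v (Fin.last n) * (z (Fin.last n))⁻¹ ^ 2) • (z + Eₗ n),
        2 * (z (Fin.last n))⁻¹ * inner ℝ z v -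
          v (Fin.last n) * (z (Fin.last n))⁻¹ ^ 2 * inner ℝ z z)
      map_add' := fun u v => by
        refine Prod.ext ?_ ?_
        · simp only [PiLp.add_apply, Prod.fst_add]
          module
        · simp only [PiLp.add_apply, Prod.snd_add, inner_add_right]
          ring
      map_smul' := fun r v => by
        refine Prod.ext ?_ ?_
        · simp only [PiLp.smul_apply, Prod.smul_fst, smul_eq_mul, RingHom.id_apply]
          module
        · simp only [PiLp.smul_apply, Prod.smul_snd, smul_eq_mul, RingHom.id_apply,
            real_inner_smul_right]
          ring }

theorem hypLift_apply (z v : E n) : hypLift z v = ((z (Fin.last n))⁻¹ • v -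
      (v (Fin.last n) * (z (Fin.last n))⁻¹ ^ 2) • (z + Eₗ n),
    2 * (z (Fin.last n))⁻¹ * inner ℝ z v -
      v (Fin.last n) * (z (Fin.last n))⁻¹ ^ 2 * inner ℝ z z) := rfl

/-- The second differential of `hypPoint`. -/
def hypLiftDeriv (z v : E n) : E n →L[ℝ] E n × ℝ :=
  LinearMap.toContinuousLinearMap
    { toFun := fun u => (-(u (Fin.last n) * (z (Fin.last n))⁻¹ ^ 2) • v +
          (2 * v (Fin.last n) * u (Fin.last n) * (z (Fin.last n))⁻¹ ^ 3) • (z + Eₗ n) -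
          (v (Fin.last n) * (z (Fin.last n))⁻¹ ^ 2) • u,
        -2 * u (Fin.last n) * (z (Fin.last n))⁻¹ ^ 2 * inner ℝ z v +
          2 * (z (Fin.last n))⁻¹ * inner ℝ u v +
          2 * v (Fin.last n) * u (Fin.last n) * (z (Fin.last n))⁻¹ ^ 3 * inner ℝ z z -
          2 * v (Fin.last n) * (z (Fin.last n))⁻¹ ^ 2 * inner ℝ z u)
      map_add' := fun u v => by
        refine Prod.ext ?_ ?_
        · simp only [PiLp.add_apply, Prod.fst_add]
          module
        · simp only [PiLp.add_apply, Prod.snd_add, inner_add_right, inner_add_left]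
          ring
      map_smul' := fun r v => by
        refine Prod.ext ?_ ?_
        · simp only [PiLp.smul_apply, Prod.smul_fst, smul_eq_mul, RingHom.id_apply]
          module
        · simp only [PiLp.smul_apply, Prod.smul_snd, smul_eq_mul, RingHom.id_apply,
            real_inner_smul_right, real_inner_smul_left]
          ring }

theorem hypLiftDeriv_apply (z v u : E n) : hypLiftDeriv z v u =
    (-(u (Fin.last n) * (z (Fin.last n))⁻¹ ^ 2) • v +
          (2 * v (Fin.last n) * u (Fin.last n) * (z (Fin.last n))⁻¹ ^ 3) • (z + Eₗ n) -
          (v (Fin.last n) * (z (Fin.last n))⁻¹ ^ 2) • u,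
        -2 * u (Fin.last n) * (z (Fin.last n))⁻¹ ^ 2 * inner ℝ z v +
          2 * (z (Fin.last n))⁻¹ * inner ℝ u v +
          2 * v (Fin.last n) * u (Fin.last n) * (z (Fin.last n))⁻¹ ^ 3 * inner ℝ z z -
          2 * v (Fin.last n) * (z (Fin.last n))⁻¹ ^ 2 * inner ℝ z u) := rfl

theorem hasFDerivAt_inv_last {z : E n} (hz : z (Fin.last n) ≠ 0) :
    HasFDerivAt (fun z : E n => (z (Fin.last n))⁻¹)
      (-((z (Fin.last n))⁻¹ ^ 2) • (EuclideanSpace.proj (Fin.last n) : E n →L[ℝ] ℝ)) z := by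
  have h := (hasDerivAt_inv hz).comp_hasFDerivAt z
    (EuclideanSpace.proj (Fin.last n) : E n →L[ℝ] ℝ).hasFDerivAt
  rw [inv_pow]
  exact h

theorem hasFDerivAt_hypPoint {z : E n} (hz : z (Fin.last n) ≠ 0) :
    HasFDerivAt hypPoint (hypLift z) z := by
  have hr := hasFDerivAt_inv_last hz
  have hi := hasFDerivAt_id (𝕜 := ℝ) z
  refine (((hr.smul hi).add ((hr.sub_const 1).smul_const (Eₗ n))).prodMk
    (hr.mul (hi.inner ℝ hi))).congr_fderiv ?_
  ext v : 1
  rw [hypLift_apply]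
  refine Prod.ext ?_ ?_
  · simp
    module
  · simp [real_inner_comm z v]
    ring

theorem hasFDerivAt_hypLift {z : E n} (v : E n) (hz : z (Fin.last n) ≠ 0) :
    HasFDerivAt (fun q : E n × E n => hypLift q.1 q.2)
      ((hypLift z).comp (ContinuousLinearMap.snd ℝ _ _) +
        (hypLiftDeriv z v).comp (ContinuousLinearMap.fst ℝ _ _)) (z, v) := by
  have hr : HasFDerivAt (fun q : E n × E n => (q.1 (Fin.last n))⁻¹) _ (z, v) :=
    HasFDerivAt.comp (f := Prod.fst) (z, v) (hasFDerivAt_inv_last (z := z) hz) hasFDerivAt_fst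
  have h1 : HasFDerivAt (fun q : E n × E n => q.1) _ (z, v) := hasFDerivAt_fst (𝕜 := ℝ)
  have h2 : HasFDerivAt (fun q : E n × E n => q.2) _ (z, v) := hasFDerivAt_snd (𝕜 := ℝ)
  have hl : HasFDerivAt (fun q : E n × E n => q.2 (Fin.last n)) _ (z, v) :=
    ((EuclideanSpace.proj (Fin.last n) : E n →L[ℝ] ℝ).hasFDerivAt).comp (z, v) h2
  refine (((hr.smul h2).sub ((hl.mul (hr.pow 2)).smul (h1.add_const (Eₗ n)))).prodMk
    (((hr.const_mul 2).mul (h1.inner ℝ h2)).sub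
      ((hl.mul (hr.pow 2)).mul (h1.inner ℝ h1)))).congr_fderiv ?_
  refine ContinuousLinearMap.ext fun u => ?_
  simp only [add_apply, ContinuousLinearMap.comp_apply, ContinuousLinearMap.coe_fst',
    ContinuousLinearMap.coe_snd']
  rw [hypLift_apply, hypLiftDeriv_apply]
  refine Prod.ext ?_ ?_
  · simp
    module
  · simp [real_inner_comm z u.1]
    ring

/-- The last coordinate and the extra one are null coordinates, equal to `1/z_{n+1}` and
`|z|²/z_{n+1}` at the image point; the `-1` in `hypPoint` is there to produce the former. The other
coordinates are `z_i/z_{n+1}`, and `|z|² - ∑ z_i² = z_{n+1}²`. -/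
theorem lorentz_hypPoint_hypPoint {z : E n} (hz : z (Fin.last n) ≠ 0) :
    lorentz n (hypPoint z) (hypPoint z) = -1 := by
  simp only [lorentz_apply, hypPoint, inner_add_left, inner_add_right, real_inner_smul_left,
    real_inner_smul_right, inner_Eₗ_left, inner_Eₗ_right, PiLp.add_apply, PiLp.smul_apply,
    smul_eq_mul, Eₗ_last]
  field_simp
  ring

theorem lorentz_hypPoint_hypLift {z : E n} (hz : z (Fin.last n) ≠ 0) (v : E n) :
    lorentz n (hypPoint z) (hypLift z v) = 0 := by
  simp only [lorentz_apply, hypPoint, hypLift_apply, inner_add_left, inner_add_right,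
    inner_sub_right, real_inner_smul_left,
    real_inner_smul_right, inner_Eₗ_left, inner_Eₗ_right, PiLp.add_apply, PiLp.smul_apply,
    PiLp.sub_apply, smul_eq_mul, Eₗ_last]
  field_simp
  ring

theorem lorentz_hypLift_hypLift {z : E n} (hz : z (Fin.last n) ≠ 0) (u v : E n) :
    lorentz n (hypLift z u) (hypLift z v) = hypInner z u v := by
  simp only [lorentz_apply, hypInner, hypLift_apply, inner_add_left, inner_add_right,
    inner_sub_right, inner_sub_left, real_inner_smul_left, real_inner_comm z u,
    real_inner_smul_right, inner_Eₗ_left, inner_Eₗ_right, PiLp.add_apply, PiLp.smul_apply,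
    PiLp.sub_apply, smul_eq_mul, Eₗ_last]
  field_simp
  ring

/-- On the hyperboloid the Levi-Civita connection is the tangential part of the flat derivative.
This is that fact in half-space coordinates, and the reason why the second fundamental form is `⟨dN,
dX⟩`. -/
theorem lorentz_hypLiftDeriv_hypLift {z : E n} (hz : z (Fin.last n) ≠ 0) (v u w : E n) :
    lorentz n (hypLiftDeriv z v u) (hypLift z w) = hypInner z (christoffel z u v) w := by
  simp only [lorentz_apply, hypInner, hypLift_apply, hypLiftDeriv_apply, christoffel,
    inner_add_left, inner_add_right, inner_neg_left,
    inner_sub_right, inner_sub_left, real_inner_smul_left, real_inner_comm z u, real_inner_comm z v,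
    real_inner_smul_right, inner_Eₗ_left, inner_Eₗ_right, PiLp.add_apply, PiLp.smul_apply,
    PiLp.sub_apply, smul_eq_mul, Eₗ_last]
  field_simp
  ring

/-- The infinitesimal isometry of the Lorentz form that corresponds to the position vector. -/
def boost (n : ℕ) : E n × ℝ →L[ℝ] E n × ℝ :=
  ((-(EuclideanSpace.proj (Fin.last n) : E n →L[ℝ] ℝ)).smulRight (Eₗ n) |>.comp
    (ContinuousLinearMap.fst ℝ _ _)).prod (ContinuousLinearMap.snd ℝ _ _)

theorem boost_apply (u : E n × ℝ) : boost n u = ((-u.1 (Fin.last n)) • Eₗ n, u.2) := rfl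

/-- `boost` has weights `-1` and `1` on the two paired null coordinates and `0` on the others, hence
is skew; it generates the dilations of the half-space. -/
theorem lorentz_boost (u v : E n × ℝ) : lorentz n (boost n u) v = -lorentz n u (boost n v) := by
  simp only [lorentz_apply, boost_apply, real_inner_smul_left, real_inner_smul_right,
    inner_Eₗ_left, inner_Eₗ_right, PiLp.smul_apply, smul_eq_mul, Eₗ_last]
  ring

theorem lorentz_boost_self (u : E n × ℝ) : lorentz n (boost n u) u = 0 := by
  have := lorentz_boost u u
  rw [lorentz_comm u] at this
  linarith

/-- The Killing field `x - c E_{n+1}` read on the hyperboloid. -/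
def killing (c : ℝ) (X : E n × ℝ) : E n × ℝ := boost n X - c • (0, 2)

/-- The boost lifts the position vector, and the constant null vector `(0, 2)` has tangential part
`E_{n+1}`; the `2` compensates the factor `1/2` in the Lorentz form. -/
theorem lorentz_killing_hypLift {z : E n} (hz : z (Fin.last n) ≠ 0) (c : ℝ) (v : E n) :
    lorentz n (killing c (hypPoint z)) (hypLift z v) = hypInner z (z - c • Eₗ n) v := by
  simp only [killing, lorentz_apply, hypInner, hypPoint, hypLift_apply, boost_apply,
    Prod.fst_sub, Prod.snd_sub, Prod.smul_fst, Prod.smul_snd, smul_zero, sub_zero,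
    inner_add_right, inner_sub_right, inner_sub_left, real_inner_smul_left,
    real_inner_smul_right, inner_Eₗ_left, inner_Eₗ_right, PiLp.add_apply, PiLp.smul_apply,
    PiLp.sub_apply, smul_eq_mul, Eₗ_last]
  field_simp
  ring

/-- Skewness removes the boost, so only the constant vector contributes: `c/z_{n+1}` is the
conformal factor of `-c E_{n+1}`. -/
theorem lorentz_killing_hypPoint {z : E n} (hz : z (Fin.last n) ≠ 0) (c : ℝ) :
    lorentz n (killing c (hypPoint z)) (hypPoint z) = c / z (Fin.last n) := by
  rw [killing, map_sub, sub_apply, lorentz_boost_self]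
  simp only [lorentz_apply, hypPoint, Prod.smul_fst, Prod.smul_snd, smul_zero, inner_zero_left,
    PiLp.add_apply, PiLp.smul_apply, PiLp.zero_apply, smul_eq_mul, Eₗ_last]
  field_simp
  ring

theorem lorentz_E₁ [NeZero n] (u : E n × ℝ) : lorentz n (E₁ n, 0) u = u.1 0 := by
  simp only [lorentz_apply, inner_E₁_left, E₁_last]
  ring

theorem lorentz_boost_hypLift_hypPoint {z : E n} (hz : z (Fin.last n) ≠ 0) (v : E n) (c : ℝ) :
    lorentz n (boost n (hypLift z v)) (hypPoint z) =
      -hypInner z (z - c • Eₗ n) v - c * v (Fin.last n) / z (Fin.last n) ^ 2 := by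
  rw [lorentz_boost, lorentz_comm]
  have h := lorentz_killing_hypLift hz c v
  rw [killing, map_sub, sub_apply] at h
  have h2 : lorentz n (c • ((0 : E n), (2 : ℝ))) (hypLift z v) =
      c * v (Fin.last n) / z (Fin.last n) ^ 2 := by
    simp only [lorentz_apply, hypLift_apply, Prod.smul_fst, Prod.smul_snd, smul_zero,
      inner_zero_left, PiLp.add_apply, PiLp.smul_apply, PiLp.zero_apply, PiLp.sub_apply,
      smul_eq_mul, Eₗ_last]
    field_simp
    ring
  rw [h2] at h
  linarith

/-- The field along a capillary hypersurface whose divergence gives the Minkowski formulas. -/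
def capField (θ c : ℝ) (X N : E n × ℝ) : E n × ℝ :=
  killing c X + Real.cos θ • (lorentz n (killing c X) N • (E₁ n, (0 : ℝ)) -
    lorentz n (E₁ n, 0) N • killing c X + lorentz n (E₁ n, 0) X • boost n N)

/-- The two terms `⟨m,N⟩⟨a,N⟩` cancel and skewness removes the boost term, so the correction by `cos
θ` is invisible in the normal component. -/
theorem lorentz_capField_normal (θ c : ℝ) (X N : E n × ℝ) :
    lorentz n (capField θ c X N) N = lorentz n (killing c X) N := by
  simp only [capField, map_add, map_sub, map_smul, add_apply, FunLike.coe_sub, Pi.sub_apply,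
    FunLike.coe_smul, Pi.smul_apply, smul_eq_mul, lorentz_boost_self]
  ring

/-- The summand `⟨a,X⟩ R N` of `capField` serves to cancel `⟨m,N⟩⟨a,X⟩` here. What remains,
`⟨a,N⟩/z_{n+1} + ⟨a,X⟩ v_{n+1}/z_{n+1}²`, is `⟨E_1, v⟩` in the hyperbolic metric. -/
theorem lorentz_capField_hypPoint [NeZero n] {z : E n} (hz : z (Fin.last n) ≠ 0) (θ c : ℝ)
    (v : E n) : lorentz n (capField θ c (hypPoint z) (hypLift z v)) (hypPoint z) =
      c * (1 / z (Fin.last n) - Real.cos θ * hypInner z (E₁ n) v) := by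
  simp only [capField, map_add, map_sub, map_smul, add_apply, FunLike.coe_sub, Pi.sub_apply,
    FunLike.coe_smul, Pi.smul_apply, smul_eq_mul, lorentz_killing_hypPoint hz,
    lorentz_killing_hypLift hz, lorentz_E₁, lorentz_boost_hypLift_hypPoint hz v c]
  simp only [hypPoint, hypLift_apply, hypInner, inner_E₁_left, PiLp.add_apply, PiLp.smul_apply,
    PiLp.sub_apply, smul_eq_mul, Eₗ_zero]
  field_simp
  ring

/-- Here `⟨a,a⟩ = 1` while `a` is orthogonal to `m` and to the image of the boost. Together with
`lorentz_capField_normal` this says that `a - cos θ N` is orthogonal to the field. -/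
theorem lorentz_E₁_capField [NeZero n] (θ c : ℝ) (X N : E n × ℝ) :
    lorentz n (E₁ n, 0) (capField θ c X N) = Real.cos θ * lorentz n (killing c X) N := by
  simp only [lorentz_E₁, capField, killing, boost_apply, Prod.fst_add, Prod.fst_sub,
    Prod.smul_fst, smul_zero, sub_zero, PiLp.add_apply, PiLp.smul_apply, PiLp.sub_apply,
    smul_eq_mul, Eₗ_zero, E₁_zero]
  ring

end Hyperboloid

end

section

open Function Set Matrix MeasureTheory Filter Topology

/-! ### Antisymmetry of the derivative of the capillary field. -/

section FrameAlgebra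

variable {n : ℕ} {X N : E n × ℝ} {Xs Ns : Fin n → E n × ℝ} {g h : Matrix (Fin n) (Fin n) ℝ}

/-- The difference of the two sides is orthogonal to `X`, to `N` and to all `Xs j`. Were it nonzero,
pairing with it would be a nonzero functional killing all entries of `D(X, N, Xs)`, which does not
vanish. -/
theorem IsAdaptedFrame.weingarten (hf : IsAdaptedFrame (lorentz n) X N Xs Ns)
    (e : Module.Basis (Fin (n + 2)) ℝ (E n × ℝ)) (hg : ∀ i j, g i j = lorentz n (Xs i) (Xs j))
    (hh : ∀ i j, h i j = lorentz n (Ns i) (Xs j)) (hg0 : 0 < g.det) (i : Fin n) :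
    Ns i = ∑ j, (h * g⁻¹) i j • Xs j := by
  have hV : Module.finrank ℝ (E n × ℝ) = n + 2 := by
    rw [Module.finrank_eq_card_basis e, Fintype.card_fin]
  have hgeq : (Matrix.of fun i j => lorentz n (Xs i) (Xs j)) = g := by
    ext i j; exact (hg i j).symm
  obtain ⟨-, hF, -⟩ := hf.insertTwo_sq e (by rwa [hgeq])
  rw [← sub_eq_zero]
  refine eq_zero_of_lorentz_eq_zero ?_
  by_contra hne
  refine hF ?_
  rw [insertTwo_apply]
  refine alternating_eq_zero_of_functional _ hV hne fun j => ?_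
  simp only [map_sub, map_sum, map_smul, FunLike.coe_sub, FunLike.coe_sum, Finset.sum_apply,
    Pi.sub_apply, FunLike.coe_smul, Pi.smul_apply, smul_eq_mul]
  refine Fin.cases ?_ (fun j => Fin.cases ?_ (fun k => ?_) j) j
  · simp [lorentz_comm _ X, hf.X_Ns, hf.X_Xs]
  · simp [lorentz_comm _ N, hf.N_Ns, hf.N_Xs]
  · simp only [cons_val_succ, ← hg, ← hh, ← Matrix.mul_apply]
    rw [Matrix.mul_assoc, Matrix.nonsing_inv_mul _ (isUnit_iff_ne_zero.2 hg0.ne'), mul_one,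
      sub_self]

/-- The derivative of `capField` in the direction `(X', N')`. -/
def capFieldDeriv (θ c : ℝ) (X N X' N' : E n × ℝ) : E n × ℝ :=
  boost n X' + Real.cos θ • ((lorentz n (boost n X') N + lorentz n (killing c X) N') •
      (E₁ n, (0 : ℝ)) -
    (lorentz n (E₁ n, 0) N • boost n X' + lorentz n (E₁ n, 0) N' • killing c X) +
    (lorentz n (E₁ n, 0) X • boost n N' + lorentz n (E₁ n, 0) X' • boost n N))

/-- Terms linear in `dX` are antisymmetric because the boost is skew; the two containing `N` pair up
to an antisymmetric expression. Terms linear in `dN` become `A = h g⁻¹` applied to terms in `dX` by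
the Weingarten equation, and there `m ∧ a` and the boost are antisymmetric again. -/
theorem IsAdaptedFrame.exists_antisymm_capFieldDeriv
    (hf : IsAdaptedFrame (lorentz n) X N Xs Ns)
    (e : Module.Basis (Fin (n + 2)) ℝ (E n × ℝ)) (hg : ∀ i j, g i j = lorentz n (Xs i) (Xs j))
    (hh : ∀ i j, h i j = lorentz n (Ns i) (Xs j)) (hg0 : 0 < g.det) (θ c : ℝ) :
    ∃ K₀ K₁ : Matrix (Fin n) (Fin n) ℝ, K₀ᵀ = -K₀ ∧ K₁ᵀ = -K₁ ∧
      ∀ i j, lorentz n (capFieldDeriv θ c X N (Xs i) (Ns i)) (Xs j) =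
        (K₀ + h * g⁻¹ * K₁) i j := by
  set a : E n × ℝ := (E₁ n, 0) with ha
  set m := killing c X with hm
  refine ⟨Matrix.of fun i k => (1 - Real.cos θ * lorentz n a N) * lorentz n (boost n (Xs i)) (Xs k) +
      Real.cos θ * (lorentz n (boost n (Xs i)) N * lorentz n a (Xs k) +
        lorentz n a (Xs i) * lorentz n (boost n N) (Xs k)),
    Matrix.of fun j k => Real.cos θ * (lorentz n m (Xs j) * lorentz n a (Xs k) -
      lorentz n a (Xs j) * lorentz n m (Xs k) +
      lorentz n a X * lorentz n (boost n (Xs j)) (Xs k)), ?_, ?_, fun i k => ?_⟩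
  · ext i k
    simp only [Matrix.transpose_apply, Matrix.of_apply, Matrix.neg_apply]
    rw [lorentz_boost (Xs k) (Xs i), lorentz_comm (Xs k), lorentz_boost (Xs k) N,
      lorentz_comm (Xs k), lorentz_boost (Xs i) N, lorentz_comm (Xs i) (boost n N)]
    ring
  · ext i k
    simp only [Matrix.transpose_apply, Matrix.of_apply, Matrix.neg_apply]
    rw [lorentz_boost (Xs k) (Xs i), lorentz_comm (Xs k)]
    ring
  · have hw := hf.weingarten e hg hh hg0 i
    have hlin : ∀ l : E n × ℝ →L[ℝ] ℝ, l (Ns i) = ∑ j, (h * g⁻¹) i j * l (Xs j) := by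
      intro l
      conv_lhs => rw [hw]
      simp only [map_sum, map_smul, smul_eq_mul]
    have h1 := hlin (lorentz n m)
    have h2 := hlin (lorentz n a)
    have h3 := hlin (((lorentz n).flip (Xs k)).comp (boost n))
    simp only [ContinuousLinearMap.comp_apply, ContinuousLinearMap.flip_apply] at h3
    simp only [Matrix.add_apply, Matrix.mul_apply (N := Matrix.of _), Matrix.of_apply]
    have h4 : ∑ j, (h * g⁻¹) i j * (Real.cos θ * (lorentz n m (Xs j) * lorentz n a (Xs k) -
        lorentz n a (Xs j) * lorentz n m (Xs k) +
        lorentz n a X * lorentz n (boost n (Xs j)) (Xs k))) =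
        Real.cos θ * (lorentz n m (Ns i) * lorentz n a (Xs k) -
        lorentz n a (Ns i) * lorentz n m (Xs k) +
        lorentz n a X * lorentz n (boost n (Ns i)) (Xs k)) := by
      rw [h1, h2, h3]
      simp only [Finset.sum_mul, Finset.mul_sum, ← Finset.sum_sub_distrib, ← Finset.sum_add_distrib]
      refine Finset.sum_congr rfl fun j _ => by ring
    rw [h4]
    simp only [capFieldDeriv, ← ha, ← hm, map_add, map_sub, map_smul, _root_.add_apply, FunLike.coe_sub,
      Pi.sub_apply, FunLike.coe_smul, Pi.smul_apply, smul_eq_mul]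
    ring

end FrameAlgebra

/-! ### Boundary points and tangential derivatives in charts. -/

section Charts

variable {n : ℕ} [NeZero n] {M : Type*} [TopologicalSpace M] [CompactSpace M] [T2Space M]
  [ChartedSpace (EuclideanHalfSpace n) M] [IsManifold (𝓡∂ n) ∞ M]
  {V W : Type*} [NormedAddCommGroup V] [NormedSpace ℝ V]
  [NormedAddCommGroup W] [NormedSpace ℝ W]

/-- Interior points are sent by every chart to the interior of its target, hence into the open
half-space. -/
theorem mem_boundary_of_chart_zero {q : M} {y : EuclideanSpace ℝ (Fin n)}
    (hy : y ∈ (extChartAt (𝓡∂ n) q).target) (hy0 : y 0 = 0) :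
    (extChartAt (𝓡∂ n) q).symm y ∈ (𝓡∂ n).boundary M := by
  have h1 : IsManifold (𝓡∂ n) 1 M := IsManifold.of_le (n := ∞) (by simp)
  have hs : (extChartAt (𝓡∂ n) q).symm y ∈ (chartAt (EuclideanHalfSpace n) q).source := by
    rw [← extChartAt_source (𝓡∂ n)]
    exact (extChartAt (𝓡∂ n) q).map_target hy
  by_contra hcon
  have h2 : (extChartAt (𝓡∂ n) q).symm y ∈ (𝓡∂ n).interior M := by
    rw [← ModelWithCorners.compl_boundary]
    exact hcon
  have h3 := (ModelWithCorners.isInteriorPoint_iff_of_mem_atlas (n := 1) one_ne_zero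
    (chart_mem_atlas _ q) hs).1 h2
  change extChartAt (𝓡∂ n) q ((extChartAt (𝓡∂ n) q).symm y) ∈
    interior (extChartAt (𝓡∂ n) q).target at h3
  rw [(extChartAt (𝓡∂ n) q).right_inv hy] at h3
  have h4 := interior_mono (extChartAt_target_subset_range q) h3
  rw [interior_range_modelWithCornersEuclideanHalfSpace] at h4
  exact (ne_of_gt h4) hy0

theorem contMDiff_comp {k : WithTop ℕ∞} {f : M → V} {g : V → W}
    (hf : ContMDiff (𝓡∂ n) 𝓘(ℝ, V) k f) (hg : ∀ p, ContDiffAt ℝ k g (f p)) :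
    ContMDiff (𝓡∂ n) 𝓘(ℝ, W) k fun p => g (f p) :=
  fun p => (hg p).contMDiffAt.comp p (hf p)

/-- A function which is constant on the boundary part of a chart has vanishing tangential
derivatives there. -/
theorem chartDeriv_apply_eq_zero_of_const {f : M → V} (hf : ContMDiff (𝓡∂ n) 𝓘(ℝ, V) 1 f) {q : M}
    {k : V} (hk : ∀ y ∈ (extChartAt (𝓡∂ n) q).target, y 0 = 0 →
      f ((extChartAt (𝓡∂ n) q).symm y) = k)
    {y : EuclideanSpace ℝ (Fin n)} (hy : y ∈ (extChartAt (𝓡∂ n) q).target) (hy0 : y 0 = 0)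
    {j : Fin n} (hj : j ≠ 0) : chartDeriv q f y (stdVec n j) = 0 := by
  have hM : IsManifold (𝓡∂ n) 1 M := IsManifold.of_le (n := ∞) (by simp)
  have hd : HasFDerivWithinAt (f ∘ (extChartAt (𝓡∂ n) q).symm) (chartDeriv q f y)
      (range (𝓡∂ n)) y := (hasFDerivWithinAt_chart hf hy).mono_of_mem_nhdsWithin
    (target_mem_nhdsWithin hy)
  have hl : HasDerivAt (fun t : ℝ => y + t • stdVec n j) (stdVec n j) 0 := by
    simpa using ((hasDerivAt_id (0 : ℝ)).smul_const (stdVec n j)).const_add y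
  have hl0 : ∀ t : ℝ, (y + t • stdVec n j) 0 = 0 := by
    intro t
    simp [hy0, hj.symm]
  have hr : ∀ t : ℝ, y + t • stdVec n j ∈ range (𝓡∂ n) := by
    intro t
    rw [range_model]
    exact (hl0 t).ge
  have hc : HasDerivAt ((f ∘ (extChartAt (𝓡∂ n) q).symm) ∘ fun t : ℝ => y + t • stdVec n j)
      (chartDeriv q f y (stdVec n j)) 0 := by
    rw [← hasDerivWithinAt_univ]
    refine HasFDerivWithinAt.comp_hasDerivWithinAt (t := range (𝓡∂ n)) (0 : ℝ) ?_
      hl.hasDerivWithinAt fun t _ => hr t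
    simpa using hd
  have hev : ∀ᶠ t : ℝ in 𝓝 0, y + t • stdVec n j ∈ (extChartAt (𝓡∂ n) q).target := by
    have ht : Tendsto (fun t : ℝ => y + t • stdVec n j) (𝓝 0) (𝓝[range (𝓡∂ n)] y) := by
      refine tendsto_nhdsWithin_iff.2 ⟨?_, Eventually.of_forall hr⟩
      have := hl.continuousAt.tendsto
      simpa using this
    exact ht (target_mem_nhdsWithin hy)
  have hz : HasDerivAt ((f ∘ (extChartAt (𝓡∂ n) q).symm) ∘ fun t : ℝ => y + t • stdVec n j) 0 0 :=
    (hasDerivAt_const (0 : ℝ) k).congr_of_eventuallyEq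
      (hev.mono fun t ht => hk _ ht (hl0 t))
  exact hc.unique hz

theorem diffAt_bilin {U : Type*} [NormedAddCommGroup U] [NormedSpace ℝ U] (B : V →L[ℝ] W →L[ℝ] U)
    {f : M → V} {k : M → W} {p : M}
    (hf : MDifferentiableAt (𝓡∂ n) 𝓘(ℝ, V) f p) (hk : MDifferentiableAt (𝓡∂ n) 𝓘(ℝ, W) k p)
    (v : EuclideanSpace ℝ (Fin n)) :
    diffAt (n := n) (fun p => B (f p) (k p)) p v =
      B (f p) (diffAt k p v) + B (diffAt f p v) (k p) := by
  have h1 := hasFDerivWithinAt_diffAt hf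
  have h2 := hasFDerivWithinAt_diffAt hk
  have hc : ContinuousAt (fun p => B (f p) (k p)) p :=
    ((B.continuous.continuousAt.comp hf.continuousAt)).clm_apply hk.continuousAt
  have h := (B.hasFDerivAt.comp_hasFDerivWithinAt _ h1).clm_apply h2
  rw [diffAt_eq_of_hasFDerivWithinAt hc h]
  simp only [Function.comp_apply, extChartAt_to_inv, _root_.add_apply, ContinuousLinearMap.comp_apply,
    ContinuousLinearMap.flip_apply]

theorem diffAt_clm (L : V →L[ℝ] W) {f : M → V} {p : M}
    (hf : MDifferentiableAt (𝓡∂ n) 𝓘(ℝ, V) f p) (v : EuclideanSpace ℝ (Fin n)) :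
    diffAt (n := n) (fun p => L (f p)) p v = L (diffAt f p v) := by
  rw [diffAt_comp L.hasFDerivAt hf]
  rfl

theorem diffAt_const (a : V) (p : M) : diffAt (n := n) (fun _ : M => a) p = 0 :=
  diffAt_eq_of_hasFDerivWithinAt continuousAt_const (hasFDerivWithinAt_const _ _ _)

end Charts

end

section

open Function Set MeasureTheory Filter Topology

/-! ### Capillary hypersurfaces lifted to the hyperboloid. -/

section Minkowski

variable {n : ℕ} [NeZero n] {M : Type*} [TopologicalSpace M] [CompactSpace M] [T2Space M]
  [ChartedSpace (EuclideanHalfSpace n) M] [IsManifold (𝓡∂ n) ∞ M]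
  {x ν : M → E n} {θ : ℝ}

theorem contDiffAt_hypPoint {z : E n} (hz : z (Fin.last n) ≠ 0) : ContDiffAt ℝ ∞ hypPoint z := by
  have hr : ContDiffAt ℝ ∞ (fun z : E n => (z (Fin.last n))⁻¹) z :=
    ContDiffAt.inv (by fun_prop) hz
  exact ContDiffAt.prodMk ((hr.smul contDiffAt_id).add ((hr.sub contDiffAt_const).smul
    contDiffAt_const)) (hr.mul (contDiffAt_id.inner ℝ contDiffAt_id))

theorem contDiffAt_hypLift {q : E n × E n} (hz : q.1 (Fin.last n) ≠ 0) :
    ContDiffAt ℝ ∞ (fun q : E n × E n => hypLift q.1 q.2) q := by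
  have hr : ContDiffAt ℝ ∞ (fun q : E n × E n => (q.1 (Fin.last n))⁻¹) q :=
    ContDiffAt.inv (by fun_prop) hz
  have h1 : ContDiffAt ℝ ∞ (fun q : E n × E n => q.1) q := contDiffAt_fst
  have h2 : ContDiffAt ℝ ∞ (fun q : E n × E n => q.2) q := contDiffAt_snd
  have hl : ContDiffAt ℝ ∞ (fun q : E n × E n => q.2 (Fin.last n)) q := by fun_prop
  exact ContDiffAt.prodMk ((hr.smul h2).sub ((hl.mul (hr.pow 2)).smul (h1.add contDiffAt_const)))
    (((contDiffAt_const.mul hr).mul (h1.inner ℝ h2)).sub ((hl.mul (hr.pow 2)).mul (h1.inner ℝ h1)))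

theorem IsCapillary.last_ne (hc : IsCapillary θ x ν) (p : M) : x p (Fin.last n) ≠ 0 :=
  (hc.mem_half p).ne'

theorem IsCapillary.contMDiff_hypPoint (hc : IsCapillary θ x ν) :
    ContMDiff (𝓡∂ n) 𝓘(ℝ, E n × ℝ) ∞ fun p => hypPoint (x p) :=
  contMDiff_comp hc.smooth fun p => contDiffAt_hypPoint (hc.last_ne p)

theorem IsCapillary.contMDiff_hypLift (hc : IsCapillary θ x ν) :
    ContMDiff (𝓡∂ n) 𝓘(ℝ, E n × ℝ) ∞ fun p => hypLift (x p) (ν p) :=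
  fun p => ContMDiffAt.comp (I' := 𝓘(ℝ, E n × E n)) (g := fun q : E n × E n => hypLift q.1 q.2)
    (f := fun p => (x p, ν p)) p (contDiffAt_hypLift (q := (x p, ν p)) (hc.last_ne p)).contMDiffAt
    ((hc.smooth p).prodMk_space (hc.normal_smooth p))

theorem mdifferentiableAt_of_infty {V : Type*} [NormedAddCommGroup V] [NormedSpace ℝ V]
    {f : M → V} (hf : ContMDiff (𝓡∂ n) 𝓘(ℝ, V) ∞ f) (p : M) :
    MDifferentiableAt (𝓡∂ n) 𝓘(ℝ, V) f p :=
  ((contMDiff_one_of_infty hf) p).mdifferentiableAt one_ne_zero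

theorem IsCapillary.diffAt_hypPoint (hc : IsCapillary θ x ν) (p : M)
    (v : EuclideanSpace ℝ (Fin n)) :
    diffAt (n := n) (fun p => hypPoint (x p)) p v = hypLift (x p) (diffAt x p v) := by
  rw [diffAt_comp (hasFDerivAt_hypPoint (hc.last_ne p)) (mdifferentiableAt_of_infty hc.smooth p)]
  rfl

theorem IsCapillary.diffAt_hypLift (hc : IsCapillary θ x ν) (p : M)
    (v : EuclideanSpace ℝ (Fin n)) :
    diffAt (n := n) (fun p => hypLift (x p) (ν p)) p v =
      hypLift (x p) (diffAt ν p v) + hypLiftDeriv (x p) (ν p) (diffAt x p v) := by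
  have h1 := mdifferentiableAt_of_infty hc.smooth p
  have h2 := mdifferentiableAt_of_infty hc.normal_smooth p
  have hp : diffAt (n := n) (fun p => (x p, ν p)) p = (diffAt x p).prod (diffAt ν p) :=
    diffAt_eq_of_hasFDerivWithinAt (h1.continuousAt.prodMk h2.continuousAt)
      ((hasFDerivWithinAt_diffAt h1).prodMk (hasFDerivWithinAt_diffAt h2))
  have h3 := diffAt_comp (g := fun q : E n × E n => hypLift q.1 q.2) (f := fun p => (x p, ν p))
    (hasFDerivAt_hypLift (ν p) (hc.last_ne p))
    (mdifferentiableAt_of_infty (hc.smooth.prodMk_space hc.normal_smooth) p)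
  rw [h3, hp]
  rfl

theorem IsCapillary.lorentz_normal (hc : IsCapillary θ x ν) (p : M) :
    lorentz n (hypLift (x p) (ν p)) (hypLift (x p) (ν p)) = 1 := by
  rw [lorentz_hypLift_hypLift (hc.last_ne p), hc.normal_unit]

theorem lorentz_diffAt_of_const {f k : M → E n × ℝ} {r : ℝ} (h : ∀ p, lorentz n (f p) (k p) = r)
    (hf : ContMDiff (𝓡∂ n) 𝓘(ℝ, E n × ℝ) ∞ f) (hk : ContMDiff (𝓡∂ n) 𝓘(ℝ, E n × ℝ) ∞ k) (p : M)
    (v : EuclideanSpace ℝ (Fin n)) :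
    lorentz n (f p) (diffAt k p v) + lorentz n (diffAt f p v) (k p) = 0 := by
  rw [← diffAt_bilin (lorentz n) (mdifferentiableAt_of_infty hf p)
    (mdifferentiableAt_of_infty hk p), show (fun p => lorentz n (f p) (k p)) = fun _ => r from
      funext h, diffAt_const]
  rfl

theorem IsCapillary.lorentz_normal_diffAt (hc : IsCapillary θ x ν) (p : M) (i : Fin n) :
    lorentz n (hypLift (x p) (ν p)) (diffAt (n := n) (fun p => hypPoint (x p)) p (stdVec n i)) =
      0 := by
  rw [hc.diffAt_hypPoint, lorentz_hypLift_hypLift (hc.last_ne p)]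
  exact hc.normal_orth p i

/-- The relations involving `dN` are obtained by differentiating `⟨X,N⟩ = 0` and `⟨N,N⟩ = 1`. -/
theorem IsCapillary.adapted (hc : IsCapillary θ x ν) (p : M) :
    IsAdaptedFrame (lorentz n) (hypPoint (x p)) (hypLift (x p) (ν p))
      (fun i => diffAt (n := n) (fun p => hypPoint (x p)) p (stdVec n i))
      (fun i => diffAt (n := n) (fun p => hypLift (x p) (ν p)) p (stdVec n i)) where
  symm := lorentz_comm
  XX := lorentz_hypPoint_hypPoint (hc.last_ne p)
  NN := hc.lorentz_normal p
  XN := lorentz_hypPoint_hypLift (hc.last_ne p) _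
  X_Xs i := by rw [hc.diffAt_hypPoint, lorentz_hypPoint_hypLift (hc.last_ne p)]
  N_Xs i := hc.lorentz_normal_diffAt p i
  X_Ns i := by
    have h := lorentz_diffAt_of_const (n := n) (f := fun p => hypPoint (x p))
      (fun p => lorentz_hypPoint_hypLift (hc.last_ne p) (ν p)) hc.contMDiff_hypPoint
      hc.contMDiff_hypLift p (stdVec n i)
    rwa [lorentz_comm (diffAt _ p _), hc.lorentz_normal_diffAt, add_zero] at h
  N_Ns i := by
    have h := lorentz_diffAt_of_const (n := n) hc.lorentz_normal
      hc.contMDiff_hypLift hc.contMDiff_hypLift p (stdVec n i)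
    rw [lorentz_comm (diffAt _ p _)] at h
    linarith

theorem IsCapillary.firstForm_eq (hc : IsCapillary θ x ν) (p : M) (i j : Fin n) :
    firstForm x p i j = lorentz n (diffAt (n := n) (fun p => hypPoint (x p)) p (stdVec n i))
      (diffAt (n := n) (fun p => hypPoint (x p)) p (stdVec n j)) := by
  rw [hc.diffAt_hypPoint, hc.diffAt_hypPoint, lorentz_hypLift_hypLift (hc.last_ne p)]
  rfl

theorem IsCapillary.secondForm_eq (hc : IsCapillary θ x ν) (p : M) (i j : Fin n) :
    secondForm x ν p i j =
      lorentz n (diffAt (n := n) (fun p => hypLift (x p) (ν p)) p (stdVec n i))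
        (diffAt (n := n) (fun p => hypPoint (x p)) p (stdVec n j)) := by
  rw [hc.diffAt_hypPoint, hc.diffAt_hypLift, map_add, add_apply,
    lorentz_hypLift_hypLift (hc.last_ne p), lorentz_hypLiftDeriv_hypLift (hc.last_ne p)]
  simp only [hypInner, ← add_div, ← inner_add_left]
  rfl

theorem IsCapillary.firstForm_posDef (hc : IsCapillary θ x ν) (p : M) :
    (firstForm x p).PosDef := by
  have hpos : 0 < x p (Fin.last n) := hc.mem_half p
  refine Matrix.PosDef.of_dotProduct_mulVec_pos ?_ fun v hv => ?_
  · ext i j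
    simp [firstForm, hypInner, real_inner_comm]
  · have h1 : star v ⬝ᵥ (firstForm x p).mulVec v = hypInner (x p)
        (diffAt x p (∑ i, v i • stdVec n i)) (diffAt x p (∑ i, v i • stdVec n i)) := by
      simp only [dotProduct, Matrix.mulVec, firstForm, Matrix.of_apply, hypInner, map_sum, map_smul,
        sum_inner, inner_sum, real_inner_smul_left, real_inner_smul_right, Finset.mul_sum,
        Finset.sum_div, star_trivial]
      refine Finset.sum_congr rfl fun i _ => Finset.sum_congr rfl fun j _ => ?_
      rw [frame_eq_diffAt, frame_eq_diffAt, real_inner_comm]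
      ring
    rw [h1]
    refine div_pos (real_inner_self_pos.2 fun h0 => hv ?_) (by positivity)
    have h2 : (∑ i, v i • stdVec n i) = (0 : EuclideanSpace ℝ (Fin n)) :=
      hc.immersion p (h0.trans (map_zero (diffAt x p)).symm)
    funext i
    have := congrArg (fun z : EuclideanSpace ℝ (Fin n) => z i) h2
    simpa [Pi.single_apply] using this

/-- Differentiating `⟨N, ∂_j X⟩ = 0` in the chart gives `⟨∂_i N, ∂_j X⟩ = -⟨N, ∂_i ∂_j X⟩`, and
second derivatives commute, also at the boundary. -/
theorem IsCapillary.secondForm_symm (hc : IsCapillary θ x ν) (p : M) :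
    (secondForm x ν p).transpose = secondForm x ν p := by
  have hM1 : IsManifold (𝓡∂ n) 1 M := IsManifold.of_le (n := ∞) (by simp)
  have hM2 : IsManifold (𝓡∂ n) 2 M := IsManifold.of_le (n := ∞) (WithTop.coe_le_coe.2 le_top)
  have hX := hc.contMDiff_hypPoint
  have hN := hc.contMDiff_hypLift
  set X : M → E n × ℝ := fun p => hypPoint (x p) with hXd
  set N : M → E n × ℝ := fun p => hypLift (x p) (ν p) with hNd
  have hX2 : ContMDiff (𝓡∂ n) 𝓘(ℝ, E n × ℝ) 2 X := hX.of_le (WithTop.coe_le_coe.2 le_top)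
  have hy := mem_extChartAt_target (I := 𝓡∂ n) p
  obtain ⟨X'', hX'', hsym⟩ := exists_hasFDerivWithinAt_chartDeriv hX2 hy
  have hN' := hasFDerivWithinAt_chart (contMDiff_one_of_infty hN) hy
  have key : ∀ i j, lorentz n (diffAt N p (stdVec n i)) (diffAt X p (stdVec n j)) =
      -lorentz n (N p) (X'' (stdVec n i) (stdVec n j)) := by
    intro i j
    have h1 := ((lorentz n).hasFDerivAt.comp_hasFDerivWithinAt _ hN').clm_apply
      (hX''.clm_apply (hasFDerivWithinAt_const (stdVec n j) _ _))
    have h2 : HasFDerivWithinAt (fun y => lorentz n ((N ∘ (extChartAt (𝓡∂ n) p).symm) y)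
        (chartDeriv p X y (stdVec n j))) (0 : EuclideanSpace ℝ (Fin n) →L[ℝ] ℝ)
        (extChartAt (𝓡∂ n) p).target (extChartAt (𝓡∂ n) p p) := by
      refine (hasFDerivWithinAt_const (0 : ℝ) _ _).congr' (fun y hy => ?_) hy
      rw [chartDeriv_eq_comp (contMDiff_one_of_infty hX) hy, ContinuousLinearMap.comp_apply,
        eq_sum_stdVec (chartJac p y (stdVec n j)), map_sum, map_sum]
      refine Finset.sum_eq_zero fun k _ => ?_
      rw [map_smul, map_smul]
      refine smul_eq_zero_of_right _ ?_
      exact hc.lorentz_normal_diffAt _ k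
    have h3 := (uniqueDiffOn_target p _ hy).eq h1 h2
    have h4 := congrArg (fun l => l (stdVec n i)) h3
    simp only [add_apply, ContinuousLinearMap.comp_apply, ContinuousLinearMap.flip_apply,
      zero_apply, comp_apply, extChartAt_to_inv] at h4
    rw [chartDeriv_self (mdifferentiableAt_of_infty hX p),
      chartDeriv_self (mdifferentiableAt_of_infty hN p)] at h4
    simp only [map_zero, zero_add] at h4
    linarith
  ext i j
  rw [Matrix.transpose_apply, hc.secondForm_eq, hc.secondForm_eq, key, key, hsym]

end Minkowski

theorem contDiff_capField {n : ℕ} (θ c : ℝ) :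
    ContDiff ℝ ∞ fun q : (E n × ℝ) × (E n × ℝ) => capField θ c q.1 q.2 := by
  unfold capField killing
  fun_prop

theorem exists_hasFDerivAt_capField {n : ℕ} (θ c : ℝ) (X N : E n × ℝ) :
    ∃ L : (E n × ℝ) × (E n × ℝ) →L[ℝ] E n × ℝ,
      HasFDerivAt (fun q : (E n × ℝ) × (E n × ℝ) => capField θ c q.1 q.2) L (X, N) ∧
        ∀ X' N', L (X', N') = capFieldDeriv θ c X N X' N' := by
  have h1 : HasFDerivAt (fun q : (E n × ℝ) × (E n × ℝ) => q.1) _ (X, N) := hasFDerivAt_fst (𝕜 := ℝ)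
  have h2 : HasFDerivAt (fun q : (E n × ℝ) × (E n × ℝ) => q.2) _ (X, N) := hasFDerivAt_snd (𝕜 := ℝ)
  have hm := ((boost n).hasFDerivAt.comp (X, N) h1).sub_const (c • (0, 2))
  have hmN := ((lorentz n).hasFDerivAt.comp (X, N) hm).clm_apply h2
  have haN := (lorentz n (E₁ n, 0)).hasFDerivAt.comp (X, N) h2
  have haX := (lorentz n (E₁ n, 0)).hasFDerivAt.comp (X, N) h1
  have hRN := (boost n).hasFDerivAt.comp (X, N) h2
  refine ⟨_, hm.add ((((hmN.smul_const (E₁ n, (0 : ℝ))).sub (haN.smul hm)).add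
    (haX.smul hRN)).const_smul (Real.cos θ)), fun X' N' => ?_⟩
  simp only [capFieldDeriv, killing, add_apply, FunLike.coe_sub, Pi.sub_apply, FunLike.coe_smul,
    Pi.smul_apply, ContinuousLinearMap.comp_apply, ContinuousLinearMap.smulRight_apply,
    ContinuousLinearMap.flip_apply, ContinuousLinearMap.coe_fst', ContinuousLinearMap.coe_snd',
    comp_apply]
  congr 2
  module

/-! ### Vanishing of the boundary flux. -/

section Minkowski

variable {n : ℕ} [NeZero n] {M : Type*} [TopologicalSpace M] [CompactSpace M] [T2Space M]
  [ChartedSpace (EuclideanHalfSpace n) M] [IsManifold (𝓡∂ n) ∞ M]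
  {x ν : M → E n} {θ : ℝ}

theorem IsCapillary.normal_zero_eq (hc : IsCapillary θ x ν) {p : M}
    (hp : p ∈ (𝓡∂ n).boundary M) : ν p 0 = Real.cos θ * x p (Fin.last n) := by
  have h := hc.contact p hp
  have h0 := hc.last_ne p
  simp only [hypInner, normalP, inner_neg_right, real_inner_smul_right, inner_E₁_right] at h
  field_simp at h
  linarith

theorem IsCapillary.lorentz_E₁_hypPoint (hc : IsCapillary θ x ν) {p : M}
    (hp : p ∈ (𝓡∂ n).boundary M) : lorentz n (E₁ n, 0) (hypPoint (x p)) = 0 := by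
  rw [lorentz_E₁]
  simp [hypPoint, hc.boundary_zero p hp, Eₗ_zero]

theorem IsCapillary.lorentz_E₁_hypLift (hc : IsCapillary θ x ν) {p : M}
    (hp : p ∈ (𝓡∂ n).boundary M) :
    lorentz n (E₁ n, 0) (hypLift (x p) (ν p)) = Real.cos θ := by
  have h0 := hc.last_ne p
  rw [lorentz_E₁]
  simp [hypLift_apply, hc.boundary_zero p hp, Eₗ_zero, hc.normal_zero_eq hp]
  field_simp

theorem IsCapillary.contMDiff_parallel (hc : IsCapillary θ x ν) (s : ℝ) :
    ContMDiff (𝓡∂ n) 𝓘(ℝ, E n × ℝ) ∞ fun p => hypPoint (x p) + s • hypLift (x p) (ν p) :=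
  hc.contMDiff_hypPoint.add (contMDiff_comp hc.contMDiff_hypLift fun _ =>
    (contDiff_const_smul s).contDiffAt)

theorem IsCapillary.diffAt_parallel (hc : IsCapillary θ x ν) (s : ℝ) (p : M) :
    diffAt (n := n) (fun p => hypPoint (x p) + s • hypLift (x p) (ν p)) p =
      diffAt (fun p => hypPoint (x p)) p + s • diffAt (fun p => hypLift (x p) (ν p)) p :=
  diffAt_eq_of_hasFDerivWithinAt (hc.contMDiff_parallel s).continuous.continuousAt
    ((hasFDerivWithinAt_diffAt (mdifferentiableAt_of_infty hc.contMDiff_hypPoint p)).add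
      ((hasFDerivWithinAt_diffAt
        (mdifferentiableAt_of_infty hc.contMDiff_hypLift p)).const_smul s))

theorem finrank_model (n : ℕ) : Module.finrank ℝ (E n × ℝ) = n + 2 := by
  rw [Module.finrank_prod]
  simp

/-- The flux form of `capField` vanishes along the boundary. -/
theorem IsCapillary.insertTwo_capField_eq_zero (hc : IsCapillary θ x ν) (c s : ℝ)
    (D : (E n × ℝ) [⋀^Fin (n + 2)]→L[ℝ] ℝ) {q : M} {y : EuclideanSpace ℝ (Fin n)}
    (hy : y ∈ (extChartAt (𝓡∂ n) q).target) (hy0 : y 0 = 0) :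
    let p := (extChartAt (𝓡∂ n) q).symm y
    insertTwo D (hypPoint (x p)) (hypLift (x p) (ν p)) (update (fun j => chartDeriv q
      (fun p => hypPoint (x p) + s • hypLift (x p) (ν p)) y (stdVec n j)) 0
        (capField θ c (hypPoint (x p)) (hypLift (x p) (ν p)))) = 0 := by
  intro p
  have hp : p ∈ (𝓡∂ n).boundary M := mem_boundary_of_chart_zero hy hy0
  have hY : ContMDiff (𝓡∂ n) 𝓘(ℝ, E n × ℝ) ∞ fun p => hypPoint (x p) + s • hypLift (x p) (ν p) :=
    hc.contMDiff_parallel s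
  set Y := fun p => hypPoint (x p) + s • hypLift (x p) (ν p) with hYd
  have hYj : ∀ v, chartDeriv q Y y v =
      diffAt (n := n) (fun p => hypPoint (x p)) p (chartJac q y v) +
        s • diffAt (n := n) (fun p => hypLift (x p) (ν p)) p (chartJac q y v) := by
    intro v
    rw [chartDeriv_eq_comp (contMDiff_one_of_infty hY) hy, ContinuousLinearMap.comp_apply, hYd,
      hc.diffAt_parallel]
    rfl
  have hNX : lorentz n (hypLift (x p) (ν p)) (hypPoint (x p)) = 0 := by
    rw [lorentz_comm]; exact lorentz_hypPoint_hypLift (hc.last_ne p) _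
  have hNY : ∀ v, lorentz n (hypLift (x p) (ν p)) (chartDeriv q Y y v) = 0 := by
    intro v
    have ha := hc.adapted p
    rw [hYj, eq_sum_stdVec (chartJac q y v), map_sum, map_sum, map_add, map_smul, map_sum, map_sum]
    have e1 : ∀ k, lorentz n (hypLift (x p) (ν p))
        (diffAt (n := n) (fun p => hypPoint (x p)) p (chartJac q y v k • stdVec n k)) = 0 := by
      intro k
      rw [map_smul, map_smul, ha.N_Xs, smul_zero]
    have e2 : ∀ k, lorentz n (hypLift (x p) (ν p))
        (diffAt (n := n) (fun p => hypLift (x p) (ν p)) p (chartJac q y v k • stdVec n k)) = 0 := by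
      intro k
      rw [map_smul, map_smul, ha.N_Ns, smul_zero]
    simp only [e1, e2, Finset.sum_const_zero, smul_zero, add_zero]
  -- If `cos² θ = 1` the hypersurface is tangent to `P` along its boundary: `N = cos θ · a`, the
  -- vectors `a` and `N` no longer yield a conormal, and instead `w` is a multiple of `N`, so the
  -- determinant has a repeated entry.
  by_cases hs : Real.cos θ ^ 2 = 1
  · have hy1 : lorentz n (E₁ n, 0) (hypPoint (x p)) = 0 := hc.lorentz_E₁_hypPoint hp
    have hl0 := hc.last_ne p
    have hν0 := hc.normal_zero_eq hp
    have hν : ν p = (Real.cos θ * x p (Fin.last n)) • E₁ n := by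
      have hsq : ‖ν p - (Real.cos θ * x p (Fin.last n)) • E₁ n‖ ^ 2 = 0 := by
        have h1 := hc.normal_unit p
        rw [hypInner, div_eq_one_iff_eq (by positivity)] at h1
        rw [← real_inner_self_eq_norm_sq]
        simp only [inner_sub_left, inner_sub_right, real_inner_smul_left, real_inner_smul_right,
          inner_E₁_left, inner_E₁_right, h1, hν0, E₁_zero]
        linear_combination (-(x p (Fin.last n)) ^ 2) * hs
      rw [← sub_eq_zero, ← norm_eq_zero]
      exact pow_eq_zero_iff two_ne_zero |>.1 hsq
    have hN : hypLift (x p) (ν p) = Real.cos θ • (E₁ n, (0 : ℝ)) := by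
      rw [hν, map_smul, hypLift_apply]
      refine Prod.ext ?_ ?_
      · simp [E₁_last, smul_smul, mul_assoc, hl0]
      · simp [E₁_last, inner_E₁_right, hc.boundary_zero p hp]
    have ha : (E₁ n, (0 : ℝ)) = Real.cos θ • hypLift (x p) (ν p) := by
      rw [hN, smul_smul, ← pow_two, hs, one_smul]
    have hw : capField θ c (hypPoint (x p)) (hypLift (x p) (ν p)) =
        lorentz n (killing c (hypPoint (x p))) (hypLift (x p) (ν p)) •
          hypLift (x p) (ν p) := by
      rw [capField, hy1, hc.lorentz_E₁_hypLift hp, ha, zero_smul, add_zero, smul_sub, smul_smul,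
        smul_smul, smul_smul, ← pow_two, hs, one_smul, mul_comm _ (Real.cos θ), ← mul_assoc,
        ← pow_two, hs, one_mul]
      abel
    rw [hw, ContinuousAlternatingMap.map_update_smul, insertTwo_swap_right]
    have h0 : insertTwo D (hypPoint (x p)) (hypLift (x p) (ν p)) (update (fun j =>
        chartDeriv q Y y (stdVec n j)) 0 (hypLift (x p) (ν p))) = 0 := by
      have := insertTwo_swap_right D (hypPoint (x p)) (hypLift (x p) (ν p))
        (hypLift (x p) (ν p)) (fun j => chartDeriv q Y y (stdVec n j)) 0
      linarith
    rw [h0, neg_zero, smul_zero]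
  -- The functional `⟨a - cos θ N, ·⟩` takes the value `1 - cos² θ ≠ 0` at `a` and kills every
  -- entry: `X` and `N` by the boundary conditions, `w` by `lorentz_E₁_capField`.
  · rw [insertTwo_apply]
    refine alternating_eq_zero_of_functional D (finrank_model n)
      (l := lorentz n (E₁ n, 0) - Real.cos θ • lorentz n (hypLift (x p) (ν p))) (fun h => hs ?_)
      fun j => ?_
    · have h1 := congrArg (fun l => l (E₁ n, (0 : ℝ))) h
      simp only [FunLike.coe_sub, Pi.sub_apply, FunLike.coe_smul, Pi.smul_apply, smul_eq_mul,
        zero_apply] at h1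
      rw [lorentz_comm (hypLift _ _), hc.lorentz_E₁_hypLift hp, lorentz_E₁] at h1
      simp only [E₁_zero] at h1
      linarith
    · simp only [FunLike.coe_sub, Pi.sub_apply, FunLike.coe_smul, Pi.smul_apply, smul_eq_mul]
      refine Fin.cases ?_ (fun j => Fin.cases ?_ (fun k => ?_) j) j
      · simp only [Matrix.cons_val_zero]
        rw [hNX, hc.lorentz_E₁_hypPoint hp, mul_zero, sub_zero]
      · simp only [Matrix.cons_val_zero, Matrix.cons_val_succ]
        rw [hc.lorentz_E₁_hypLift hp, hc.lorentz_normal, mul_one, sub_self]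
      · simp only [Matrix.cons_val_succ]
        by_cases hk : k = 0
        · subst hk
          rw [update_self, lorentz_E₁_capField, lorentz_comm (hypLift _ _),
            lorentz_capField_normal, sub_self]
        · rw [update_of_ne hk, hNY, mul_zero, sub_zero]
          -- For the slots `k ≠ 0`, tangent to the boundary: `⟨a, Y⟩` equals the constant `s cos θ`
          -- there, so its tangential derivatives are zero.
          have hf : ContMDiff (𝓡∂ n) 𝓘(ℝ, ℝ) 1 fun p => lorentz n (E₁ n, 0) (Y p) :=
            contMDiff_comp (contMDiff_one_of_infty hY) fun p =>
              (lorentz n (E₁ n, 0)).contDiff.contDiffAt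
          have h1 := chartDeriv_apply_eq_zero_of_const hf (k := s * Real.cos θ)
            (fun y' hy' hy0' => by
              have hb := mem_boundary_of_chart_zero hy' hy0'
              simp only [hYd, map_add, map_smul, hc.lorentz_E₁_hypPoint hb,
                hc.lorentz_E₁_hypLift hb, zero_add, smul_eq_mul]) hy hy0 hk
          rw [chartDeriv_eq_comp hf hy, ContinuousLinearMap.comp_apply,
            diffAt_clm _ (mdifferentiableAt_of_infty hY _)] at h1
          rwa [chartDeriv_eq_comp (contMDiff_one_of_infty hY) hy, ContinuousLinearMap.comp_apply]

end Minkowski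

/-! ### The Minkowski formulas. -/

section Minkowski

variable {n : ℕ} [NeZero n] {M : Type*} [TopologicalSpace M] [CompactSpace M] [T2Space M]
  [ChartedSpace (EuclideanHalfSpace n) M] [IsManifold (𝓡∂ n) ∞ M] [MeasurableSpace M]
  [BorelSpace M] {x ν : M → E n} {θ : ℝ}

/-- Stokes' theorem for `D(X, N, w, dY, …, dY)`, divided by the same form on `dX`. The latter is the
area form times a constant `κ` up to sign, by `IsAdaptedFrame.insertTwo_sq`. -/
theorem IsCapillary.integral_parallel (hc : IsCapillary θ x ν) (c s : ℝ) :
    let A := fun p => secondForm x ν p * (firstForm x p)⁻¹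
    let r := fun p => c * (1 / x p (Fin.last n) - Real.cos θ * hypInner (x p) (E₁ n) (ν p)) *
        (1 + s • A p).adjugate.trace -
      hypInner (x p) (x p - c • Eₗ n) (ν p) * (A p * (1 + s • A p).adjugate).trace
    Integrable r (area x) ∧ ∫ p, r p ∂(area x) = 0 := by
  intro A r
  -- The sign of the ambient Gram determinant is read off at a point of `M`, so the empty manifold
  -- is treated separately.
  rcases isEmpty_or_nonempty M with hM | ⟨⟨p₀⟩⟩
  · have : area x = 0 := Measure.eq_zero_of_isEmpty _
    simp [this]
  let e : Module.Basis (Fin (n + 2)) ℝ (E n × ℝ) := Module.finBasisOfFinrankEq ℝ _ (finrank_model n)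
  have hX := hc.contMDiff_hypPoint
  have hN := hc.contMDiff_hypLift
  set X : M → E n × ℝ := fun p => hypPoint (x p) with hXd
  set N : M → E n × ℝ := fun p => hypLift (x p) (ν p) with hNd
  set Y : M → E n × ℝ := fun p => X p + s • N p with hYd
  set w : M → E n × ℝ := fun p => capField θ c (X p) (N p) with hwd
  let β : M → (E n × ℝ) [⋀^Fin n]→L[ℝ] ℝ := fun p => insertTwo (basisDet e) (X p) (N p)
  let J := (Matrix.of fun i j => lorentz n (e i) (e j)).det
  have hg : ∀ p, (Matrix.of fun i j => lorentz n (diffAt (n := n) X p (stdVec n i))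
      (diffAt (n := n) X p (stdVec n j))) = firstForm x p := by
    intro p
    ext i j
    exact (hc.firstForm_eq p i j).symm
  have hgpos : ∀ p, 0 < (firstForm x p).det := fun p => (hc.firstForm_posDef p).det_pos
  have hsq : ∀ p, J < 0 ∧ β p (fun j => diffAt X p (stdVec n j)) ≠ 0 ∧
      β p (fun j => diffAt X p (stdVec n j)) ^ 2 = (-J)⁻¹ * (firstForm x p).det := by
    intro p
    have h := (hc.adapted p).insertTwo_sq e
    rw [hg] at h
    exact h (hgpos p)
  have hβ : ContMDiff (𝓡∂ n) 𝓘(ℝ, (E n × ℝ) [⋀^Fin n]→L[ℝ] ℝ) ∞ β := by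
    have h1 : ContDiff ℝ ∞ fun q : (E n × ℝ) × (E n × ℝ) => insertTwo (basisDet e) q.1 q.2 := by
      fun_prop
    exact contMDiff_comp (g := fun q : (E n × ℝ) × (E n × ℝ) => insertTwo (basisDet e) q.1 q.2)
      (f := fun p => (X p, N p)) (hX.prodMk_space hN) fun p => h1.contDiffAt
  have hXN : ContMDiff (𝓡∂ n) 𝓘(ℝ, (E n × ℝ) × (E n × ℝ)) ∞ fun p => (X p, N p) :=
    hX.prodMk_space hN
  have hw : ContMDiff (𝓡∂ n) 𝓘(ℝ, E n × ℝ) ∞ w :=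
    contMDiff_comp (g := fun q : (E n × ℝ) × (E n × ℝ) => capField θ c q.1 q.2)
      (f := fun p => (X p, N p)) hXN fun p => (contDiff_capField θ c).contDiffAt
  have hY : ContMDiff (𝓡∂ n) 𝓘(ℝ, E n × ℝ) ∞ Y := hc.contMDiff_parallel s
  have hdw : ∀ p v, diffAt (n := n) w p v =
      capFieldDeriv θ c (X p) (N p) (diffAt X p v) (diffAt N p v) := by
    intro p v
    obtain ⟨L, hL, hL'⟩ := exists_hasFDerivAt_capField θ c (X p) (N p)
    have h1 := diffAt_comp (g := fun q : (E n × ℝ) × (E n × ℝ) => capField θ c q.1 q.2)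
      (f := fun p => (X p, N p)) hL (mdifferentiableAt_of_infty hXN p)
    have h2 : diffAt (n := n) (fun p => (X p, N p)) p = (diffAt X p).prod (diffAt N p) :=
      diffAt_eq_of_hasFDerivWithinAt hXN.continuous.continuousAt
        ((hasFDerivWithinAt_diffAt (mdifferentiableAt_of_infty hX p)).prodMk
          (hasFDerivWithinAt_diffAt (mdifferentiableAt_of_infty hN p)))
    rw [hwd, h1, h2]
    exact hL' _ _
  have hdβ : ∀ p v, diffAt (n := n) β p v =
      insertTwo (basisDet e) (X p) (diffAt N p v) + insertTwo (basisDet e) (diffAt X p v) (N p) :=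
    fun p v => diffAt_bilin (insertTwo (basisDet e)) (mdifferentiableAt_of_infty hX p)
      (mdifferentiableAt_of_infty hN p) v
  have hr : r = stokesRatio β X β Y w := by
    funext p
    obtain ⟨K₀, K₁, hK₀, hK₁, hK⟩ := (hc.adapted p).exists_antisymm_capFieldDeriv e
      (hc.firstForm_eq p) (hc.secondForm_eq p) (hgpos p) θ c
    have h := (hc.adapted p).divergence_eq e (hc.firstForm_eq p) (hc.secondForm_eq p) (hgpos p)
      (hc.secondForm_symm p) hK₀ hK₁ s (w p) (fun i => diffAt (n := n) w p (stdVec n i))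
      fun i j => by rw [hdw]; exact hK i j
    rw [lorentz_comm, hwd, lorentz_capField_hypPoint (hc.last_ne p), lorentz_comm,
      lorentz_capField_normal, lorentz_killing_hypLift (hc.last_ne p)] at h
    refine h.symm.trans ?_
    rw [stokesRatio, stokesSum]
    congr 1
    refine Finset.sum_congr rfl fun i _ => ?_
    rw [hdβ, hYd, hc.diffAt_parallel]
    simp only [add_apply, FunLike.coe_smul, Pi.smul_apply, ContinuousAlternatingMap.add_apply]
    rw [add_comm (insertTwo (basisDet e) (diffAt X p (stdVec n i)) _ _)]
  have hJ := (hsq p₀).1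
  have hκ : 0 < Real.sqrt (-J)⁻¹ := Real.sqrt_pos.2 (inv_pos.2 (neg_pos.2 hJ))
  rw [hr]
  refine integral_stokesRatio (contMDiff_one_of_infty hc.smooth) hc.mem_half hβ.continuous
    (contMDiff_one_of_infty hX) hκ (fun p => ?_) (fun p => (hsq p).2.1)
    (contMDiff_one_of_infty hβ) (hY.of_le (WithTop.coe_le_coe.2 le_top))
    (contMDiff_one_of_infty hw) fun q y hy hy0 => ?_
  · rw [← Real.sqrt_sq_eq_abs, (hsq p).2.2, Real.sqrt_mul (inv_nonneg.2 (neg_pos.2 hJ).le)]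
  · exact hc.insertTwo_capField_eq_zero c s (basisDet e) hy hy0

/-- The Minkowski formulas for capillary hypersurfaces. -/
theorem IsCapillary.integral_minkowskiIntegrand (hc : IsCapillary θ x ν) (c : ℝ) {k : ℕ}
    (hk : 1 ≤ k) (hkn : k ≤ n) : Integrable (minkowskiIntegrand θ c x ν k) (area x) ∧
      ∫ p, minkowskiIntegrand θ c x ν k p ∂(area x) = 0 := by
  obtain ⟨k, rfl⟩ : ∃ j, k = j + 1 := ⟨k - 1, by omega⟩
  -- After the shift to `k + 1` the coefficient of `s^k` pairs `S_k` with `S_{k+1}`. It is a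
  -- combination, with weights independent of the point, of the values at `s = 0, …, n`, each of
  -- which integrates to zero.
  obtain ⟨a, ha⟩ := exists_coeff_eq_sum_eval n k
  let A := fun p => secondForm x ν p * (firstForm x p)⁻¹
  let r : ℝ → M → ℝ := fun s p =>
    c * (1 / x p (Fin.last n) - Real.cos θ * hypInner (x p) (E₁ n) (ν p)) *
        (1 + s • A p).adjugate.trace -
      hypInner (x p) (x p - c • Eₗ n) (ν p) * (A p * (1 + s • A p).adjugate).trace
  have hr : ∀ s, Integrable (r s) (area x) ∧ ∫ p, r s p ∂(area x) = 0 :=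
    fun s => hc.integral_parallel c s
  -- This binomial identity lets the factors `n - k` and `k + 1` be absorbed into the normalizations
  -- of `H_k` and `H_{k+1}`.
  have hch : (n.choose (k + 1) : ℝ) * (k + 1) = n.choose k * (n - k) := by
    have := Nat.choose_succ_right_eq n k
    rw [← Nat.cast_sub (by omega : k ≤ n)]
    exact_mod_cast this
  have h1 : (n.choose (k + 1) : ℝ) ≠ 0 := by
    exact_mod_cast (Nat.choose_pos hkn).ne'
  have h2 : (n.choose k : ℝ) ≠ 0 := by
    exact_mod_cast (Nat.choose_pos (by omega : k ≤ n)).ne'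
  have h3 : (k + 1 : ℝ) ≠ 0 := by positivity
  have heq : minkowskiIntegrand θ c x ν (k + 1) = fun p =>
      ((k + 1) * (n.choose (k + 1) : ℝ))⁻¹ * ∑ m : Fin (n + 1), a m * r (m : ℝ) p := by
    funext p
    obtain ⟨q, hq, hqe, hqc⟩ := exists_polynomial_trace_adjugate (hc.firstForm_posDef p)
      (hc.secondForm_symm p)
      (c * (1 / x p (Fin.last n) - Real.cos θ * hypInner (x p) (E₁ n) (ν p)))
      (hypInner (x p) (x p - c • Eₗ n) (ν p))
    have h := ha q hq
    simp only [hqe, hqc] at h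
    change _ = _ * ∑ m : Fin (n + 1), a m * (_ - _)
    rw [← h]
    simp only [minkowskiIntegrand, normCurvature, symCurvature, principalCurvatures,
      Nat.add_sub_cancel]
    have h4 : (n - k : ℝ) = n.choose (k + 1) * (k + 1) / n.choose k := by
      rw [hch]; field_simp
    rw [h4]
    field_simp
  rw [heq]
  have hi : Integrable (fun p => ∑ m : Fin (n + 1), a m * r (m : ℝ) p) (area x) :=
    integrable_finsetSum _ fun m _ => (hr _).1.const_mul _
  refine ⟨hi.const_mul _, ?_⟩
  rw [integral_const_mul, integral_finsetSum _ fun m _ => (hr _).1.const_mul _]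
  simp only [integral_const_mul, (hr _).2, mul_zero, Finset.sum_const_zero]

end Minkowski

/-! ### Volume forms and the normal of the hypersurface. -/

section Volume

/-- Cramer's rule, multiplied out so that no invertibility is required. -/
theorem sum_basisDet_update_smul {m : ℕ} {V : Type*} [NormedAddCommGroup V] [NormedSpace ℝ V]
    [FiniteDimensional ℝ V] (e : Module.Basis (Fin m) ℝ V) (v : Fin m → V) (w : V) :
    ∑ i, basisDet e (update v i w) • v i = basisDet e v • w := by
  refine e.repr.injective (Finsupp.ext fun k => ?_)
  have h := congrFun (Matrix.mulVec_cramer (e.toMatrix v) (e.repr w)) k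
  simp only [map_sum, map_smul, Finsupp.coe_finsetSum, Finset.sum_apply, Finsupp.smul_apply,
    smul_eq_mul, basisDet_apply, Module.Basis.toMatrix_update]
  simp only [Matrix.mulVec, dotProduct, Matrix.cramer_apply, Pi.smul_apply, smul_eq_mul] at h
  rw [← h]
  exact Finset.sum_congr rfl fun i _ => mul_comm _ _

theorem sum_functional_mul_basisDet_update {m : ℕ} {V : Type*} [NormedAddCommGroup V]
    [NormedSpace ℝ V] [FiniteDimensional ℝ V] (e : Module.Basis (Fin m) ℝ V) (l : V →L[ℝ] ℝ)
    (v : Fin m → V) (w : V) :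
    ∑ i, l (v i) * basisDet e (update v i w) = l w * basisDet e v := by
  have h := congrArg l (sum_basisDet_update_smul e v w)
  simp only [map_sum, map_smul, smul_eq_mul] at h
  rw [mul_comm, ← h]
  exact Finset.sum_congr rfl fun i _ => mul_comm _ _

/-- The Euclidean volume form. -/
def volForm (n : ℕ) : E n [⋀^Fin (n + 1)]→L[ℝ] ℝ :=
  basisDet (EuclideanSpace.basisFun (Fin (n + 1)) ℝ).toBasis

theorem volForm_mul_volForm {n : ℕ} (u v : Fin (n + 1) → E n) :
    volForm n u * volForm n v = (Matrix.of fun i j => (inner ℝ (u i) (v j) : ℝ)).det := by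
  have h := det_gram_eq (EuclideanSpace.basisFun (Fin (n + 1)) ℝ).toBasis (innerSL ℝ) u v
  have h1 : (Matrix.of fun i j => innerSL ℝ ((EuclideanSpace.basisFun (Fin (n + 1)) ℝ).toBasis i)
      ((EuclideanSpace.basisFun (Fin (n + 1)) ℝ).toBasis j)) = 1 := by
    ext i j
    simp [Matrix.one_apply, EuclideanSpace.inner_single_left]
  rw [h1, Matrix.det_one, one_mul] at h
  exact h.symm

/-- The identity `l ∧ vol = 0` contracted with `a` and `w`. It is the pointwise content of Cartan's
formula for the form `f · vol(a, ·)` with `df = l`. -/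
theorem volForm_curryLeft_add_sum {n : ℕ} (l : E n →L[ℝ] ℝ) (a w : E n) (Z : Fin n → E n) :
    l a * (volForm n).curryLeft w Z +
      ∑ i, l (Z i) * (volForm n).curryLeft a (update Z i w) =
      l w * (volForm n).curryLeft a Z := by
  have h := sum_functional_mul_basisDet_update (EuclideanSpace.basisFun (Fin (n + 1)) ℝ).toBasis l
    (Matrix.vecCons a Z) w
  rw [Fin.sum_univ_succ] at h
  have h0 : update (Matrix.vecCons a Z) 0 w = Matrix.vecCons w Z :=
    Fin.update_cons_zero (α := fun _ => E n) a Z w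
  have hs : ∀ i : Fin n, update (Matrix.vecCons a Z) i.succ w = Matrix.vecCons a (update Z i w) :=
    fun i => (Fin.cons_update (α := fun _ => E n) a Z i w).symm
  simp only [h0, hs, Matrix.cons_val_zero, Matrix.cons_val_succ] at h
  exact h

variable {n : ℕ} [NeZero n] {M : Type*} [TopologicalSpace M] [CompactSpace M] [T2Space M]
  [ChartedSpace (EuclideanHalfSpace n) M] [IsManifold (𝓡∂ n) ∞ M]
  {x ν : M → E n} {θ : ℝ}

theorem IsCapillary.inner_normal (hc : IsCapillary θ x ν) (p : M) (v : EuclideanSpace ℝ (Fin n)) :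
    inner ℝ (ν p) (diffAt x p v) = (0 : ℝ) := by
  have h : ∀ i, inner ℝ (ν p) (diffAt x p (stdVec n i)) = (0 : ℝ) := by
    intro i
    have h := hc.normal_orth p i
    rw [hypInner, div_eq_zero_iff, or_iff_left (pow_ne_zero 2 (hc.last_ne p))] at h
    exact h
  rw [eq_sum_stdVec v, map_sum, inner_sum]
  simp only [map_smul, real_inner_smul_right, h, mul_zero, Finset.sum_const_zero]

theorem IsCapillary.inner_normal_self (hc : IsCapillary θ x ν) (p : M) :
    inner ℝ (ν p) (ν p) = x p (Fin.last n) ^ 2 := by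
  have h := hc.normal_unit p
  rwa [hypInner, div_eq_one_iff_eq (pow_ne_zero 2 (hc.last_ne p))] at h

/-- After subtracting its normal component, `v` is tangent, and pairing with `ν` kills all entries
of the determinant. -/
theorem IsCapillary.curryLeft_eq (hc : IsCapillary θ x ν) (p : M) (v : E n)
    (A : Fin n → EuclideanSpace ℝ (Fin n)) :
    (volForm n).curryLeft v (fun j => diffAt x p (A j)) =
      hypInner (x p) v (ν p) * (volForm n).curryLeft (ν p) (fun j => diffAt x p (A j)) := by
  have h0 : (volForm n).curryLeft (v - hypInner (x p) v (ν p) • ν p)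
      (fun j => diffAt x p (A j)) = 0 := by
    rw [ContinuousAlternatingMap.curryLeft_apply_apply]
    refine alternating_eq_zero_of_functional _ (by simp) (l := innerSL ℝ (ν p)) (fun h => ?_)
      fun j => ?_
    · have h1 := hc.inner_normal_self p
      have h2 : inner ℝ (ν p) (ν p) = (0 : ℝ) := congrArg (fun l => l (ν p)) h
      rw [h2] at h1
      exact pow_ne_zero 2 (hc.last_ne p) h1.symm
    · refine Fin.cases ?_ (fun k => ?_) j
      · have := hc.last_ne p
        simp only [Matrix.cons_val_zero, innerSL_apply_apply, inner_sub_right,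
          real_inner_smul_right, hc.inner_normal_self, hypInner, real_inner_comm v]
        field_simp
        ring
      · exact hc.inner_normal p _
  rw [map_sub, map_smul, ContinuousAlternatingMap.sub_apply, ContinuousAlternatingMap.smul_apply,
    smul_eq_mul] at h0
  linarith

/-- The square is the Gram determinant of `(ν, dx)`, which splits because `ν` is normal; the powers
of `x_{n+1}` convert Euclidean into hyperbolic inner products. -/
theorem IsCapillary.volForm_normal_sq (hc : IsCapillary θ x ν) (p : M) :
    (volForm n).curryLeft (ν p) (fun j => diffAt x p (stdVec n j)) ^ 2 =
      (x p (Fin.last n) ^ (n + 1)) ^ 2 * (firstForm x p).det := by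
  rw [pow_two, ContinuousAlternatingMap.curryLeft_apply_apply, volForm_mul_volForm,
    det_eq_mul_det_of_row_zero]
  · have h1 : ((Matrix.of fun i j => (inner ℝ (Matrix.vecCons (ν p)
        (fun j => diffAt x p (stdVec n j)) i) (Matrix.vecCons (ν p)
        (fun j => diffAt x p (stdVec n j)) j) : ℝ)).submatrix Fin.succ Fin.succ) =
        (x p (Fin.last n) ^ 2) • firstForm x p := by
      ext i j
      have := hc.last_ne p
      simp only [Matrix.submatrix_apply, Matrix.of_apply, Matrix.cons_val_succ, Matrix.smul_apply,
        firstForm, hypInner, smul_eq_mul, frame_eq_diffAt]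
      field_simp
    rw [h1, Matrix.det_smul, Fintype.card_fin, Matrix.of_apply, Matrix.cons_val_zero,
      hc.inner_normal_self]
    ring
  · exact fun j => hc.inner_normal p _

theorem IsCapillary.abs_volForm_normal (hc : IsCapillary θ x ν) (p : M) :
    |(volForm n).curryLeft (ν p) (fun j => diffAt x p (stdVec n j))| =
      x p (Fin.last n) ^ (n + 1) * Real.sqrt (firstForm x p).det := by
  have h0 : 0 ≤ x p (Fin.last n) ^ (n + 1) := pow_nonneg (hc.mem_half p).le _
  rw [← Real.sqrt_sq_eq_abs, hc.volForm_normal_sq, Real.sqrt_mul (sq_nonneg _), Real.sqrt_sq h0]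

theorem IsCapillary.volForm_normal_ne (hc : IsCapillary θ x ν) (p : M) :
    (volForm n).curryLeft (ν p) (fun j => diffAt x p (stdVec n j)) ≠ 0 := by
  intro h
  have h1 := hc.volForm_normal_sq p
  rw [h] at h1
  have h2 := (hc.firstForm_posDef p).det_pos
  have h3 := pow_pos (show 0 < x p (Fin.last n) from hc.mem_half p) (n + 1)
  have : 0 < (x p (Fin.last n) ^ (n + 1)) ^ 2 * (firstForm x p).det := by positivity
  rw [← h1, zero_pow two_ne_zero] at this
  exact lt_irrefl _ this

theorem IsCapillary.abs_volForm_chart (hc : IsCapillary θ x ν) {q : M}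
    {y : EuclideanSpace ℝ (Fin n)} (hy : y ∈ (extChartAt (𝓡∂ n) q).target) :
    |(volForm n).curryLeft (ν ((extChartAt (𝓡∂ n) q).symm y))
      (fun j => chartDeriv q x y (stdVec n j))| =
      x ((extChartAt (𝓡∂ n) q).symm y) (Fin.last n) ^ (n + 1) * areaDensity x q y := by
  have hx := contMDiff_one_of_infty hc.smooth
  have : IsManifold (𝓡∂ n) 1 M := IsManifold.of_le (n := ∞) (by simp)
  rw [chartDeriv_eq_comp hx hy, areaDensity_eq hx hy]
  simp only [ContinuousLinearMap.comp_apply]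
  rw [alternating_comp_eq_det_mul, abs_mul, hc.abs_volForm_normal]
  ring

theorem IsCapillary.volForm_chart_ne (hc : IsCapillary θ x ν) {q : M}
    {y : EuclideanSpace ℝ (Fin n)} (hy : y ∈ (extChartAt (𝓡∂ n) q).target) :
    (volForm n).curryLeft (ν ((extChartAt (𝓡∂ n) q).symm y))
      (fun j => chartDeriv q x y (stdVec n j)) ≠ 0 := by
  have : IsManifold (𝓡∂ n) 1 M := IsManifold.of_le (n := ∞) (by simp)
  rw [chartDeriv_eq_comp (contMDiff_one_of_infty hc.smooth) hy]
  simp only [ContinuousLinearMap.comp_apply]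
  rw [alternating_comp_eq_det_mul]
  exact mul_ne_zero (chartJac_det_ne_zero hy) (hc.volForm_normal_ne _)

theorem IsCapillary.curryLeft_chart (hc : IsCapillary θ x ν) {q : M}
    {y : EuclideanSpace ℝ (Fin n)} (hy : y ∈ (extChartAt (𝓡∂ n) q).target) (v : E n) :
    (volForm n).curryLeft v (fun j => chartDeriv q x y (stdVec n j)) =
      hypInner (x ((extChartAt (𝓡∂ n) q).symm y)) v (ν ((extChartAt (𝓡∂ n) q).symm y)) *
      (volForm n).curryLeft (ν ((extChartAt (𝓡∂ n) q).symm y))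
        (fun j => chartDeriv q x y (stdVec n j)) := by
  rw [chartDeriv_eq_comp (contMDiff_one_of_infty hc.smooth) hy]
  simp only [ContinuousLinearMap.comp_apply]
  exact hc.curryLeft_eq _ v fun j => chartJac q y (stdVec n j)

end Volume

/-! ### The divergence theorem through a flattening map. -/

section Flattening

variable {n : ℕ}

theorem det_eq_volForm (A : E n →L[ℝ] E n) : A.det = volForm n fun j => A (stdVec (n + 1) j) := by
  have h := (EuclideanSpace.basisFun (Fin (n + 1)) ℝ).toBasis.det_comp
    (A : E n →ₗ[ℝ] E n) (EuclideanSpace.basisFun (Fin (n + 1)) ℝ).toBasis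
  rw [Module.Basis.det_self, mul_one] at h
  refine h.symm.trans ?_
  change _ = (EuclideanSpace.basisFun (Fin (n + 1)) ℝ).toBasis.det _
  congr 1
  funext j
  simp

theorem volume_hyperplane_zero : volume {u : E n | u 0 = 0} = 0 := by
  have h := Measure.addHaar_submodule (volume : Measure (E n))
    (LinearMap.ker (EuclideanSpace.proj (0 : Fin (n + 1)) : E n →L[ℝ] ℝ).toLinearMap) (by
      intro h
      have h1 : stdVec (n + 1) 0 ∈ (⊤ : Submodule ℝ (E n)) := trivial
      rw [← h, LinearMap.mem_ker] at h1
      simp at h1)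
  exact h

theorem setIntegral_halfSpace_eq {f : E n → ℝ} :
    ∫ u in {u : E n | 0 ≤ u 0}, f u = ∫ u in {u : E n | 0 < u 0}, f u := by
  refine setIntegral_congr_set ?_
  have h : ∀ᵐ u : E n, u 0 ≠ 0 := by
    rw [ae_iff]
    simpa using volume_hyperplane_zero (n := n)
  filter_upwards [h] with u hu
  refine propext ⟨fun h => lt_of_le_of_ne h hu.symm, fun h => le_of_lt h⟩

/-- The divergence theorem for `ψ E_1` on a domain flattened by `Ψ`. -/
theorem integral_image_flattening {Ψ : E n → E n} {Q K : Set (E n)} (hQ : IsOpen Q)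
    (hΨ : ContDiffOn ℝ 2 Ψ Q) (hinj : InjOn Ψ Q)
    (hdet : ∀ u ∈ Q, (volForm n fun j => fderiv ℝ Ψ u (stdVec (n + 1) j)) ≠ 0)
    {ψ : E n → ℝ} (hψ : ContDiff ℝ 1 ψ) (hK : IsCompact K) (hKQ : K ⊆ Q)
    (hKψ : ∀ u ∈ Q, Ψ u ∈ tsupport ψ → u ∈ K) :
    ∫ z in Ψ '' (Q ∩ {u | 0 < u 0}), fderiv ℝ ψ z (E₁ n) =
      -∫ z : Fin n → ℝ, Q.indicator (fun u =>
        |volForm n fun j => fderiv ℝ Ψ u (stdVec (n + 1) j)| /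
          (volForm n fun j => fderiv ℝ Ψ u (stdVec (n + 1) j)) *
        (ψ (Ψ u) * volForm n (update (fun j => fderiv ℝ Ψ u (stdVec (n + 1) j)) 0 (E₁ n))))
          (WithLp.toLp 2 (Fin.cons 0 z : Fin (n + 1) → ℝ)) := by
  classical
  set F : E n → ℝ := fun u => volForm n fun j => fderiv ℝ Ψ u (stdVec (n + 1) j) with hF
  have hd1 : ∀ u ∈ Q, HasFDerivAt Ψ (fderiv ℝ Ψ u) u := fun u hu =>
    ((hΨ.contDiffAt (hQ.mem_nhds hu)).differentiableAt two_ne_zero).hasFDerivAt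
  have hd2 : ContDiffOn ℝ 1 (fderiv ℝ Ψ) Q :=
    hΨ.fderiv_of_isOpen hQ (by norm_num)
  have cΨ : ContinuousOn Ψ Q := hΨ.continuousOn
  have cA : ContinuousOn (fderiv ℝ Ψ) Q := hd2.continuousOn
  have cframe : ContinuousOn (fun u => fun j => fderiv ℝ Ψ u (stdVec (n + 1) j)) Q :=
    continuousOn_pi.2 fun j => cA.clm_apply continuousOn_const
  have cF : ContinuousOn F Q := (volForm n).cont.comp_continuousOn cframe
  have cw : ContinuousOn (fun u => ψ (Ψ u) • E₁ n) Q :=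
    (hψ.continuous.comp_continuousOn cΨ).smul continuousOn_const
  let sg : E n → ℝ := fun u => |F u| / F u
  have csg : ContinuousOn sg Q := cF.abs.div cF hdet
  -- The cofactors of `DΨ` applied to `ψ E_1`: the pullback of the flux form, whose divergence
  -- contains no second derivatives of `Ψ`.
  let b : Fin (n + 1) → E n → ℝ := fun i u =>
    volForm n (update (fun j => fderiv ℝ Ψ u (stdVec (n + 1) j)) i (ψ (Ψ u) • E₁ n))
  have cb : ∀ i, ContinuousOn (b i) Q := fun i =>
    (volForm n).cont.comp_continuousOn (continuousOn_update cframe i cw)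
  let η : Fin (n + 1) → E n → ℝ := fun i => Q.indicator fun u => sg u * b i u
  let d : E n → ℝ := Q.indicator fun u => |F u| * fderiv ℝ ψ (Ψ u) (E₁ n)
  have hψ0 : ∀ u ∈ Q, u ∉ K → ψ (Ψ u) = 0 := fun u hu huK =>
    image_eq_zero_of_notMem_tsupport fun h => huK (hKψ u hu h)
  have hdψ0 : ∀ u ∈ Q, u ∉ K → fderiv ℝ ψ (Ψ u) = 0 := fun u hu huK => by
    have h := notMem_tsupport_iff_eventuallyEq.1 fun h => huK (hKψ u hu h)
    rw [h.fderiv_eq]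
    simp
  have hηK : ∀ i u, u ∉ K → η i u = 0 := by
    intro i u hu
    by_cases h : u ∈ Q
    · simp only [η, indicator_of_mem h, b, hψ0 u h hu, zero_smul,
        ContinuousAlternatingMap.map_update_zero, mul_zero]
    · exact indicator_of_notMem h _
  have hdK : ∀ u, u ∉ K → d u = 0 := by
    intro u hu
    by_cases h : u ∈ Q
    · simp only [d, indicator_of_mem h, hdψ0 u h hu, zero_apply, mul_zero]
    · exact indicator_of_notMem h _
  have hzero : ∀ i u, u ∉ Q → η i =ᶠ[𝓝 u] fun _ => 0 := fun i u hu =>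
    Filter.mem_of_superset (hK.isClosed.isOpen_compl.mem_nhds fun h => hu (hKQ h))
      fun z hz => hηK i z hz
  have cη : ∀ i, Continuous (η i) := by
    intro i
    refine continuous_iff_continuousAt.2 fun u => ?_
    by_cases hu : u ∈ Q
    · exact ((csg.mul (cb i)).congr fun z hz => indicator_of_mem hz _).continuousAt
        (hQ.mem_nhds hu)
    · exact (hzero i u hu).continuousAt
  have cd : Continuous d := by
    refine continuous_iff_continuousAt.2 fun u => ?_
    by_cases hu : u ∈ Q
    · have h1 : ContinuousOn (fun u => fderiv ℝ ψ (Ψ u)) Q :=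
        (hψ.continuous_fderiv one_ne_zero).comp_continuousOn cΨ
      exact ((cF.abs.mul (h1.clm_apply continuousOn_const)).congr
        fun z hz => indicator_of_mem hz _).continuousAt (hQ.mem_nhds hu)
    · have : d =ᶠ[𝓝 u] fun _ => 0 :=
        Filter.mem_of_superset (hK.isClosed.isOpen_compl.mem_nhds fun h => hu (hKQ h))
          fun z hz => hdK z hz
      exact this.continuousAt
  have hdint : Integrable d :=
    cd.integrable_of_hasCompactSupport (HasCompactSupport.intro hK fun u hu => hdK u hu)
  have hder : ∀ u : E n, ∃ η' : Fin (n + 1) → E n →L[ℝ] ℝ,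
      (∀ i, HasFDerivAt (η i) (η' i) u) ∧ ∑ i, η' i (stdVec (n + 1) i) = d u := by
    intro u
    by_cases hu : u ∈ Q
    · have hnhds := hQ.mem_nhds hu
      have hA : HasFDerivAt (fderiv ℝ Ψ) (fderiv ℝ (fderiv ℝ Ψ) u) u :=
        ((hd2.contDiffAt hnhds).differentiableAt one_ne_zero).hasFDerivAt
      have hsym : ∀ a c, fderiv ℝ (fderiv ℝ Ψ) u a c = fderiv ℝ (fderiv ℝ Ψ) u c a := by
        have := (hΨ.contDiffAt hnhds).isSymmSndFDerivAt (by simp)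
        exact fun a c => this a c
      have hw : HasFDerivAt (fun u => ψ (Ψ u) • E₁ n)
          (((fderiv ℝ ψ (Ψ u)).comp (fderiv ℝ Ψ u)).smulRight (E₁ n)) u :=
        (((hψ.differentiable one_ne_zero (Ψ u)).hasFDerivAt).comp u (hd1 u hu)).smul_const (E₁ n)
      obtain ⟨b', hb', hsum⟩ := exists_hasFDerivAt_cofactor
        (hasFDerivAt_const (volForm n) u) hA hw hsym
      refine ⟨fun i => sg u • b' i, fun i => ?_, ?_⟩
      · refine ((hb' i).const_mul (sg u)).congr_of_eventuallyEq ?_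
        filter_upwards [hnhds, eventually_abs_div_self_eq (cF.continuousAt hnhds) (hdet u hu)]
          with z hz hz2
        simp only [η, indicator_of_mem hz, b]
        rw [show sg z = sg u from hz2]
      · simp only [FunLike.coe_smul, Pi.smul_apply, smul_eq_mul, ← Finset.mul_sum]
        rw [hsum]
        simp only [stokesSum, zero_apply, d, indicator_of_mem hu,
          ContinuousLinearMap.smulRight_apply, ContinuousLinearMap.comp_apply,
          ContinuousAlternatingMap.map_update_smul, smul_eq_mul]
        have hz : ∀ v, (0 : E n [⋀^Fin (n + 1)]→L[ℝ] ℝ) v = 0 := fun v => rfl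
        simp only [hz, mul_zero, zero_add]
        -- Cramer's rule turns the divergence of the cofactor field into the Jacobian times the
        -- derivative of `ψ` in the direction `E_1`.
        have h1 := sum_functional_mul_basisDet_update
          (EuclideanSpace.basisFun (Fin (n + 1)) ℝ).toBasis (fderiv ℝ ψ (Ψ u))
          (fun j => fderiv ℝ Ψ u (stdVec (n + 1) j)) (E₁ n)
        have h2 : ∑ i, fderiv ℝ ψ (Ψ u) (fderiv ℝ Ψ u (stdVec (n + 1) i)) *
            volForm n (update (fun j => fderiv ℝ Ψ u (stdVec (n + 1) j)) i (E₁ n)) =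
            fderiv ℝ ψ (Ψ u) (E₁ n) * F u := h1
        rw [h2]
        have := hdet u hu
        simp only [sg]
        change |F u| / F u * _ = _
        have hFu : F u ≠ 0 := this
        field_simp
    · refine ⟨fun i => 0, fun i => (hasFDerivAt_const (0 : ℝ) u).congr_of_eventuallyEq
        (hzero i u hu), ?_⟩
      simp only [zero_apply, Finset.sum_const_zero, d, indicator_of_notMem hu]
  choose η' hη' using hder
  have hdiv := setIntegral_divergence_halfSpace hK η (fun i u => η' u i) d
    (fun i u _ h => hηK i u h) (fun i => (cη i).continuousOn) (fun u _ i => (hη' u).1 i)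
    (fun u _ => (hη' u).2) hdint.integrableOn hdK
  have hQm : MeasurableSet (Q ∩ {u : E n | 0 < u 0}) :=
    hQ.measurableSet.inter (measurableSet_lt measurable_const (by fun_prop))
  rw [integral_image_eq_integral_abs_det_fderiv_smul volume hQm
    (fun u hu => (hd1 u hu.1).hasFDerivWithinAt) (hinj.mono inter_subset_left)]
  rw [setIntegral_halfSpace_eq] at hdiv
  have h1 : ∫ u in Q ∩ {u : E n | 0 < u 0}, |(fderiv ℝ Ψ u).det| • fderiv ℝ ψ (Ψ u) (E₁ n) =
      ∫ u in {u : E n | 0 < u 0}, d u := by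
    rw [inter_comm, ← setIntegral_indicator hQ.measurableSet]
    simp only [det_eq_volForm, smul_eq_mul]
    rfl
  rw [h1, hdiv]
  congr 1
  refine integral_congr_ae (Eventually.of_forall fun z => ?_)
  simp only [η, indicator]
  split_ifs with h
  · simp only [b, ContinuousAlternatingMap.map_update_smul, smul_eq_mul, sg]
    rfl
  · rfl

end Flattening

/-! ### Collar neighbourhoods of interior points. -/

section Collar

variable {n : ℕ}

/-- Removal of the first coordinate. -/
def tailL (n : ℕ) : E n →L[ℝ] EuclideanSpace ℝ (Fin n) :=
  LinearMap.toContinuousLinearMap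
    { toFun := fun u => WithLp.toLp 2 fun i => u i.succ
      map_add' := fun _ _ => rfl
      map_smul' := fun _ _ => rfl }

/-- Insertion of a zero first coordinate. -/
def consL (n : ℕ) : EuclideanSpace ℝ (Fin n) →L[ℝ] E n :=
  LinearMap.toContinuousLinearMap
    { toFun := fun y => WithLp.toLp 2 (Fin.cons 0 y : Fin (n + 1) → ℝ)
      map_add' := fun a b => by
        ext i
        refine Fin.cases ?_ (fun i => ?_) i <;> simp
      map_smul' := fun r a => by
        ext i
        refine Fin.cases ?_ (fun i => ?_) i <;> simp }

theorem tailL_apply (u : E n) (i : Fin n) : tailL n u i = u i.succ := rfl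

theorem consL_zero (y : EuclideanSpace ℝ (Fin n)) : consL n y 0 = 0 := rfl

theorem tailL_consL (y : EuclideanSpace ℝ (Fin n)) : tailL n (consL n y) = y := rfl

theorem consL_tailL {u : E n} (hu : u 0 = 0) : consL n (tailL n u) = u := by
  ext i
  refine Fin.cases ?_ (fun i => ?_) i
  · rw [consL_zero, hu]
  · rfl

theorem tailL_stdVec_zero : tailL n (stdVec (n + 1) 0) = 0 := by
  ext i
  rw [tailL_apply]
  simp

theorem tailL_stdVec_succ (j : Fin n) : tailL n (stdVec (n + 1) j.succ) = stdVec n j := by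
  ext i
  rw [tailL_apply]
  simp

variable [NeZero n] {M : Type*} [TopologicalSpace M] [CompactSpace M] [T2Space M]
  [ChartedSpace (EuclideanHalfSpace n) M] [IsManifold (𝓡∂ n) ∞ M]
  {x ν : M → E n} {θ : ℝ}

/-- The map flattening a hypersurface: `(s, y) ↦ x(y) - s ν(y)` in the chart around `q`. -/
def collar (x ν : M → E n) (q : M) (u : E n) : E n :=
  x ((extChartAt (𝓡∂ n) q).symm (tailL n u)) - u 0 • ν ((extChartAt (𝓡∂ n) q).symm (tailL n u))

/-- The open set of parameters over interior points of a chart. -/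
def collarDomain (n : ℕ) [NeZero n] {M : Type*} [TopologicalSpace M]
    [ChartedSpace (EuclideanHalfSpace n) M] (q : M) : Set (E n) :=
  {u | tailL n u ∈ (extChartAt (𝓡∂ n) q).target ∧ 0 < tailL n u 0}

theorem isOpen_collarDomain (q : M) : IsOpen (collarDomain n q) := by
  have h : IsOpen {y : EuclideanSpace ℝ (Fin n) | y ∈ (extChartAt (𝓡∂ n) q).target ∧ 0 < y 0} := by
    refine isOpen_iff_mem_nhds.2 fun y hy => ?_
    have h0 : {y : EuclideanSpace ℝ (Fin n) | 0 < y 0} ∈ 𝓝 y :=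
      (isOpen_lt continuous_const (by fun_prop)).mem_nhds hy.2
    filter_upwards [target_mem_nhds hy.1 hy.2, h0] with z h1 h2 using ⟨h1, h2⟩
  exact h.preimage (tailL n).continuous

theorem contDiffOn_collar {k : WithTop ℕ∞} [IsManifold (𝓡∂ n) k M]
    (hx : ContMDiff (𝓡∂ n) 𝓘(ℝ, E n) k x) (hν : ContMDiff (𝓡∂ n) 𝓘(ℝ, E n) k ν) (q : M) :
    ContDiffOn ℝ k (collar x ν q) (collarDomain n q) := by
  have hm : MapsTo (tailL n) (collarDomain n q) (extChartAt (𝓡∂ n) q).target := fun u hu => hu.1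
  have h1 := (contDiffOn_chart hx q).comp (tailL n).contDiff.contDiffOn hm
  have h2 := (contDiffOn_chart hν q).comp (tailL n).contDiff.contDiffOn hm
  have h3 : ContDiff ℝ k fun u : E n => u 0 := by fun_prop
  exact h1.sub (h3.contDiffOn.smul h2)

theorem fderiv_collar (hx : ContMDiff (𝓡∂ n) 𝓘(ℝ, E n) 1 x)
    (hν : ContMDiff (𝓡∂ n) 𝓘(ℝ, E n) 1 ν) {q : M} {u : E n} (hu : u ∈ collarDomain n q) (v : E n) :
    fderiv ℝ (collar x ν q) u v = chartDeriv q x (tailL n u) (tailL n v) -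
      (u 0 • chartDeriv q ν (tailL n u) (tailL n v) +
        v 0 • ν ((extChartAt (𝓡∂ n) q).symm (tailL n u))) := by
  have : IsManifold (𝓡∂ n) 1 M := IsManifold.of_le (n := ∞) (by simp)
  have h1 := (hasFDerivAt_chart hx hu.1 hu.2).comp u (tailL n).hasFDerivAt
  have h2 := (hasFDerivAt_chart hν hu.1 hu.2).comp u (tailL n).hasFDerivAt
  have h3 : HasFDerivAt (fun u : E n => u 0) (EuclideanSpace.proj 0 : E n →L[ℝ] ℝ) u :=
    (EuclideanSpace.proj 0 : E n →L[ℝ] ℝ).hasFDerivAt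
  have h : HasFDerivAt (collar x ν q) _ u := h1.sub (h3.smul h2)
  rw [h.fderiv]
  rfl

theorem collar_consL (q : M) (y : EuclideanSpace ℝ (Fin n)) :
    collar x ν q (consL n y) = x ((extChartAt (𝓡∂ n) q).symm y) := by
  rw [collar, tailL_consL, consL_zero, zero_smul, sub_zero]

theorem fderiv_collar_consL_succ (hx : ContMDiff (𝓡∂ n) 𝓘(ℝ, E n) 1 x)
    (hν : ContMDiff (𝓡∂ n) 𝓘(ℝ, E n) 1 ν) {q : M} {y : EuclideanSpace ℝ (Fin n)}
    (hu : consL n y ∈ collarDomain n q) (j : Fin n) :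
    fderiv ℝ (collar x ν q) (consL n y) (stdVec (n + 1) j.succ) =
      chartDeriv q x y (stdVec n j) := by
  rw [fderiv_collar hx hν hu, tailL_consL, consL_zero, tailL_stdVec_succ]
  simp

theorem fderiv_collar_consL_zero (hx : ContMDiff (𝓡∂ n) 𝓘(ℝ, E n) 1 x)
    (hν : ContMDiff (𝓡∂ n) 𝓘(ℝ, E n) 1 ν) {q : M} {y : EuclideanSpace ℝ (Fin n)}
    (hu : consL n y ∈ collarDomain n q) :
    fderiv ℝ (collar x ν q) (consL n y) (stdVec (n + 1) 0) =
      -ν ((extChartAt (𝓡∂ n) q).symm y) := by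
  rw [fderiv_collar hx hν hu, tailL_consL, consL_zero, tailL_stdVec_zero]
  simp

theorem volForm_collar_update (hx : ContMDiff (𝓡∂ n) 𝓘(ℝ, E n) 1 x)
    (hν : ContMDiff (𝓡∂ n) 𝓘(ℝ, E n) 1 ν) {q : M} {y : EuclideanSpace ℝ (Fin n)}
    (hu : consL n y ∈ collarDomain n q) (v : E n) :
    volForm n (update (fun j => fderiv ℝ (collar x ν q) (consL n y) (stdVec (n + 1) j)) 0 v) =
      (volForm n).curryLeft v (fun j => chartDeriv q x y (stdVec n j)) := by
  rw [ContinuousAlternatingMap.curryLeft_apply_apply]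
  congr 1
  funext j
  refine Fin.cases ?_ (fun j => ?_) j
  · simp
  · rw [update_of_ne (Fin.succ_ne_zero j), fderiv_collar_consL_succ hx hν hu]
    rfl

theorem volForm_collar (hx : ContMDiff (𝓡∂ n) 𝓘(ℝ, E n) 1 x)
    (hν : ContMDiff (𝓡∂ n) 𝓘(ℝ, E n) 1 ν) {q : M} {y : EuclideanSpace ℝ (Fin n)}
    (hu : consL n y ∈ collarDomain n q) :
    (volForm n fun j => fderiv ℝ (collar x ν q) (consL n y) (stdVec (n + 1) j)) =
      -(volForm n).curryLeft (ν ((extChartAt (𝓡∂ n) q).symm y))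
        (fun j => chartDeriv q x y (stdVec n j)) := by
  have h := volForm_collar_update hx hν hu (-ν ((extChartAt (𝓡∂ n) q).symm y))
  rw [← fderiv_collar_consL_zero hx hν hu, update_eq_self] at h
  rw [h, fderiv_collar_consL_zero hx hν hu, map_neg]
  rfl

/-- A collar neighbourhood: near an interior point, the enclosed domain is the image of a half-ball
under the flattening map. -/
theorem IsEnclosedDomain.exists_collar (hc : IsCapillary θ x ν) (hinj : Injective x)
    {Ω : Set (E n)} (hΩ : IsEnclosedDomain x ν Ω) {p : M} (hp : p ∈ (𝓡∂ n).interior M) :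
    ∃ (Q : Set (E n)) (g : E n → E n), IsOpen Q ∧ Q ⊆ collarDomain n p ∧ InjOn (collar x ν p) Q ∧
      (∀ u ∈ Q, (volForm n fun j => fderiv ℝ (collar x ν p) u (stdVec (n + 1) j)) ≠ 0) ∧
      IsOpen (collar x ν p '' Q) ∧ x p ∈ collar x ν p '' Q ∧
      collar x ν p '' Q ⊆ {z | 0 < z 0} ∧
      Ω ∩ collar x ν p '' Q = collar x ν p '' (Q ∩ {u | 0 < u 0}) ∧
      (∀ p', x p' ∈ collar x ν p '' Q → p' ∈ (extChartAt (𝓡∂ n) p).source ∧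
        consL n (extChartAt (𝓡∂ n) p p') ∈ Q) ∧
      ContinuousOn g (collar x ν p '' Q) ∧ ∀ u ∈ Q, g (collar x ν p u) = u := by
  have hM1 : IsManifold (𝓡∂ n) 1 M := IsManifold.of_le (n := ∞) (by simp)
  have hM2 : IsManifold (𝓡∂ n) 2 M := IsManifold.of_le (n := ∞) (WithTop.coe_le_coe.2 le_top)
  have hx1 := contMDiff_one_of_infty hc.smooth
  have hν1 := contMDiff_one_of_infty hc.normal_smooth
  have hΨ : ContDiffOn ℝ 2 (collar x ν p) (collarDomain n p) :=
    contDiffOn_collar (hc.smooth.of_le (WithTop.coe_le_coe.2 le_top))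
      (hc.normal_smooth.of_le (WithTop.coe_le_coe.2 le_top)) p
  set Ψ := collar x ν p with hΨd
  set φ := extChartAt (𝓡∂ n) p with hφ
  have hy0 : φ p ∈ φ.target := mem_extChartAt_target (I := 𝓡∂ n) p
  have hy0pos : 0 < φ p 0 := by
    have h := ModelWithCorners.isInteriorPoint_iff.1 hp
    have h2 := interior_mono (extChartAt_target_subset_range p) h
    rwa [interior_range_modelWithCornersEuclideanHalfSpace] at h2
  set u₀ : E n := consL n (φ p) with hu₀
  have hu₀D : u₀ ∈ collarDomain n p := ⟨hy0, hy0pos⟩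
  have hDopen := isOpen_collarDomain (n := n) p
  have hΨu₀ : Ψ u₀ = x p := by
    rw [hΨd, hu₀, collar_consL, φ.left_inv (mem_extChartAt_source p)]
  let F : E n → ℝ := fun u => volForm n fun j => fderiv ℝ Ψ u (stdVec (n + 1) j)
  have hF₀ : F u₀ ≠ 0 := by
    have h := volForm_collar hx1 hν1 hu₀D
    change F u₀ = _ at h
    rw [h]
    exact neg_ne_zero.2 (hc.volForm_chart_ne hy0)
  have hA0 : (fderiv ℝ Ψ u₀).det ≠ 0 := by
    rw [det_eq_volForm]; exact hF₀
  have hcd : ContDiffAt ℝ 2 Ψ u₀ := hΨ.contDiffAt (hDopen.mem_nhds hu₀D)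
  let A := (fderiv ℝ Ψ u₀).toContinuousLinearEquivOfDetNeZero hA0
  have hA : HasFDerivAt Ψ (A : E n →L[ℝ] E n) u₀ :=
    (hcd.differentiableAt two_ne_zero).hasFDerivAt
  let h := hcd.toOpenPartialHomeomorph Ψ hA two_ne_zero
  have hh : ∀ u, h u = Ψ u := fun u => rfl
  have hu₀h : u₀ ∈ h.source := hcd.mem_toOpenPartialHomeomorph_source hA two_ne_zero
  have cF : ContinuousOn F (collarDomain n p) :=
    (volForm n).cont.comp_continuousOn (continuousOn_pi.2 fun j =>
      (hΨ.fderiv_of_isOpen (m := 1) hDopen (by norm_num)).continuousOn.clm_apply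
        continuousOn_const)
  have hxp : 0 < x p 0 := hc.interior_pos p hp
  have hopos : IsOpen {z : E n | 0 < z 0} := isOpen_lt continuous_const (by fun_prop)
  have cΨ : ContinuousAt Ψ u₀ := hcd.continuousAt
  obtain ⟨r₀, hr₀, hQ₀⟩ : ∃ r₀ > 0, Metric.ball u₀ r₀ ⊆
      {u | u ∈ collarDomain n p ∧ u ∈ h.source ∧ F u ≠ 0 ∧ 0 < Ψ u 0} := by
    refine Metric.mem_nhds_iff.1 ?_
    have h1 := hDopen.mem_nhds hu₀D
    have h2 := h.open_source.mem_nhds hu₀h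
    have h3 := (cF.continuousAt h1).eventually_ne hF₀
    have h4 : ∀ᶠ u in 𝓝 u₀, 0 < Ψ u 0 :=
      cΨ.eventually (hopos.mem_nhds (by rw [hΨu₀]; exact hxp))
    filter_upwards [h1, h2, h3, h4] with u a b c d using ⟨a, b, c, d⟩
  -- The points of `M` away from `p`. The image of this compact set misses `x p` since `x` is
  -- injective, so after shrinking the ball no other sheet of the hypersurface enters the collar.
  let C : Set M := {p' | p' ∈ φ.source ∧ consL n (φ p') ∈ Metric.ball u₀ r₀}ᶜ
  have hCclosed : IsClosed C := by
    have h1 : ContinuousOn (fun p' => consL n (φ p')) φ.source :=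
      (consL n).continuous.comp_continuousOn (continuousOn_extChartAt p)
    exact (h1.isOpen_inter_preimage (isOpen_extChartAt_source p)
      Metric.isOpen_ball).isClosed_compl
  have hpC : p ∉ C := fun hcon => hcon ⟨mem_extChartAt_source p, Metric.mem_ball_self hr₀⟩
  have hxC : IsClosed (x '' C) := (hCclosed.isCompact.image hx1.continuous).isClosed
  have hxpC : x p ∉ x '' C := by
    rintro ⟨p', hp', heq⟩
    exact hpC (hinj heq ▸ hp')
  obtain ⟨r, hr, hQr⟩ : ∃ r > 0, Metric.ball u₀ r ⊆ {u | u ∈ Metric.ball u₀ r₀ ∧ Ψ u ∉ x '' C} := by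
    refine Metric.mem_nhds_iff.1 ?_
    have h1 : ∀ᶠ u in 𝓝 u₀, Ψ u ∈ (x '' C)ᶜ :=
      cΨ.eventually (hxC.isOpen_compl.mem_nhds (by rw [hΨu₀]; exact hxpC))
    filter_upwards [h1, Metric.ball_mem_nhds u₀ hr₀] with u a b using ⟨b, a⟩
  set Q := Metric.ball u₀ r with hQd
  have hQ : ∀ u ∈ Q, u ∈ collarDomain n p ∧ u ∈ h.source ∧ F u ≠ 0 ∧ 0 < Ψ u 0 :=
    fun u hu => hQ₀ (hQr hu).1
  have hinjh : InjOn Ψ h.source := h.injOn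
  have hsrc : ∀ p', x p' ∈ Ψ '' Q → p' ∈ φ.source ∧ consL n (φ p') ∈ Q := by
    rintro p' ⟨u, hu, hup⟩
    have h1 : p' ∈ φ.source ∧ consL n (φ p') ∈ Metric.ball u₀ r₀ := by
      by_contra hcon
      exact (hQr hu).2 ⟨p', hcon, hup.symm⟩
    have h2 : Ψ (consL n (φ p')) = Ψ u := by
      rw [hup, hΨd, collar_consL, φ.left_inv h1.1]
    rw [hinjh (hQ₀ h1.2).2.1 (hQ u hu).2.1 h2]
    exact ⟨h1.1, hu⟩
  -- Inside `P_+` the frontier is the hypersurface, and the only part of it in the collar is the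
  -- slice `u 0 = 0`.
  have hne : ∀ u ∈ Q, u 0 ≠ 0 → Ψ u ∉ frontier Ω := by
    intro u hu hu0 hfr
    have h1 : Ψ u ∈ range x ∩ {y | 0 < y 0} := by
      rw [← hΩ.frontier_eq]; exact ⟨hfr, (hQ u hu).2.2.2⟩
    obtain ⟨p', hp'⟩ := h1.1
    have h2 := hsrc p' ⟨u, hu, hp'.symm⟩
    have h3 : Ψ (consL n (φ p')) = Ψ u := by
      rw [← hp', hΨd, collar_consL, φ.left_inv h2.1]
    have h4 := hinjh (hQ _ h2.2).2.1 (hQ u hu).2.1 h3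
    exact hu0 (by rw [← h4, consL_zero])
  -- A half-ball has connected image disjoint from the frontier, so it lies in `Ω` as soon as it
  -- meets `Ω`.
  have hconn : ∀ S : Set (E n), Convex ℝ S → (∀ u ∈ S, u 0 ≠ 0) →
      (Ψ '' (Q ∩ S) ∩ Ω).Nonempty → Ψ '' (Q ∩ S) ⊆ Ω := by
    intro S hS hS0 hne' z hz
    by_contra hzΩ
    have hpre : IsPreconnected (Ψ '' (Q ∩ S)) :=
      ((convex_ball u₀ r).inter hS).isPreconnected.image _
        ((hΨ.continuousOn).mono fun u hu => (hQ u hu.1).1)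
    have hnf : ∀ w ∈ Ψ '' (Q ∩ S), w ∉ Ω → w ∉ closure Ω := by
      rintro _ ⟨u, hu, rfl⟩ h1 h2
      refine hne u hu.1 (hS0 u hu.2) ?_
      rw [frontier, hΩ.isOpen.interior_eq]
      exact ⟨h2, h1⟩
    obtain ⟨w, -, hw1, hw2⟩ := hpre Ω (closure Ω)ᶜ hΩ.isOpen isClosed_closure.isOpen_compl
      (fun w hw => or_iff_not_imp_left.2 fun h1 => hnf w hw h1) hne' ⟨z, hz, hnf z hz hzΩ⟩
    exact hw2 (subset_closure hw1)
  have hline : ∀ s : ℝ, Ψ (u₀ + s • stdVec (n + 1) 0) = x p - s • ν p := by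
    intro s
    have h1 : tailL n (u₀ + s • stdVec (n + 1) 0) = φ p := by
      rw [map_add, map_smul, tailL_stdVec_zero, smul_zero, add_zero, hu₀, tailL_consL]
    have h2 : (u₀ + s • stdVec (n + 1) 0) 0 = s := by
      simp [hu₀, consL_zero]
    rw [hΨd, collar, h1, h2, φ.left_inv (mem_extChartAt_source p)]
  have hs : ∀ᶠ s : ℝ in 𝓝[>] 0, u₀ + s • stdVec (n + 1) 0 ∈ Q ∧
      u₀ + (-s) • stdVec (n + 1) 0 ∈ Q := by
    refine nhdsWithin_le_nhds ?_
    have c1 : Continuous fun s : ℝ => u₀ + s • stdVec (n + 1) 0 := by fun_prop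
    have c2 : Continuous fun s : ℝ => u₀ + (-s) • stdVec (n + 1) 0 := by fun_prop
    have hb : Q ∈ 𝓝 u₀ := Metric.ball_mem_nhds u₀ hr
    refine (c1.continuousAt.eventually ?_).and (c2.continuousAt.eventually ?_)
    · simpa using hb
    · simpa using hb
  -- A single small `s`, with one point on each side of the hypersurface, decides which half-ball is
  -- inside: the map subtracts `s ν`, so positive parameters point inwards.
  obtain ⟨s, ⟨⟨hs1, hs2⟩, hs3, hs4⟩, hs0⟩ := ((hs.and (hΩ.outer p hp)).and
    self_mem_nhdsWithin).exists
  have hs0' : (0 : ℝ) < s := hs0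
  have hcoord : ∀ s : ℝ, (u₀ + s • stdVec (n + 1) 0) 0 = s := by
    intro s
    simp [hu₀, consL_zero]
  have hcvx1 : Convex ℝ {u : E n | 0 < u 0} :=
    convex_halfSpace_gt (EuclideanSpace.proj (0 : Fin (n + 1)) : E n →L[ℝ] ℝ).isLinear 0
  have hcvx2 : Convex ℝ {u : E n | u 0 < 0} :=
    convex_halfSpace_lt (EuclideanSpace.proj (0 : Fin (n + 1)) : E n →L[ℝ] ℝ).isLinear 0
  have hin : Ψ '' (Q ∩ {u | 0 < u 0}) ⊆ Ω :=
    hconn _ hcvx1 (fun u hu => ne_of_gt hu) ⟨_, ⟨_, ⟨hs1, by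
      change 0 < (u₀ + s • stdVec (n + 1) 0) 0
      rw [hcoord]; exact hs0'⟩, hline s⟩, hs3⟩
  have hout : ∀ u ∈ Q, u 0 < 0 → Ψ u ∉ Ω := by
    intro u hu hu0 huΩ
    refine hs4 ?_
    have h1 := hconn _ hcvx2 (fun u hu => ne_of_lt hu) ⟨_, ⟨u, ⟨hu, hu0⟩, rfl⟩, huΩ⟩
    refine h1 ⟨_, ⟨hs2, ?_⟩, ?_⟩
    · change (u₀ + (-s) • stdVec (n + 1) 0) 0 < 0
      rw [hcoord]; linarith
    · rw [hline, neg_smul, sub_neg_eq_add]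
  refine ⟨Q, h.symm, Metric.isOpen_ball, fun u hu => (hQ u hu).1,
    hinjh.mono fun u hu => (hQ u hu).2.1, fun u hu => (hQ u hu).2.2.1, ?_,
    ⟨u₀, Metric.mem_ball_self hr, hΨu₀⟩, ?_, ?_, hsrc, ?_, ?_⟩
  · exact h.isOpen_image_of_subset_source Metric.isOpen_ball fun u hu => (hQ u hu).2.1
  · rintro _ ⟨u, hu, rfl⟩
    exact (hQ u hu).2.2.2
  · refine Subset.antisymm ?_ fun z hz => ⟨hin hz, image_mono inter_subset_left hz⟩
    rintro z ⟨hzΩ, u, hu, rfl⟩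
    rcases lt_trichotomy (u 0) 0 with h1 | h1 | h1
    · exact absurd hzΩ (hout u hu h1)
    · exfalso
      have h2 : Ψ u ∈ frontier Ω ∩ {y | 0 < y 0} := by
        rw [hΩ.frontier_eq]
        refine ⟨⟨φ.symm (tailL n u), ?_⟩, (hQ u hu).2.2.2⟩
        rw [hΨd]
        conv_rhs => rw [← consL_tailL h1]
        rw [collar_consL]
      rw [frontier, hΩ.isOpen.interior_eq] at h2
      exact h2.1.2 hzΩ
    · exact ⟨u, ⟨hu, h1⟩, rfl⟩
  · refine h.continuousOn_symm.mono ?_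
    rintro _ ⟨u, hu, rfl⟩
    exact h.map_source (hQ u hu).2.1
  · exact fun u hu => h.left_inv (hQ u hu).2.1

end Collar

/-! ### The divergence theorem on the enclosed domain. -/

section LocalDivergence

variable {n : ℕ} [NeZero n] {M : Type*} [TopologicalSpace M] [CompactSpace M] [T2Space M]
  [ChartedSpace (EuclideanHalfSpace n) M] [IsManifold (𝓡∂ n) ∞ M]
  {x ν : M → E n} {θ : ℝ}

/-- The Euclidean flux density of `E_1` through the hypersurface, with respect to the hyperbolic
area. -/
def fluxDensity (x ν : M → E n) (p : M) : ℝ :=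
  x p (Fin.last n) ^ (n + 1) * hypInner (x p) (E₁ n) (ν p)

theorem IsCapillary.continuous_fluxDensity (hc : IsCapillary θ x ν) :
    Continuous (fluxDensity x ν) := by
  have hx := hc.smooth.continuous
  have hν := hc.normal_smooth.continuous
  have hl : Continuous fun p => x p (Fin.last n) := by
    have : Continuous fun z : E n => z (Fin.last n) := by fun_prop
    exact this.comp hx
  refine (hl.pow _).mul ((continuous_const.inner hν).div (hl.pow 2) fun p => ?_)
  exact pow_ne_zero 2 (ne_of_gt (hc.mem_half p))

theorem IsCapillary.areaDensity_mul_fluxDensity (hc : IsCapillary θ x ν) {q : M}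
    {y : EuclideanSpace ℝ (Fin n)} (hy : y ∈ (extChartAt (𝓡∂ n) q).target) :
    areaDensity x q y * fluxDensity x ν ((extChartAt (𝓡∂ n) q).symm y) =
      |(volForm n).curryLeft (ν ((extChartAt (𝓡∂ n) q).symm y))
        (fun j => chartDeriv q x y (stdVec n j))| /
      (volForm n).curryLeft (ν ((extChartAt (𝓡∂ n) q).symm y))
        (fun j => chartDeriv q x y (stdVec n j)) *
      (volForm n).curryLeft (E₁ n) (fun j => chartDeriv q x y (stdVec n j)) := by
  have hne := hc.volForm_chart_ne hy
  have habs := hc.abs_volForm_chart hy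
  rw [hc.curryLeft_chart hy (E₁ n), fluxDensity]
  generalize (volForm n).curryLeft (ν ((extChartAt (𝓡∂ n) q).symm y))
    (fun j => chartDeriv q x y (stdVec n j)) = D at *
  rw [habs]
  field_simp

/-- In the collar `Ω` is the image of `{u 0 > 0}`, so `integral_image_flattening` applies, and the
integral over the slice `u 0 = 0` is the integral over the hypersurface in the chart at `p`. -/
theorem IsEnclosedDomain.exists_local_divergence [MeasurableSpace M] [BorelSpace M]
    (hc : IsCapillary θ x ν) (hinj : Injective x)
    {Ω : Set (E n)} (hΩ : IsEnclosedDomain x ν Ω) {p : M} (hp : p ∈ (𝓡∂ n).interior M) :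
    ∃ U : Set (E n), IsOpen U ∧ x p ∈ U ∧ ∀ ψ : E n → ℝ, ContDiff ℝ 1 ψ → HasCompactSupport ψ →
      tsupport ψ ⊆ U →
      ∫ z in Ω, fderiv ℝ ψ z (E₁ n) = ∫ p, ψ (x p) * fluxDensity x ν p ∂area x := by
  classical
  have hM1 : IsManifold (𝓡∂ n) 1 M := IsManifold.of_le (n := ∞) (by simp)
  have hM2 : IsManifold (𝓡∂ n) 2 M := IsManifold.of_le (n := ∞) (WithTop.coe_le_coe.2 le_top)
  have hx1 := contMDiff_one_of_infty hc.smooth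
  have hν1 := contMDiff_one_of_infty hc.normal_smooth
  obtain ⟨Q, g, hQ, hQd, hinjQ, hdet, hUo, hpU, -, hΩU, hsrc, hg, hgu⟩ :=
    hΩ.exists_collar hc hinj hp
  refine ⟨collar x ν p '' Q, hUo, hpU, fun ψ hψ hψc hψU => ?_⟩
  have hΨ : ContDiffOn ℝ 2 (collar x ν p) Q :=
    (contDiffOn_collar (hc.smooth.of_le (WithTop.coe_le_coe.2 le_top))
      (hc.normal_smooth.of_le (WithTop.coe_le_coe.2 le_top)) p).mono hQd
  have hflat := integral_image_flattening hQ hΨ hinjQ hdet hψ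
    (hψc.isCompact.image_of_continuousOn (hg.mono hψU)) (by
      rintro _ ⟨z, hz, rfl⟩
      obtain ⟨u, hu, rfl⟩ := hψU hz
      rw [hgu u hu]; exact hu) (fun u hu h => ⟨_, h, hgu u hu⟩)
  have hleft : ∫ z in Ω, fderiv ℝ ψ z (E₁ n) =
      ∫ z in collar x ν p '' (Q ∩ {u | 0 < u 0}), fderiv ℝ ψ z (E₁ n) := by
    rw [← hΩU]
    refine setIntegral_eq_of_subset_of_forall_sdiff_eq_zero hΩ.isOpen.measurableSet
      inter_subset_left fun z hz => ?_
    have hz' : z ∉ tsupport ψ := fun h => hz.2 ⟨hz.1, hψU h⟩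
    rw [(notMem_tsupport_iff_eventuallyEq.1 hz').fderiv_eq]
    simp
  have hzero : ∀ p', x p' ∉ collar x ν p '' Q → ψ (x p') = 0 := fun p' h =>
    image_eq_zero_of_notMem_tsupport fun h' => h (hψU h')
  rw [hleft, hflat, (integrable_area_iff hx1 hc.mem_half (q := p)
    (f := fun p' => ψ (x p') * fluxDensity x ν p') ((hψ.continuous.comp hc.smooth.continuous).mul hc.continuous_fluxDensity).continuousOn
    fun p' hp' => by
      rw [hzero p' fun h => hp' (hsrc p' h).1, zero_mul]).2,
    ← integral_indicator (measurableSet_target p), ← integral_neg]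
  rw [← (PiLp.volume_preserving_toLp (Fin n)).integral_comp
    (MeasurableEquiv.toLp 2 _).measurableEmbedding]
  refine integral_congr_ae (Eventually.of_forall fun z => ?_)
  set y : EuclideanSpace ℝ (Fin n) := WithLp.toLp 2 z with hy
  change -Q.indicator _ (consL n y) = indicator _ _ y
  by_cases hyQ : consL n y ∈ Q
  · have hyt : y ∈ (extChartAt (𝓡∂ n) p).target := (hQd hyQ).1
    have hk := hc.areaDensity_mul_fluxDensity hyt
    -- The collar runs in the direction `-ν`, so its Jacobian is `-vol(ν, dx, …)`; this sign cancels
    -- the one in the half-space divergence theorem.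
    rw [indicator_of_mem hyQ, indicator_of_mem hyt, volForm_collar hx1 hν1 (hQd hyQ),
      volForm_collar_update hx1 hν1 (hQd hyQ), collar_consL, abs_neg, div_neg,
      mul_left_comm (areaDensity x p y), hk]
    ring
  · rw [indicator_of_notMem hyQ, neg_zero]
    by_cases hyt : y ∈ (extChartAt (𝓡∂ n) p).target
    · rw [indicator_of_mem hyt, hzero, zero_mul, mul_zero]
      intro h
      have := (hsrc _ h).2
      rw [(extChartAt (𝓡∂ n) p).right_inv hyt] at this
      exact hyQ this
    · rw [indicator_of_notMem hyt]

/-- The divergence theorem for `ψ E_1` on an enclosed domain, when `ψ` is supported in `P_+`. -/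
theorem IsEnclosedDomain.integral_fderiv_eq [MeasurableSpace M] [BorelSpace M]
    (hc : IsCapillary θ x ν) (hinj : Injective x)
    {Ω : Set (E n)} (hΩ : IsEnclosedDomain x ν Ω) {ψ : E n → ℝ} (hψ : ContDiff ℝ 1 ψ)
    (hψc : HasCompactSupport ψ) (hψ0 : tsupport ψ ⊆ {z | 0 < z 0}) :
    ∫ z in Ω, fderiv ℝ ψ z (E₁ n) = ∫ p, ψ (x p) * fluxDensity x ν p ∂area x := by
  classical
  have hfr : ∀ p, 0 < x p 0 → x p ∈ frontier Ω := fun p hp =>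
    (hΩ.frontier_eq.superset ⟨mem_range_self p, hp⟩).1
  -- Points of `P_+` are of three kinds. Inside `Ω` and outside its closure both integrals vanish
  -- for small supports. A frontier point is `x p` with `p` interior, since boundary points are
  -- mapped into `P`.
  have hloc : ∀ z : E n, 0 < z 0 → ∃ U : Set (E n), IsOpen U ∧ z ∈ U ∧ ∀ ψ : E n → ℝ,
      ContDiff ℝ 1 ψ → HasCompactSupport ψ → tsupport ψ ⊆ U →
      ∫ z in Ω, fderiv ℝ ψ z (E₁ n) = ∫ p, ψ (x p) * fluxDensity x ν p ∂area x := by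
    intro z hz
    by_cases h1 : z ∈ Ω
    · refine ⟨Ω, hΩ.isOpen, h1, fun ψ hψ hψc hψU => ?_⟩
      have hR : ∀ p, ψ (x p) = 0 := fun p => image_eq_zero_of_notMem_tsupport fun h => by
        have := hfr p (hΩ.subset_pos (hψU h))
        rw [hΩ.isOpen.frontier_eq] at this
        exact this.2 (hψU h)
      simp only [hR, zero_mul, integral_zero]
      rw [setIntegral_eq_integral_of_forall_compl_eq_zero fun z hz => by
        rw [(notMem_tsupport_iff_eventuallyEq.1 fun h => hz (hψU h)).fderiv_eq]
        simp]
      have hi : Integrable ψ := hψ.continuous.integrable_of_hasCompactSupport hψc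
      have hi' : Integrable fun z => fderiv ℝ ψ z (E₁ n) :=
        ((hψ.continuous_fderiv one_ne_zero).clm_apply
          continuous_const).integrable_of_hasCompactSupport (hψc.fderiv_apply ℝ (E₁ n))
      have := integral_mul_fderiv_eq_neg_fderiv_mul_of_integrable (μ := volume) (𝕜 := ℝ)
        (f := fun _ : E n => (1 : ℝ)) (g := ψ) (v := E₁ n)
        (by simp) (by simpa using hi') (by simpa using hi) (by fun_prop)
        fun z _ => hψ.differentiable one_ne_zero z
      simpa using this
    · by_cases h2 : z ∈ closure Ω
      · have h3 : z ∈ frontier Ω := by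
          rw [hΩ.isOpen.frontier_eq]
          exact ⟨h2, h1⟩
        obtain ⟨⟨p, rfl⟩, -⟩ := hΩ.frontier_eq.subset ⟨h3, hz⟩
        refine hΩ.exists_local_divergence hc hinj ?_
        by_contra hcon
        have h4 : p ∈ (𝓡∂ n).boundary M := by
          rw [← ModelWithCorners.compl_interior]
          exact hcon
        exact hz.ne' (hc.boundary_zero p h4)
      · refine ⟨(closure Ω)ᶜ ∩ {z | 0 < z 0}, isClosed_closure.isOpen_compl.inter
          (isOpen_lt continuous_const (by fun_prop)), ⟨h2, hz⟩, fun ψ hψ hψc hψU => ?_⟩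
        have hR : ∀ p, ψ (x p) = 0 := fun p => image_eq_zero_of_notMem_tsupport fun h =>
          (hψU h).1 (frontier_subset_closure (hfr p (hψU h).2))
        simp only [hR, zero_mul, integral_zero]
        refine setIntegral_eq_zero_of_forall_eq_zero fun z hz => ?_
        rw [(notMem_tsupport_iff_eventuallyEq.1
          fun h => (hψU h).1 (subset_closure hz)).fderiv_eq]
        simp
  choose U hUo hzU hU using hloc
  obtain ⟨t, ht⟩ := hψc.isCompact.elim_finite_subcover (fun z : {z : E n // 0 < z 0} => U z z.2)
    (fun z => hUo _ _) fun z hz => mem_iUnion.2 ⟨⟨z, hψ0 hz⟩, hzU _ _⟩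
  obtain ⟨ρ, hρ⟩ := SmoothPartitionOfUnity.exists_isSubordinate 𝓘(ℝ, E n) (s := tsupport ψ)
    (isClosed_tsupport ψ) (fun i : t => U i.1 i.1.2) (fun i => hUo _ _)
    (ht.trans (iUnion₂_subset fun q hq => subset_iUnion_of_subset ⟨q, hq⟩ subset_rfl))
  have hρc : ∀ i, ContDiff ℝ 1 fun z => ρ i z * ψ z := fun i =>
    ((ρ i).contMDiff.contDiff.of_le (by simp)).mul hψ
  have hρs : ∀ i, HasCompactSupport fun z => ρ i z * ψ z := fun i => hψc.mul_left
  have hsum : ψ = fun z => ∑ i, ρ i z * ψ z := by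
    funext z
    rw [← Finset.sum_mul]
    by_cases hz : z ∈ tsupport ψ
    · have := ρ.sum_eq_one hz
      rw [finsum_eq_sum_of_fintype] at this
      rw [this, one_mul]
    · rw [image_eq_zero_of_notMem_tsupport hz, mul_zero]
  have hU' : ∀ i, ∫ z in Ω, fderiv ℝ (fun z => ρ i z * ψ z) z (E₁ n) =
      ∫ p, (ρ i (x p) * ψ (x p)) * fluxDensity x ν p ∂area x := fun i =>
    hU i.1 i.1.2 _ (hρc i) (hρs i) ((tsupport_mul_subset_left).trans (hρ i))
  have hL : ∀ z, fderiv ℝ ψ z (E₁ n) = ∑ i, fderiv ℝ (fun z => ρ i z * ψ z) z (E₁ n) := by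
    intro z
    conv_lhs => rw [hsum]
    rw [fderiv_fun_sum fun i _ => (hρc i).differentiable one_ne_zero z]
    simp
  have hR : ∀ p, ψ (x p) * fluxDensity x ν p =
      ∑ i, (ρ i (x p) * ψ (x p)) * fluxDensity x ν p := by
    intro p
    rw [← Finset.sum_mul]
    exact congrArg (· * _) (congrFun hsum (x p))
  simp only [hL, hR]
  rw [integral_finsetSum, integral_finsetSum]
  · exact Finset.sum_congr rfl fun i _ => hU' i
  · exact fun i _ => integrable_area_of_continuous (contMDiff_one_of_infty hc.smooth) hc.mem_half
      (((hρc i).continuous.comp hc.smooth.continuous).mul hc.continuous_fluxDensity)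
  · exact fun i _ => ((((hρc i).continuous_fderiv one_ne_zero).clm_apply
      continuous_const).integrable_of_hasCompactSupport
        ((hρs i).fderiv_apply ℝ (E₁ n))).integrableOn

end LocalDivergence

/-! ### Cutoffs near `P`. -/

section Ramp

/-- Continuous approximations of the indicator function of `(0, ∞)`. -/
def rampSlope (k : ℕ) (s : ℝ) : ℝ := max 0 (min 1 ((k + 1) * s - 1))

/-- Approximations of `max s 0` vanishing near `0`. -/
def ramp (k : ℕ) (s : ℝ) : ℝ := ∫ τ in (0 : ℝ)..s, rampSlope k τ

theorem continuous_rampSlope (k : ℕ) : Continuous (rampSlope k) := by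
  unfold rampSlope
  fun_prop

theorem rampSlope_nonneg (k : ℕ) (s : ℝ) : 0 ≤ rampSlope k s := le_max_left _ _

theorem rampSlope_le_one (k : ℕ) (s : ℝ) : rampSlope k s ≤ 1 :=
  max_le zero_le_one (min_le_left _ _)

theorem norm_rampSlope_le (k : ℕ) (s : ℝ) : ‖rampSlope k s‖ ≤ 1 := by
  rw [Real.norm_of_nonneg (rampSlope_nonneg k s)]
  exact rampSlope_le_one k s

theorem tendsto_rampSlope {s : ℝ} (hs : 0 < s) :
    Tendsto (fun k => rampSlope k s) atTop (𝓝 1) := by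
  refine tendsto_const_nhds.congr' ?_
  obtain ⟨N, hN⟩ := exists_nat_gt (2 / s)
  filter_upwards [eventually_ge_atTop N] with k hk
  have h1 : 2 < (k + 1 : ℝ) * s := by
    rw [div_lt_iff₀ hs] at hN
    have : (N : ℝ) ≤ k := by exact_mod_cast hk
    nlinarith
  rw [rampSlope, min_eq_left (by linarith), max_eq_right zero_le_one]

theorem hasDerivAt_ramp (k : ℕ) (s : ℝ) : HasDerivAt (ramp k) (rampSlope k s) s :=
  intervalIntegral.integral_hasDerivAt_right ((continuous_rampSlope k).intervalIntegrable _ _)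
    ((continuous_rampSlope k).stronglyMeasurableAtFilter _ _) (continuous_rampSlope k).continuousAt

theorem contDiff_ramp (k : ℕ) : ContDiff ℝ 1 (ramp k) := by
  refine contDiff_one_iff_deriv.2 ⟨fun s => (hasDerivAt_ramp k s).differentiableAt, ?_⟩
  rw [show deriv (ramp k) = rampSlope k from funext fun s => (hasDerivAt_ramp k s).deriv]
  exact continuous_rampSlope k

theorem ramp_eq_zero {k : ℕ} {s : ℝ} (hs : s ≤ 1 / (k + 1)) : ramp k s = 0 := by
  refine intervalIntegral.integral_zero_ae (Eventually.of_forall fun τ hτ => ?_)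
  have hk : (0 : ℝ) < k + 1 := by positivity
  have h1 : τ ≤ 1 / (k + 1) := by
    refine hτ.2.trans (max_le (by positivity) hs)
  rw [le_div_iff₀ hk] at h1
  exact max_eq_left ((min_le_right _ _).trans (by linarith))

theorem norm_ramp_le (k : ℕ) (s : ℝ) : ‖ramp k s‖ ≤ ‖s‖ := by
  have := intervalIntegral.norm_integral_le_of_norm_le_const (a := 0) (b := s) (C := 1)
    fun τ _ => norm_rampSlope_le k τ
  simpa [ramp] using this

theorem tendsto_ramp {s : ℝ} (hs : 0 ≤ s) : Tendsto (fun k => ramp k s) atTop (𝓝 s) := by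
  have : Tendsto (fun k => ramp k s) atTop (𝓝 (∫ τ in (0 : ℝ)..s, (1 : ℝ))) := by
    refine intervalIntegral.tendsto_integral_filter_of_dominated_convergence (fun _ => 1)
      (Eventually.of_forall fun k => (continuous_rampSlope k).aestronglyMeasurable)
      (Eventually.of_forall fun k => Eventually.of_forall fun τ _ => norm_rampSlope_le k τ)
      (by simp) (Eventually.of_forall fun τ hτ => ?_)
    rw [uIoc_of_le hs] at hτ
    exact tendsto_rampSlope hτ.1
  simpa using this

end Ramp

/-! ### The enclosed volume as an integral over the hypersurface. -/

section Volume

variable {n : ℕ} [NeZero n] {M : Type*} [TopologicalSpace M] [CompactSpace M] [T2Space M]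
  [ChartedSpace (EuclideanHalfSpace n) M] [IsManifold (𝓡∂ n) ∞ M]
  {x ν : M → E n} {θ : ℝ}

theorem isOpen_upperHalf : IsOpen (upperHalf n) :=
  isOpen_lt continuous_const (by fun_prop)

/-- The hyperbolic density blows up at `x_{n+1} = 0`. Cutting it off away from the relevant compact
set gives a compactly supported function on the whole space, as the divergence theorem needs. -/
theorem exists_contDiff_eq_inv_pow {C : Set (E n)} (hC : IsCompact C) (hCU : C ⊆ upperHalf n)
    (k : ℕ) : ∃ h : E n → ℝ, ContDiff ℝ 1 h ∧ HasCompactSupport h ∧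
      ∀ z ∈ C, h z = (z (Fin.last n) ^ k)⁻¹ := by
  obtain ⟨K, hK, hCK, hKU⟩ := exists_compact_between hC isOpen_upperHalf hCU
  obtain ⟨f, hf1, hf0, -⟩ := exists_contMDiffMap_one_nhds_of_subset_interior 𝓘(ℝ, E n) (n := 1)
    hC.isClosed hCK
  have hfs : ContDiff ℝ 1 f := f.contMDiff.contDiff
  refine ⟨fun z => f z * (z (Fin.last n) ^ k)⁻¹, ?_, HasCompactSupport.intro hK fun z hz => by
    rw [hf0 z hz, zero_mul], fun z hz => ?_⟩
  · refine contDiff_iff_contDiffAt.2 fun z => ?_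
    by_cases hz : z ∈ K
    · have h1 : ContDiff ℝ 1 fun z : E n => z (Fin.last n) ^ k := by fun_prop
      exact hfs.contDiffAt.mul (h1.contDiffAt.inv (pow_ne_zero k (ne_of_gt (hKU hz))))
    · refine (contDiffAt_const (c := (0 : ℝ))).congr_of_eventuallyEq ?_
      filter_upwards [hK.isClosed.isOpen_compl.mem_nhds hz] with w hw
      rw [hf0 w hw, zero_mul]
  · have : f z = 1 := hf1.self_of_nhdsSet z hz
    change f z * _ = _
    rw [this, one_mul]

theorem IsCapillary.zero_le (hc : IsCapillary θ x ν) (p : M) : 0 ≤ x p 0 := by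
  by_cases h : p ∈ (𝓡∂ n).interior M
  · exact (hc.interior_pos p h).le
  · refine (hc.boundary_zero p ?_).ge
    rw [← ModelWithCorners.compl_interior]
    exact h

/-- The volume of the enclosed domain as an integral over the hypersurface. -/
theorem IsEnclosedDomain.hypVolume_eq [MeasurableSpace M] [BorelSpace M]
    (hc : IsCapillary θ x ν) (hinj : Injective x)
    {Ω : Set (E n)} (hΩ : IsEnclosedDomain x ν Ω) :
    hypVolume Ω = ENNReal.ofReal (∫ p, x p 0 * hypInner (x p) (E₁ n) (ν p) ∂area x) := by
  have hxc := hc.smooth.continuous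
  obtain ⟨h, hh, hhc, hheq⟩ := exists_contDiff_eq_inv_pow
    (hΩ.compact_closure.union (isCompact_range hxc))
    (union_subset hΩ.closure_subset (range_subset_iff.2 hc.mem_half)) (n + 1)
  have hhΩ : ∀ z ∈ Ω, h z = (z (Fin.last n) ^ (n + 1))⁻¹ := fun z hz =>
    hheq z (Or.inl (subset_closure hz))
  have hhx : ∀ p, h (x p) * fluxDensity x ν p = hypInner (x p) (E₁ n) (ν p) := fun p => by
    have : x p (Fin.last n) ^ (n + 1) ≠ 0 := pow_ne_zero _ (ne_of_gt (hc.mem_half p))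
    rw [hheq _ (Or.inr (mem_range_self p)), fluxDensity, inv_mul_cancel_left₀ this]
  have hint : IntegrableOn h Ω := (hh.continuous.integrable_of_hasCompactSupport hhc).integrableOn
  have hzc : Continuous fun z : E n => z 0 := by fun_prop
  have hψ : ∀ k, ContDiff ℝ 1 fun z : E n => ramp k (z 0) * h z := fun k =>
    ((contDiff_ramp k).comp (by fun_prop : ContDiff ℝ 1 fun z : E n => z 0)).mul hh
  have hder : ∀ k, ∀ z ∈ Ω, fderiv ℝ (fun z : E n => ramp k (z 0) * h z) z (E₁ n) =
      rampSlope k (z 0) * h z := by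
    intro k z hz
    have h1 : HasFDerivAt (fun z : E n => ramp k (z 0)) _ z :=
      HasDerivAt.comp_hasFDerivAt (f := fun z : E n => z 0) z (hasDerivAt_ramp k (z 0))
        (EuclideanSpace.proj 0 : E n →L[ℝ] ℝ).hasFDerivAt
    have hl : z (Fin.last n) ^ (n + 1) ≠ 0 :=
      pow_ne_zero _ (ne_of_gt (hΩ.closure_subset (subset_closure hz)))
    have h2 : HasFDerivAt (fun z : E n => (z (Fin.last n) ^ (n + 1))⁻¹) _ z :=
      HasDerivAt.comp_hasFDerivAt (f := fun z : E n => z (Fin.last n)) z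
        ((hasDerivAt_pow (n + 1) (z (Fin.last n))).fun_inv hl)
        (EuclideanSpace.proj (Fin.last n) : E n →L[ℝ] ℝ).hasFDerivAt
    have h3 := h2.congr_of_eventuallyEq (f₁ := h) (by
      filter_upwards [hΩ.isOpen.mem_nhds hz] with w hw using hhΩ w hw)
    rw [(h1.fun_mul h3).fderiv]
    have e1 : (EuclideanSpace.proj (Fin.last n) : E n →L[ℝ] ℝ) (E₁ n) = 0 := E₁_last (n := n)
    have e2 : (EuclideanSpace.proj 0 : E n →L[ℝ] ℝ) (E₁ n) = 1 := E₁_zero (n := n)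
    simp [e1, e2, mul_comm]
  -- Replacing `x_1` by its ramp keeps the support of the field off `P`, so no information is needed
  -- where the hypersurface meets `P`.
  have hkey : ∀ k, ∫ z in Ω, rampSlope k (z 0) * h z =
      ∫ p, ramp k (x p 0) * hypInner (x p) (E₁ n) (ν p) ∂area x := by
    intro k
    have h1 : ∀ p, ramp k (x p 0) * hypInner (x p) (E₁ n) (ν p) =
        ramp k (x p 0) * h (x p) * fluxDensity x ν p := fun p => by rw [mul_assoc, hhx]
    simp only [h1]
    rw [← hΩ.integral_fderiv_eq hc hinj (hψ k) hhc.mul_left]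
    · exact setIntegral_congr_fun hΩ.isOpen.measurableSet fun z hz => (hder k z hz).symm
    · refine tsupport_mul_subset_left.trans (?_ : closure _ ⊆ _)
      have h2 : IsClosed {z : E n | 1 / ((k : ℝ) + 1) ≤ z 0} := isClosed_le continuous_const hzc
      refine (closure_minimal (fun z hz => ?_) h2).trans fun z hz => lt_of_lt_of_le (b := 1 / ((k : ℝ) + 1)) ?_ hz
      · by_contra hcon
        exact hz (ramp_eq_zero (not_le.1 hcon).le)
      · positivity
  have hflux : Continuous fun p => hypInner (x p) (E₁ n) (ν p) := by
    have : (fun p => hypInner (x p) (E₁ n) (ν p)) = fun p => h (x p) * fluxDensity x ν p :=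
      funext fun p => (hhx p).symm
    rw [this]
    exact (hh.continuous.comp hxc).mul hc.continuous_fluxDensity
  have hL : Tendsto (fun k => ∫ z in Ω, rampSlope k (z 0) * h z) atTop (𝓝 (∫ z in Ω, h z)) := by
    refine tendsto_integral_of_dominated_convergence (fun z => ‖h z‖)
      (fun k => (((continuous_rampSlope k).comp hzc).mul hh.continuous).aestronglyMeasurable)
      hint.norm (fun k => Eventually.of_forall fun z => ?_) ?_
    · rw [norm_mul]
      exact mul_le_of_le_one_left (norm_nonneg _) (norm_rampSlope_le k _)
    · filter_upwards [ae_restrict_mem hΩ.isOpen.measurableSet] with z hz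
      simpa using (tendsto_rampSlope (hΩ.subset_pos hz)).mul_const (h z)
  have hR : Tendsto (fun k => ∫ p, ramp k (x p 0) * hypInner (x p) (E₁ n) (ν p) ∂area x) atTop
      (𝓝 (∫ p, x p 0 * hypInner (x p) (E₁ n) (ν p) ∂area x)) := by
    refine tendsto_integral_of_dominated_convergence
      (fun p => ‖x p 0 * hypInner (x p) (E₁ n) (ν p)‖)
      (fun k => ((((contDiff_ramp k).continuous.comp hzc).comp hxc).mul
        hflux).aestronglyMeasurable) ?_
      (fun k => Eventually.of_forall fun p => ?_) (Eventually.of_forall fun p =>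
        (tendsto_ramp (hc.zero_le p)).mul_const _)
    · exact (integrable_area_of_continuous (contMDiff_one_of_infty hc.smooth) hc.mem_half
        ((hzc.comp hxc).mul hflux)).norm
    · rw [norm_mul, norm_mul]
      exact mul_le_mul_of_nonneg_right (norm_ramp_le k _) (norm_nonneg _)
  -- Both sides converge by dominated convergence, the slopes to the indicator of `x_1 > 0` and the
  -- ramps to `x_1`.
  simp only [hkey] at hL
  rw [tendsto_nhds_unique hR hL, ofReal_integral_eq_lintegral_ofReal hint]
  · refine setLIntegral_congr_fun hΩ.isOpen.measurableSet fun z hz => ?_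
    rw [hhΩ z hz, one_div]
  · filter_upwards [ae_restrict_mem hΩ.isOpen.measurableSet] with z hz
    rw [hhΩ z hz]
    exact inv_nonneg.2 (pow_nonneg (le_of_lt (hΩ.closure_subset (subset_closure hz))) _)

end Volume

/-! ### Time-dependent maps in charts. -/

section FlowChart

variable {n : ℕ} [NeZero n] {M : Type*} [TopologicalSpace M]
  [ChartedSpace (EuclideanHalfSpace n) M] [IsManifold (𝓡∂ n) ∞ M]
  {V : Type*} [NormedAddCommGroup V] [NormedSpace ℝ V] {x : ℝ → M → V} {I : Set ℝ} {q : M}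

/-- A time-dependent map read in the chart around `q`. -/
def flowChart (x : ℝ → M → V) (q : M) (z : ℝ × EuclideanSpace ℝ (Fin n)) : V :=
  x z.1 ((extChartAt (𝓡∂ n) q).symm z.2)

theorem contDiffOn_flowChart {k : WithTop ℕ∞} [IsManifold (𝓡∂ n) k M]
    (hx : ContMDiffOn (𝓘(ℝ, ℝ).prod (𝓡∂ n)) 𝓘(ℝ, V) k (fun z : ℝ × M => x z.1 z.2) (I ×ˢ univ))
    (q : M) : ContDiffOn ℝ k (flowChart x q) (I ×ˢ (extChartAt (𝓡∂ n) q).target) := by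
  have h1 : ContMDiffOn 𝓘(ℝ, ℝ × EuclideanSpace ℝ (Fin n)) 𝓘(ℝ, ℝ) k
      (fun z : ℝ × EuclideanSpace ℝ (Fin n) => z.1) (I ×ˢ (extChartAt (𝓡∂ n) q).target) :=
    contDiff_fst.contMDiff.contMDiffOn
  have h2 : ContMDiffOn 𝓘(ℝ, ℝ × EuclideanSpace ℝ (Fin n)) (𝓡∂ n) k
      (fun z : ℝ × EuclideanSpace ℝ (Fin n) => (extChartAt (𝓡∂ n) q).symm z.2)
      (I ×ˢ (extChartAt (𝓡∂ n) q).target) :=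
    (contMDiffOn_extChartAt_symm q).comp contDiff_snd.contMDiff.contMDiffOn fun z hz => hz.2
  exact (hx.comp (h1.prodMk h2) fun z hz => ⟨hz.1, mem_univ _⟩).contDiffOn

theorem uniqueDiffOn_flowChart (hI : UniqueDiffOn ℝ I) (q : M) :
    UniqueDiffOn ℝ (I ×ˢ (extChartAt (𝓡∂ n) q).target) :=
  hI.prod (uniqueDiffOn_target q)

theorem chartDeriv_eq_flowChart
    (hx : DifferentiableOn ℝ (flowChart x q) (I ×ˢ (extChartAt (𝓡∂ n) q).target)) {t : ℝ}
    (ht : t ∈ I) {y : EuclideanSpace ℝ (Fin n)} (hy : y ∈ (extChartAt (𝓡∂ n) q).target)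
    (v : EuclideanSpace ℝ (Fin n)) :
    chartDeriv q (x t) y v =
      fderivWithin ℝ (flowChart x q) (I ×ˢ (extChartAt (𝓡∂ n) q).target) (t, y) (0, v) := by
  have h1 := (hx (t, y) ⟨ht, hy⟩).hasFDerivWithinAt
  have h2 : HasFDerivWithinAt (fun y' : EuclideanSpace ℝ (Fin n) => (t, y')) _
      (extChartAt (𝓡∂ n) q).target y := (hasFDerivAt_prodMk_right (𝕜 := ℝ) t y).hasFDerivWithinAt
  have h3 := h1.comp y h2 fun y' hy' => ⟨ht, hy'⟩
  rw [chartDeriv_eq_fderivWithin_target hy]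
  change fderivWithin ℝ (flowChart x q ∘ fun y' => (t, y')) _ y v = _
  rw [h3.fderivWithin (uniqueDiffOn_target q y hy)]
  rfl

theorem hasDerivAt_time {g : ℝ × EuclideanSpace ℝ (Fin n) → V} (hI : IsOpen I)
    {S : Set (EuclideanSpace ℝ (Fin n))} (hg : DifferentiableOn ℝ g (I ×ˢ S)) {t : ℝ} (ht : t ∈ I)
    {y : EuclideanSpace ℝ (Fin n)} (hy : y ∈ S) :
    HasDerivAt (fun s => g (s, y)) (fderivWithin ℝ g (I ×ˢ S) (t, y) (1, 0)) t := by
  have h1 := (hg (t, y) ⟨ht, hy⟩).hasFDerivWithinAt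
  have h2 : HasDerivWithinAt (fun s : ℝ => (s, y)) ((1 : ℝ), (0 : EuclideanSpace ℝ (Fin n))) I t :=
    ((hasDerivAt_id t).prodMk (hasDerivAt_const t y)).hasDerivWithinAt
  have h3 : MapsTo (fun s : ℝ => (s, y)) I (I ×ˢ S) := fun s hs => ⟨hs, hy⟩
  exact (h1.comp_hasDerivWithinAt t h2 h3).hasDerivAt (hI.mem_nhds ht)

/-- The velocity in a chart: its spatial differential is the time derivative of the spatial
differential. -/
theorem hasDerivAt_flowChart [IsManifold (𝓡∂ n) 2 M] (hI : IsOpen I)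
    (hx : ContMDiffOn (𝓘(ℝ, ℝ).prod (𝓡∂ n)) 𝓘(ℝ, V) 2 (fun z : ℝ × M => x z.1 z.2) (I ×ˢ univ))
    {t : ℝ} (ht : t ∈ I) {y : EuclideanSpace ℝ (Fin n)}
    (hy : y ∈ (extChartAt (𝓡∂ n) q).target) :
    HasDerivAt (fun s => x s ((extChartAt (𝓡∂ n) q).symm y))
      (deriv (fun s => x s ((extChartAt (𝓡∂ n) q).symm y)) t) t ∧
    ∀ v, HasDerivAt (fun s => chartDeriv q (x s) y v)
      (chartDeriv q (fun p => deriv (fun s => x s p) t) y v) t := by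
  set S := I ×ˢ (extChartAt (𝓡∂ n) q).target with hS
  have hu : UniqueDiffOn ℝ S := uniqueDiffOn_flowChart hI.uniqueDiffOn q
  have hc := contDiffOn_flowChart hx q
  have hd : DifferentiableOn ℝ (flowChart x q) S := hc.differentiableOn two_ne_zero
  have hc1 : ContDiffOn ℝ 1 (fderivWithin ℝ (flowChart x q) S) S :=
    hc.fderivWithin hu (by norm_num)
  have hd1 := hc1.differentiableOn one_ne_zero
  have hw : ∀ y ∈ (extChartAt (𝓡∂ n) q).target,
      deriv (fun s => x s ((extChartAt (𝓡∂ n) q).symm y)) t =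
        fderivWithin ℝ (flowChart x q) S (t, y) (1, 0) := fun y hy =>
    (hasDerivAt_time hI hd ht hy).deriv
  refine ⟨(hasDerivAt_time hI hd ht hy).differentiableAt.hasDerivAt, fun v => ?_⟩
  set D2 := fderivWithin ℝ (fderivWithin ℝ (flowChart x q) S) S (t, y) with hD2
  -- Time and space derivatives commute also at points of the model boundary, as `I` is open and the
  -- target lies in the closure of its interior.
  have hsymm : IsSymmSndFDerivWithinAt ℝ (flowChart x q) S (t, y) := by
    refine (hc (t, y) ⟨ht, hy⟩).isSymmSndFDerivWithinAt (by simp) hu ?_ ⟨ht, hy⟩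
    rw [interior_prod_eq, closure_prod_eq, hI.interior_eq]
    exact ⟨subset_closure ht, extChartAt_target_subset_closure_interior hy⟩
  have h1 : HasDerivAt (fun s => fderivWithin ℝ (flowChart x q) S (s, y)) (D2 (1, 0)) t :=
    hasDerivAt_time hI hd1 ht hy
  have h2 : HasDerivAt (fun s => chartDeriv q (x s) y v) (D2 (1, 0) (0, v)) t := by
    have h3 : HasDerivAt (fun s => fderivWithin ℝ (flowChart x q) S (s, y) (0, v)) _ t :=
      h1.clm_apply (hasDerivAt_const t _)
    rw [map_zero, add_zero] at h3
    refine h3.congr_of_eventuallyEq ?_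
    filter_upwards [hI.mem_nhds ht] with s hs
    exact chartDeriv_eq_flowChart hd hs hy v
  have h4 : chartDeriv q (fun p => deriv (fun s => x s p) t) y v = D2 (0, v) (1, 0) := by
    rw [chartDeriv_eq_fderivWithin_target hy]
    have h5 : HasFDerivWithinAt (fun y' : EuclideanSpace ℝ (Fin n) => (t, y')) _
      (extChartAt (𝓡∂ n) q).target y := (hasFDerivAt_prodMk_right (𝕜 := ℝ) t y).hasFDerivWithinAt
    have h6 := ((hd1 (t, y) ⟨ht, hy⟩).hasFDerivWithinAt.comp y h5
      fun y' hy' => ⟨ht, hy'⟩).clm_apply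
      (hasFDerivWithinAt_const ((1 : ℝ), (0 : EuclideanSpace ℝ (Fin n))) y _)
    have h7 := h6.congr (f₁ := (fun p => deriv (fun s => x s p) t) ∘ (extChartAt (𝓡∂ n) q).symm)
      (fun z hz => hw z hz) (hw y hy)
    rw [h7.fderivWithin (uniqueDiffOn_target q y hy)]
    simp [D2]
  rw [h4, ← hsymm]
  exact h2

theorem contMDiff_velocity [IsManifold (𝓡∂ n) 2 M] (hI : IsOpen I)
    (hx : ContMDiffOn (𝓘(ℝ, ℝ).prod (𝓡∂ n)) 𝓘(ℝ, V) 2 (fun z : ℝ × M => x z.1 z.2) (I ×ˢ univ))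
    {t : ℝ} (ht : t ∈ I) : ContMDiff (𝓡∂ n) 𝓘(ℝ, V) 1 fun p => deriv (fun s => x s p) t := by
  intro q
  have : IsManifold (𝓡∂ n) 1 M := IsManifold.of_le (n := ∞) (by simp)
  set S := I ×ˢ (extChartAt (𝓡∂ n) q).target with hS
  have hu : UniqueDiffOn ℝ S := uniqueDiffOn_flowChart hI.uniqueDiffOn q
  have hc := contDiffOn_flowChart hx q
  have hc1 : ContDiffOn ℝ 1 (fderivWithin ℝ (flowChart x q) S) S :=
    hc.fderivWithin hu (by norm_num)
  have h1 : ContDiffOn ℝ 1 (fun y => fderivWithin ℝ (flowChart x q) S (t, y) (1, 0))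
      (extChartAt (𝓡∂ n) q).target :=
    (hc1.comp (contDiff_prodMk_right t).contDiffOn fun y hy => ⟨ht, hy⟩).clm_apply contDiffOn_const
  have h2 : ContMDiffOn (𝓡∂ n) 𝓘(ℝ, V) 1
      (fun p => fderivWithin ℝ (flowChart x q) S (t, extChartAt (𝓡∂ n) q p) (1, 0))
      (extChartAt (𝓡∂ n) q).source := by
    refine h1.contMDiffOn.comp ?_ fun p hp => (extChartAt (𝓡∂ n) q).map_source hp
    rw [extChartAt_source]
    exact contMDiffOn_extChartAt
  refine (h2.congr fun p hp => ?_).contMDiffAt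
    ((isOpen_extChartAt_source q).mem_nhds (mem_extChartAt_source q))
  have h3 := (hasDerivAt_time hI (hc.differentiableOn two_ne_zero) ht
    ((extChartAt (𝓡∂ n) q).map_source hp)).deriv
  simp only [flowChart, (extChartAt (𝓡∂ n) q).left_inv hp] at h3
  exact h3

end FlowChart

/-! ### Integrals depending on a parameter. -/

section Parametric

variable {Y : Type*} [TopologicalSpace Y] [T2Space Y] [SecondCountableTopology Y]
  [MeasurableSpace Y] [BorelSpace Y] {μ : Measure Y} [IsFiniteMeasureOnCompacts μ] {K : Set Y}

/-- Near `t` the times may be restricted to `[0, b]` with `t < b < T`, and on the compact set `[0,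
b] ×ˢ K` the integrand is bounded. The endpoint `0` is included. -/
theorem continuousOn_integral_Ico (hK : IsCompact K) {T : ℝ} {F : ℝ → Y → ℝ}
    (hF : ContinuousOn (uncurry F) (Ico 0 T ×ˢ K)) :
    ContinuousOn (fun t => ∫ y in K, F t y ∂μ) (Ico 0 T) := by
  intro t ht
  obtain ⟨b, htb, hbT⟩ := exists_between ht.2
  have hsub : Icc 0 b ×ˢ K ⊆ Ico 0 T ×ˢ K :=
    prod_mono (fun s hs => ⟨hs.1, hs.2.trans_lt hbT⟩) subset_rfl
  obtain ⟨C, hC⟩ := (isCompact_Icc.prod hK).exists_bound_of_continuousOn (hF.mono hsub)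
  have hcont : ∀ s ∈ Ico 0 T, ContinuousOn (F s) K := fun s hs =>
    hF.comp (f := fun y => (s, y)) (by fun_prop) fun y hy => ⟨hs, hy⟩
  refine continuousWithinAt_of_dominated (bound := fun _ => C) ?_ ?_
    (integrableOn_const hK.measure_ne_top) ?_
  · filter_upwards [self_mem_nhdsWithin] with s hs
    exact (hcont s hs).aestronglyMeasurable hK.measurableSet
  · filter_upwards [self_mem_nhdsWithin, nhdsWithin_le_nhds (Iio_mem_nhds htb)] with s hs hsb
    filter_upwards [ae_restrict_mem hK.measurableSet] with y hy
    exact hC (s, y) ⟨⟨hs.1, le_of_lt hsb⟩, hy⟩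
  · filter_upwards [ae_restrict_mem hK.measurableSet] with y hy
    have := hF.comp (f := fun s => (s, y)) (t := Ico 0 T ×ˢ K) (s := Ico 0 T) (by fun_prop)
      fun s hs => ⟨hs, hy⟩
    exact this t ht

theorem hasDerivAt_integral_Ioo (hK : IsCompact K) {T : ℝ} {F F' : ℝ → Y → ℝ}
    (hF : ContinuousOn (uncurry F) (Ioo 0 T ×ˢ K)) (hF' : ContinuousOn (uncurry F') (Ioo 0 T ×ˢ K))
    (hd : ∀ t ∈ Ioo 0 T, ∀ y ∈ K, HasDerivAt (fun s => F s y) (F' t y) t) {t : ℝ}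
    (ht : t ∈ Ioo 0 T) :
    HasDerivAt (fun t => ∫ y in K, F t y ∂μ) (∫ y in K, F' t y ∂μ) t := by
  obtain ⟨a, ha, hat⟩ := exists_between ht.1
  obtain ⟨b, htb, hbT⟩ := exists_between ht.2
  have hsub : Icc a b ⊆ Ioo 0 T := fun s hs => ⟨ha.trans_le hs.1, hs.2.trans_lt hbT⟩
  obtain ⟨C, hC⟩ := (isCompact_Icc.prod hK).exists_bound_of_continuousOn
    (hF'.mono (prod_mono hsub subset_rfl))
  have hcont : ∀ s ∈ Ioo 0 T, ContinuousOn (F s) K := fun s hs =>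
    hF.comp (f := fun y => (s, y)) (by fun_prop) fun y hy => ⟨hs, hy⟩
  have hcont' : ContinuousOn (F' t) K :=
    hF'.comp (f := fun y => (t, y)) (by fun_prop) fun y hy => ⟨ht, hy⟩
  refine (hasDerivAt_integral_of_dominated_loc_of_deriv_le (bound := fun _ => C)
    (Icc_mem_nhds hat htb) ?_ ((hcont t ht).integrableOn_compact hK)
    (hcont'.aestronglyMeasurable hK.measurableSet) ?_
    (integrableOn_const hK.measure_ne_top) ?_).2
  · filter_upwards [Ioo_mem_nhds ht.1 ht.2] with s hs
    exact (hcont s hs).aestronglyMeasurable hK.measurableSet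
  · filter_upwards [ae_restrict_mem hK.measurableSet] with y hy s hs
    exact hC (s, y) ⟨hs, hy⟩
  · filter_upwards [ae_restrict_mem hK.measurableSet] with y hy s hs
    exact hd s (hsub hs) y hy

end Parametric

/-! ### First variation of the enclosed volume. -/

section Rate

variable {n : ℕ} [NeZero n] {M : Type*} [TopologicalSpace M] [CompactSpace M] [T2Space M]
  [ChartedSpace (EuclideanHalfSpace n) M] [IsManifold (𝓡∂ n) ∞ M]
  {x ν w : M → E n} {θ : ℝ}

/-- A primitive of the hyperbolic volume density in the direction `E_1`. -/
def volPrimitive (z : E n) : ℝ := z 0 * (z (Fin.last n) ^ (n + 1))⁻¹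

theorem contDiffAt_volPrimitive {z : E n} (hz : z (Fin.last n) ≠ 0) :
    ContDiffAt ℝ ∞ volPrimitive z := by
  have h0 : ContDiff ℝ ∞ fun z : E n => z 0 := by fun_prop
  have h1 : ContDiff ℝ ∞ fun z : E n => z (Fin.last n) ^ (n + 1) := by fun_prop
  exact h0.contDiffAt.mul (h1.contDiffAt.inv (pow_ne_zero _ hz))

theorem exists_hasFDerivAt_volPrimitive {z : E n} (hz : z (Fin.last n) ≠ 0) :
    ∃ L : E n →L[ℝ] ℝ, HasFDerivAt volPrimitive L z ∧
      L (E₁ n) = (z (Fin.last n) ^ (n + 1))⁻¹ := by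
  have h1 : HasFDerivAt (fun z : E n => z 0) (EuclideanSpace.proj 0 : E n →L[ℝ] ℝ) z :=
    (EuclideanSpace.proj 0 : E n →L[ℝ] ℝ).hasFDerivAt
  have h2 : HasFDerivAt (fun z : E n => (z (Fin.last n) ^ (n + 1))⁻¹) _ z :=
    HasDerivAt.comp_hasFDerivAt (f := fun z : E n => z (Fin.last n)) z
      ((hasDerivAt_pow (n + 1) (z (Fin.last n))).fun_inv (pow_ne_zero _ hz))
      (EuclideanSpace.proj (Fin.last n) : E n →L[ℝ] ℝ).hasFDerivAt
  refine ⟨_, h1.fun_mul h2, ?_⟩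
  have e1 : (EuclideanSpace.proj (Fin.last n) : E n →L[ℝ] ℝ) (E₁ n) = 0 := E₁_last (n := n)
  have e2 : (EuclideanSpace.proj 0 : E n →L[ℝ] ℝ) (E₁ n) = 1 := E₁_zero (n := n)
  simp [e1, e2]

/-- The form whose integral over the hypersurface is the enclosed volume. -/
def volPrimitiveForm (x : M → E n) (p : M) : E n [⋀^Fin n]→L[ℝ] ℝ :=
  volPrimitive (x p) • (volForm n).curryLeft (E₁ n)

/-- The hyperbolic area form. -/
def areaForm (x ν : M → E n) (p : M) : E n [⋀^Fin n]→L[ℝ] ℝ :=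
  (x p (Fin.last n) ^ (n + 1))⁻¹ • (volForm n).curryLeft (ν p)

theorem areaForm_apply (x ν : M → E n) (p : M) (v : Fin n → E n) :
    areaForm x ν p v = (x p (Fin.last n) ^ (n + 1))⁻¹ * (volForm n).curryLeft (ν p) v := rfl

/-- The rate of change of the enclosed volume density under the velocity `w`. -/
def volumeRate (x ν w : M → E n) (p : M) : ℝ :=
  stokesRatio (areaForm x ν) x (volPrimitiveForm x) x w p + hypInner (x p) (w p) (ν p)

theorem IsCapillary.contMDiff_volPrimitiveForm (hc : IsCapillary θ x ν) :
    ContMDiff (𝓡∂ n) 𝓘(ℝ, E n [⋀^Fin n]→L[ℝ] ℝ) ∞ (volPrimitiveForm x) :=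
  contMDiff_comp (g := fun z => volPrimitive z • (volForm n).curryLeft (E₁ n)) hc.smooth
    fun p => (contDiffAt_volPrimitive (hc.last_ne p)).smul contDiffAt_const

theorem IsCapillary.continuous_areaForm (hc : IsCapillary θ x ν) :
    Continuous (areaForm x ν) := by
  have hl : Continuous fun p => x p (Fin.last n) ^ (n + 1) := by
    have : Continuous fun z : E n => z (Fin.last n) ^ (n + 1) := by fun_prop
    exact this.comp hc.smooth.continuous
  have h2 : Continuous fun p => (volForm n).curryLeft (ν p) :=
    (volForm n).curryLeft.continuous.comp hc.normal_smooth.continuous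
  exact (hl.inv₀ fun p => pow_ne_zero _ (hc.last_ne p)).smul h2

theorem IsCapillary.abs_areaForm (hc : IsCapillary θ x ν) (p : M) :
    |areaForm x ν p fun j => diffAt x p (stdVec n j)| =
      1 * Real.sqrt (firstForm x p).det := by
  have h0 : 0 < x p (Fin.last n) ^ (n + 1) := pow_pos (hc.mem_half p) _
  rw [areaForm_apply, abs_mul, hc.abs_volForm_normal, abs_of_pos (inv_pos.2 h0), inv_mul_cancel_left₀ h0.ne',
    one_mul]

theorem IsCapillary.areaForm_ne (hc : IsCapillary θ x ν) (p : M) :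
    (areaForm x ν p fun j => diffAt x p (stdVec n j)) ≠ 0 :=
  mul_ne_zero (inv_ne_zero (pow_ne_zero _ (hc.last_ne p))) (hc.volForm_normal_ne p)

theorem IsCapillary.areaForm_chart_ne (hc : IsCapillary θ x ν) {q : M}
    {y : EuclideanSpace ℝ (Fin n)} (hy : y ∈ (extChartAt (𝓡∂ n) q).target) :
    (areaForm x ν ((extChartAt (𝓡∂ n) q).symm y) fun j => chartDeriv q x y (stdVec n j)) ≠ 0 :=
  mul_ne_zero (inv_ne_zero (pow_ne_zero _ (hc.last_ne _))) (hc.volForm_chart_ne hy)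

/-- The `stokesRatio` part is a divergence whose flux form carries the factor `x_1`, zero on the
boundary, whatever the tangential part of `w`. The normal part is `n` times the Minkowski integrand
of index one. -/
theorem IsCapillary.integral_volumeRate [MeasurableSpace M] [BorelSpace M]
    (hc : IsCapillary θ x ν) {c : ℝ} (hw : ContMDiff (𝓡∂ n) 𝓘(ℝ, E n) 1 w)
    (hwν : ∀ p, hypInner (x p) (w p) (ν p) = flowSpeed θ c x ν p) :
    ∫ p, volumeRate x ν w p ∂area x = 0 := by
  have h1 := integral_stokesRatio (contMDiff_one_of_infty hc.smooth) hc.mem_half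
    hc.continuous_areaForm (contMDiff_one_of_infty hc.smooth) one_pos hc.abs_areaForm
    hc.areaForm_ne (contMDiff_one_of_infty hc.contMDiff_volPrimitiveForm)
    (hc.smooth.of_le (WithTop.coe_le_coe.2 le_top)) hw fun q y hy hy0 => by
      have := hc.boundary_zero _ (mem_boundary_of_chart_zero hy hy0)
      rw [volPrimitiveForm, volPrimitive, this, zero_mul, zero_smul]
      rfl
  have hn : (1 : ℕ) ≤ n := NeZero.one_le
  have h2 := hc.integral_minkowskiIntegrand c le_rfl hn
  have h3 : ∀ p, flowSpeed θ c x ν p = n * minkowskiIntegrand θ c x ν 1 p := by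
    intro p
    have : (n : ℝ) ≠ 0 := Nat.cast_ne_zero.2 (NeZero.ne n)
    have h0 : symCurvature x ν 0 p = 1 := by simp [symCurvature, Multiset.esymm]
    simp only [flowSpeed, minkowskiIntegrand, normCurvature, Nat.sub_self, h0, Nat.choose_zero_right,
      Nat.choose_one_right]
    field_simp
    push_cast
    ring
  have h4 : volumeRate x ν w = fun p => stokesRatio (areaForm x ν) x (volPrimitiveForm x) x w p +
      n * minkowskiIntegrand θ c x ν 1 p := by
    funext p
    rw [volumeRate, hwν, h3]
  rw [h4, integral_add h1.1 (h2.1.const_mul _), h1.2, integral_const_mul, h2.2, mul_zero, add_zero]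

theorem IsCapillary.chartDeriv_volPrimitiveForm (hc : IsCapillary θ x ν) {q : M}
    {y : EuclideanSpace ℝ (Fin n)} (hy : y ∈ (extChartAt (𝓡∂ n) q).target) {L : E n →L[ℝ] ℝ}
    (hL : HasFDerivAt volPrimitive L (x ((extChartAt (𝓡∂ n) q).symm y)))
    (v : EuclideanSpace ℝ (Fin n)) :
    chartDeriv q (volPrimitiveForm x) y v =
      L (chartDeriv q x y v) • (volForm n).curryLeft (E₁ n) := by
  have : IsManifold (𝓡∂ n) 1 M := IsManifold.of_le (n := ∞) (by simp)
  have h1 := hasFDerivWithinAt_chart (contMDiff_one_of_infty hc.smooth) hy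
  have h2 : HasFDerivWithinAt (volPrimitiveForm x ∘ (extChartAt (𝓡∂ n) q).symm) _
      (extChartAt (𝓡∂ n) q).target y :=
    (HasFDerivAt.comp_hasFDerivWithinAt (f := x ∘ (extChartAt (𝓡∂ n) q).symm) y hL h1).smul_const
      ((volForm n).curryLeft (E₁ n))
  rw [chartDeriv_eq_fderivWithin_target hy, h2.fderivWithin (uniqueDiffOn_target q y hy)]
  rfl

/-- The volume rate in a chart. -/
theorem IsCapillary.areaForm_mul_volumeRate (hc : IsCapillary θ x ν)
    (hw : ContMDiff (𝓡∂ n) 𝓘(ℝ, E n) 1 w) {q : M}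
    {y : EuclideanSpace ℝ (Fin n)} (hy : y ∈ (extChartAt (𝓡∂ n) q).target) {L : E n →L[ℝ] ℝ}
    (hL : HasFDerivAt volPrimitive L (x ((extChartAt (𝓡∂ n) q).symm y)))
    (hLE : L (E₁ n) = (x ((extChartAt (𝓡∂ n) q).symm y) (Fin.last n) ^ (n + 1))⁻¹) :
    (areaForm x ν ((extChartAt (𝓡∂ n) q).symm y) fun j => chartDeriv q x y (stdVec n j)) *
        volumeRate x ν w ((extChartAt (𝓡∂ n) q).symm y) =
      L (w ((extChartAt (𝓡∂ n) q).symm y)) *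
          (volForm n).curryLeft (E₁ n) (fun j => chartDeriv q x y (stdVec n j)) +
        volPrimitive (x ((extChartAt (𝓡∂ n) q).symm y)) * ∑ i, (volForm n).curryLeft (E₁ n)
          (update (fun j => chartDeriv q x y (stdVec n j)) i (chartDeriv q w y (stdVec n i))) := by
  have hx1 := contMDiff_one_of_infty hc.smooth
  rw [volumeRate, stokesRatio_chart hx1 (contMDiff_one_of_infty hc.contMDiff_volPrimitiveForm) hx1
    hw hy, mul_add, mul_div_cancel₀ _ (hc.areaForm_chart_ne hy)]
  -- Cartan's formula: the contraction of the exterior derivative of `volPrimitiveForm` with `w` is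
  -- traded for the derivative of the coefficient along `w`.
  have h1 := volForm_curryLeft_add_sum L (E₁ n) (w ((extChartAt (𝓡∂ n) q).symm y))
    fun j => chartDeriv q x y (stdVec n j)
  rw [← h1, hc.curryLeft_chart hy (w _), hLE, stokesSum, Finset.sum_add_distrib, Finset.mul_sum]
  simp only [hc.chartDeriv_volPrimitiveForm hy hL]
  simp only [areaForm_apply, volPrimitiveForm, ContinuousAlternatingMap.smul_apply, smul_eq_mul]
  ring

theorem hasDerivAt_curryLeft {Z : ℝ → Fin n → E n} {Z' : Fin n → E n} {φ : ℝ → ℝ} {φ' t : ℝ}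
    (hφ : HasDerivAt φ φ' t) (hZ : ∀ j, HasDerivAt (fun s => Z s j) (Z' j) t)
    (B : E n [⋀^Fin n]→L[ℝ] ℝ) :
    HasDerivAt (fun s => φ s * B (Z s))
      (φ' * B (Z t) + φ t * ∑ i, B (update (Z t) i (Z' i))) t := by
  have h := (hasFDerivAt_const B t).continuousAlternatingMap_apply fun j => (hZ j).hasFDerivAt
  have h2 := hφ.mul h.hasDerivAt
  refine h2.congr_deriv ?_
  simp

end Rate

/-! ### Conservation of the volume along the flow. -/

section FlowVolume

variable {n : ℕ} [NeZero n] {M : Type*} [TopologicalSpace M] [CompactSpace M] [T2Space M]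
  [ChartedSpace (EuclideanHalfSpace n) M] [IsManifold (𝓡∂ n) ∞ M]
  {x ν : ℝ → M → E n} {θ c T : ℝ} {q : M} {I : Set ℝ}

/-- The density, in the chart around `q`, whose integral is the enclosed volume. -/
def volDensity (x : ℝ → M → E n) (q : M) (t : ℝ) (y : EuclideanSpace ℝ (Fin n)) : ℝ :=
  volPrimitive (x t ((extChartAt (𝓡∂ n) q).symm y)) *
    (volForm n).curryLeft (E₁ n) fun j => chartDeriv q (x t) y (stdVec n j)

/-- The orientation of the chart around `q` relative to the normal. -/
def orientationSign (x ν : M → E n) (q : M) (y : EuclideanSpace ℝ (Fin n)) : ℝ :=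
  |(volForm n).curryLeft (ν ((extChartAt (𝓡∂ n) q).symm y))
    (fun j => chartDeriv q x y (stdVec n j))| /
  (volForm n).curryLeft (ν ((extChartAt (𝓡∂ n) q).symm y))
    (fun j => chartDeriv q x y (stdVec n j))

/-- Only first space derivatives of `x` enter, so one order is lost: `C^1` data give a continuous
density, enough at `t = 0`, and `C^2` data a differentiable one. -/
theorem contDiffOn_volDensity {k m : WithTop ℕ∞} [IsManifold (𝓡∂ n) k M] (hmk : m + 1 ≤ k)
    (hm : m ≤ ∞) (hI : UniqueDiffOn ℝ I) (hl : ∀ t ∈ I, ∀ p, x t p (Fin.last n) ≠ 0)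
    (hx : ContMDiffOn (𝓘(ℝ, ℝ).prod (𝓡∂ n)) 𝓘(ℝ, E n) k (fun z : ℝ × M => x z.1 z.2) (I ×ˢ univ))
    (q : M) :
    ContDiffOn ℝ m (uncurry (volDensity x q)) (I ×ˢ (extChartAt (𝓡∂ n) q).target) := by
  have hc := contDiffOn_flowChart hx q
  have hu := uniqueDiffOn_flowChart (n := n) (M := M) hI q
  have hk : m ≤ k := le_self_add.trans hmk
  have hk1 : (1 : WithTop ℕ∞) ≤ k := le_add_self.trans hmk
  have h1 : ContDiffOn ℝ m (fun z => volPrimitive (flowChart x q z))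
      (I ×ˢ (extChartAt (𝓡∂ n) q).target) := fun z hz =>
    ContDiffAt.comp_contDiffWithinAt (f := flowChart x q) z
      ((contDiffAt_volPrimitive (hl _ hz.1 _)).of_le hm)
      ((hc.of_le hk) z hz)
  have hd := hc.differentiableOn (zero_lt_one.trans_le hk1).ne'
  have h2 : ContDiffOn ℝ m (fun z : ℝ × EuclideanSpace ℝ (Fin n) =>
      fun j => chartDeriv q (x z.1) z.2 (stdVec n j)) (I ×ˢ (extChartAt (𝓡∂ n) q).target) := by
    refine contDiffOn_pi.2 fun j => ?_
    refine ((hc.fderivWithin hu hmk).clm_apply (contDiffOn_const (c := (0, stdVec n j)))).congr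
      fun z hz => ?_
    exact chartDeriv_eq_flowChart hd hz.1 hz.2 _
  have h3 : ContDiff ℝ m ((volForm n).curryLeft (E₁ n)) := ((volForm n).curryLeft (E₁ n)).toContinuousMultilinearMap.contDiff
  exact h1.mul (h3.comp_contDiffOn h2)

theorem IsCapillary.areaDensity_eq_areaForm {x ν : M → E n} (hc : IsCapillary θ x ν)
    {y : EuclideanSpace ℝ (Fin n)} (hy : y ∈ (extChartAt (𝓡∂ n) q).target) :
    areaDensity x q y = orientationSign x ν q y *
      areaForm x ν ((extChartAt (𝓡∂ n) q).symm y) fun j => chartDeriv q x y (stdVec n j) := by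
  have h1 := hc.abs_volForm_chart hy
  have h2 := hc.volForm_chart_ne hy
  have h3 := pow_ne_zero (n + 1) (hc.last_ne ((extChartAt (𝓡∂ n) q).symm y))
  rw [orientationSign, areaForm_apply, h1]
  field_simp

theorem IsCapillary.areaDensity_mul {x : ℝ → M → E n} {ν : M → E n} {t : ℝ}
    (hc : IsCapillary θ (x t) ν)
    {y : EuclideanSpace ℝ (Fin n)} (hy : y ∈ (extChartAt (𝓡∂ n) q).target) :
    areaDensity (x t) q y * (x t ((extChartAt (𝓡∂ n) q).symm y) 0 *
        hypInner (x t ((extChartAt (𝓡∂ n) q).symm y)) (E₁ n) (ν ((extChartAt (𝓡∂ n) q).symm y))) =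
      orientationSign (x t) ν q y * volDensity x q t y := by
  rw [hc.areaDensity_eq_areaForm hy, volDensity, hc.curryLeft_chart hy (E₁ n), areaForm_apply,
    volPrimitive]
  ring

theorem integral_area_eq_of_tsupport [MeasurableSpace M] [BorelSpace M] {x : M → E n}
    (hx : ContMDiff (𝓡∂ n) 𝓘(ℝ, E n) 1 x) (hU : ∀ p, x p ∈ upperHalf n) {ρ f : M → ℝ}
    (hρ : Continuous ρ) (hρq : tsupport ρ ⊆ (extChartAt (𝓡∂ n) q).source) (hf : Continuous f) :
    ∫ p, ρ p * f p ∂area x = ∫ y in extChartAt (𝓡∂ n) q '' tsupport ρ,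
      ρ ((extChartAt (𝓡∂ n) q).symm y) * (areaDensity x q y *
        f ((extChartAt (𝓡∂ n) q).symm y)) := by
  have h0 : ∀ p, p ∉ tsupport ρ → ρ p = 0 := fun p hp => image_eq_zero_of_notMem_tsupport hp
  rw [(integrable_area_iff hx hU (q := q) (f := fun p => ρ p * f p) (hρ.mul hf).continuousOn fun p hp => by
    rw [h0 p fun h => hp (hρq h), zero_mul]).2]
  have hsub : extChartAt (𝓡∂ n) q '' tsupport ρ ⊆ (extChartAt (𝓡∂ n) q).target := by
    rintro _ ⟨p, hp, rfl⟩
    exact (extChartAt (𝓡∂ n) q).map_source (hρq hp)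
  simp only [mul_left_comm (areaDensity x q _)]
  refine setIntegral_eq_of_subset_of_forall_sdiff_eq_zero (measurableSet_target q) hsub
    fun y hy => ?_
  rw [h0 _ fun h => hy.2 ⟨_, h, (extChartAt (𝓡∂ n) q).right_inv hy.1⟩, zero_mul]

theorem IsCapillary.continuous_mul_hypInner {x ν : M → E n} (hc : IsCapillary θ x ν) :
    Continuous fun p => x p 0 * hypInner (x p) (E₁ n) (ν p) := by
  have h0 : Continuous fun p => x p 0 := by
    have : Continuous fun z : E n => z 0 := by fun_prop
    exact this.comp hc.smooth.continuous
  have hl : Continuous fun p => x p (Fin.last n) := by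
    have : Continuous fun z : E n => z (Fin.last n) := by fun_prop
    exact this.comp hc.smooth.continuous
  exact h0.mul ((continuous_const.inner hc.normal_smooth.continuous).div (hl.pow 2)
    fun p => pow_ne_zero 2 (hc.last_ne p))

theorem continuous_of_chart {f : M → ℝ}
    (hf : ∀ q, ContinuousOn (f ∘ (extChartAt (𝓡∂ n) q).symm) (extChartAt (𝓡∂ n) q).target) :
    Continuous f := by
  refine continuous_iff_continuousAt.2 fun q => ?_
  have h := (hf q).comp (continuousOn_extChartAt q) fun p hp => (extChartAt (𝓡∂ n) q).map_source hp
  refine (h.congr fun p hp => ?_).continuousAt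
    ((isOpen_extChartAt_source q).mem_nhds (mem_extChartAt_source q))
  simp only [comp_apply, (extChartAt (𝓡∂ n) q).left_inv hp]

namespace IsCapillaryFlow

theorem last_ne (hF : IsCapillaryFlow θ c T x ν) {t : ℝ} (ht : t ∈ Ico 0 T) (p : M) :
    x t p (Fin.last n) ≠ 0 := (hF.capillary t ht).last_ne p

/-- At a fixed chart point `vol(ν, dx, …)` is continuous in `t` and never zero, so its sign is
constant. This uses the continuity of `ν` in time and the `C^1` regularity down to `t = 0`. -/
theorem orientationSign_eq (hF : IsCapillaryFlow θ c T x ν) {t : ℝ} (ht : t ∈ Ico 0 T)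
    {y : EuclideanSpace ℝ (Fin n)} (hy : y ∈ (extChartAt (𝓡∂ n) q).target) :
    orientationSign (x t) (ν t) q y = orientationSign (x 0) (ν 0) q y := by
  have hM1 : IsManifold (𝓡∂ n) 1 M := IsManifold.of_le (n := ∞) (by simp)
  set f : ℝ → ℝ := fun t => (volForm n).curryLeft (ν t ((extChartAt (𝓡∂ n) q).symm y))
    fun j => chartDeriv q (x t) y (stdVec n j) with hfdef
  have hν : ContinuousOn (fun t => ν t ((extChartAt (𝓡∂ n) q).symm y)) (Ico 0 T) :=
    hF.normal_cont.comp (f := fun t => (t, (extChartAt (𝓡∂ n) q).symm y)) (by fun_prop)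
      fun s hs => ⟨hs, mem_univ _⟩
  have hI : UniqueDiffOn ℝ (Ico 0 T) := uniqueDiffOn_Ico 0 T
  have hc := contDiffOn_flowChart hF.joint_C1 q
  have hD : ContinuousOn (fderivWithin ℝ (flowChart x q)
      (Ico 0 T ×ˢ (extChartAt (𝓡∂ n) q).target)) (Ico 0 T ×ˢ (extChartAt (𝓡∂ n) q).target) :=
    hc.continuousOn_fderivWithin (uniqueDiffOn_flowChart hI q) le_rfl
  have hZ : ContinuousOn (fun t => fun j => chartDeriv q (x t) y (stdVec n j)) (Ico 0 T) := by
    refine continuousOn_pi.2 fun j => ?_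
    have h1 := (hD.comp (f := fun t => (t, y)) (s := Ico 0 T) (by fun_prop)
      fun s hs => ⟨hs, hy⟩).clm_apply (continuousOn_const (c := (0, stdVec n j)))
    exact h1.congr fun s hs =>
      chartDeriv_eq_flowChart (hc.differentiableOn one_ne_zero) hs hy _
  have hf : ContinuousOn f (Ico 0 T) := by
    have h : Continuous fun z : (E n [⋀^Fin n]→L[ℝ] ℝ) × (Fin n → E n) => z.1 z.2 := by fun_prop
    exact h.comp_continuousOn
      (((volForm n).curryLeft.continuous.comp_continuousOn hν).prodMk hZ)
  have hf0 : ∀ s ∈ Ico 0 T, f s ≠ 0 := fun s hs => (hF.capillary s hs).volForm_chart_ne hy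
  have h0 : (0 : ℝ) ∈ Ico 0 T := ⟨le_rfl, ht.1.trans_lt ht.2⟩
  change |f t| / f t = |f 0| / f 0
  -- `|f|` and `f` have equal squares, so on the connected interval they agree or are opposite
  -- throughout.
  rcases isPreconnected_Ico.eq_or_eq_neg_of_sq_eq hf.abs hf (fun s _ => by simp)
    (fun {s} hs => hf0 s hs) with h | h
  · rw [show |f t| = f t from h ht, show |f 0| = f 0 from h h0, div_self (hf0 t ht),
      div_self (hf0 0 h0)]
  · rw [show |f t| = -f t from h ht, show |f 0| = -f 0 from h h0, neg_div, neg_div,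
      div_self (hf0 t ht), div_self (hf0 0 h0)]

theorem hypInner_velocity (hF : IsCapillaryFlow θ c T x ν) {t : ℝ} (ht : t ∈ Ioo 0 T) (p : M) :
    hypInner (x t p) (deriv (fun s => x s p) t) (ν t p) = flowSpeed θ c (x t) (ν t) p := by
  have h := hF.evolution t ⟨ht.1.le, ht.2⟩ p
  rw [derivWithin_of_mem_nhds (Ico_mem_nhds ht.1 ht.2)] at h
  refine smul_left_injective ℝ (m := ν t p) (fun h0 => ?_) h
  have h1 := (hF.capillary t ⟨ht.1.le, ht.2⟩).normal_unit p
  rw [h0] at h1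
  simp [hypInner] at h1

theorem joint_two (hF : IsCapillaryFlow θ c T x ν) :
    ContMDiffOn (𝓘(ℝ, ℝ).prod (𝓡∂ n)) 𝓘(ℝ, E n) 2
      (fun z : ℝ × M => x z.1 z.2) (Ioo 0 T ×ˢ univ) :=
  hF.joint_smooth.of_le (WithTop.coe_le_coe.2 le_top)

theorem contMDiff_velocity (hF : IsCapillaryFlow θ c T x ν) {t : ℝ} (ht : t ∈ Ioo 0 T) :
    ContMDiff (𝓡∂ n) 𝓘(ℝ, E n) 1 fun p => deriv (fun s => x s p) t := by
  have hM2 : IsManifold (𝓡∂ n) 2 M := IsManifold.of_le (n := ∞) (WithTop.coe_le_coe.2 le_top)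
  exact HypCapillary.contMDiff_velocity isOpen_Ioo hF.joint_two ht

theorem hasDerivAt_volDensity (hF : IsCapillaryFlow θ c T x ν) {t : ℝ} (ht : t ∈ Ioo 0 T)
    {y : EuclideanSpace ℝ (Fin n)} (hy : y ∈ (extChartAt (𝓡∂ n) q).target) :
    HasDerivAt (fun s => volDensity x q s y)
      ((areaForm (x t) (ν t) ((extChartAt (𝓡∂ n) q).symm y)
          fun j => chartDeriv q (x t) y (stdVec n j)) *
        volumeRate (x t) (ν t) (fun p => deriv (fun s => x s p) t)
          ((extChartAt (𝓡∂ n) q).symm y)) t := by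
  have hM2 : IsManifold (𝓡∂ n) 2 M := IsManifold.of_le (n := ∞) (WithTop.coe_le_coe.2 le_top)
  have ht' : t ∈ Ico 0 T := ⟨ht.1.le, ht.2⟩
  obtain ⟨L, hL, hLE⟩ := exists_hasFDerivAt_volPrimitive
    (hF.last_ne ht' ((extChartAt (𝓡∂ n) q).symm y))
  rw [(hF.capillary t ht').areaForm_mul_volumeRate (hF.contMDiff_velocity ht) hy hL hLE]
  obtain ⟨h1, h2⟩ := hasDerivAt_flowChart isOpen_Ioo hF.joint_two ht hy
  exact hasDerivAt_curryLeft (hL.comp_hasDerivAt t h1) (fun j => h2 (stdVec n j)) _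

theorem continuousOn_volDensity (hF : IsCapillaryFlow θ c T x ν) (q : M) :
    ContinuousOn (uncurry (volDensity x q)) (Ico 0 T ×ˢ (extChartAt (𝓡∂ n) q).target) := by
  have hM1 : IsManifold (𝓡∂ n) 1 M := IsManifold.of_le (n := ∞) (by simp)
  exact (contDiffOn_volDensity (m := 0) (by simp) (by simp) (uniqueDiffOn_Ico 0 T)
    (fun t ht => hF.last_ne ht) hF.joint_C1 q).continuousOn

/-- The formula need not be examined term by term: by uniqueness it is the time derivative of a
jointly `C^1` density. -/
theorem continuousOn_volDensity_deriv (hF : IsCapillaryFlow θ c T x ν) (q : M) :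
    ContinuousOn (uncurry fun t y => (areaForm (x t) (ν t) ((extChartAt (𝓡∂ n) q).symm y)
          fun j => chartDeriv q (x t) y (stdVec n j)) *
        volumeRate (x t) (ν t) (fun p => deriv (fun s => x s p) t)
          ((extChartAt (𝓡∂ n) q).symm y)) (Ioo 0 T ×ˢ (extChartAt (𝓡∂ n) q).target) := by
  have hM2 : IsManifold (𝓡∂ n) 2 M := IsManifold.of_le (n := ∞) (WithTop.coe_le_coe.2 le_top)
  have h := contDiffOn_volDensity (m := 1) (k := 2) (by norm_num) (by simp)
    (isOpen_Ioo (a := (0 : ℝ)) (b := T)).uniqueDiffOn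
    (fun t ht => hF.last_ne ⟨ht.1.le, ht.2⟩) hF.joint_two q
  have hD := (h.continuousOn_fderivWithin
    (uniqueDiffOn_flowChart isOpen_Ioo.uniqueDiffOn q) le_rfl).clm_apply
    (continuousOn_const (c := ((1 : ℝ), (0 : EuclideanSpace ℝ (Fin n)))))
  refine hD.congr fun z hz => ?_
  have h1 := hasDerivAt_time isOpen_Ioo (h.differentiableOn one_ne_zero) hz.1 hz.2
  exact (hF.hasDerivAt_volDensity hz.1 hz.2).unique h1

theorem continuous_volumeRate (hF : IsCapillaryFlow θ c T x ν) {t : ℝ} (ht : t ∈ Ioo 0 T) :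
    Continuous (volumeRate (x t) (ν t) fun p => deriv (fun s => x s p) t) := by
  have hM1 : IsManifold (𝓡∂ n) 1 M := IsManifold.of_le (n := ∞) (by simp)
  have hc := hF.capillary t ⟨ht.1.le, ht.2⟩
  refine continuous_of_chart (n := n) fun q => ?_
  have h1 := (hF.continuousOn_volDensity_deriv q).comp (f := fun y => (t, y))
    (s := (extChartAt (𝓡∂ n) q).target) (by fun_prop) fun y hy => ⟨ht, hy⟩
  have h2 : ContinuousOn (fun y => areaForm (x t) (ν t) ((extChartAt (𝓡∂ n) q).symm y)
      fun j => chartDeriv q (x t) y (stdVec n j)) (extChartAt (𝓡∂ n) q).target := by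
    refine continuousOn_alternating_apply
      (hc.continuous_areaForm.comp_continuousOn (continuousOn_extChartAt_symm q))
      (continuousOn_pi.2 fun j => ?_)
    exact (contDiffOn_chartDeriv (m := 0) (contMDiff_one_of_infty hc.smooth)
      (by norm_num) q).continuousOn.clm_apply continuousOn_const
  refine (h1.div h2 fun y hy => hc.areaForm_chart_ne hy).congr fun y hy => ?_
  exact (mul_div_cancel_left₀ _ (hc.areaForm_chart_ne hy)).symm

theorem continuousOn_orientationSign (hF : IsCapillaryFlow θ c T x ν) (hT : 0 < T) (q : M) :
    ContinuousOn (orientationSign (x 0) (ν 0) q) (extChartAt (𝓡∂ n) q).target := by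
  have hM1 : IsManifold (𝓡∂ n) 1 M := IsManifold.of_le (n := ∞) (by simp)
  have hc := hF.capillary 0 ⟨le_rfl, hT⟩
  have h2 : ContinuousOn (fun y => (volForm n).curryLeft (ν 0 ((extChartAt (𝓡∂ n) q).symm y))
      fun j => chartDeriv q (x 0) y (stdVec n j)) (extChartAt (𝓡∂ n) q).target := by
    refine continuousOn_alternating_apply (((volForm n).curryLeft.continuous.comp
      hc.normal_smooth.continuous).comp_continuousOn (continuousOn_extChartAt_symm q))
      (continuousOn_pi.2 fun j => ?_)
    exact (contDiffOn_chartDeriv (m := 0) (contMDiff_one_of_infty hc.smooth)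
      (by norm_num) q).continuousOn.clm_apply continuousOn_const
  exact h2.abs.div h2 fun y hy => hc.volForm_chart_ne hy

variable [MeasurableSpace M] [BorelSpace M]

/-- With the orientation sign frozen at `t = 0`, the localized integral becomes an integral over a
fixed compact set of a density regular in `t`, and differentiation under the integral applies. -/
theorem exists_chart_integral (hF : IsCapillaryFlow θ c T x ν) (hT : 0 < T) {ρ : M → ℝ}
    (hρ : Continuous ρ) (hρq : tsupport ρ ⊆ (extChartAt (𝓡∂ n) q).source) :
    ContinuousOn (fun t => ∫ p, ρ p * (x t p 0 * hypInner (x t p) (E₁ n) (ν t p)) ∂area (x t))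
      (Ico 0 T) ∧
    ∀ t ∈ Ioo 0 T, HasDerivAt
      (fun t => ∫ p, ρ p * (x t p 0 * hypInner (x t p) (E₁ n) (ν t p)) ∂area (x t))
      (∫ p, ρ p * volumeRate (x t) (ν t) (fun p => deriv (fun s => x s p) t) p ∂area (x t)) t := by
  set K := extChartAt (𝓡∂ n) q '' tsupport ρ with hK
  have hKc : IsCompact K :=
    (isClosed_tsupport ρ).isCompact.image_of_continuousOn ((continuousOn_extChartAt q).mono hρq)
  have hKt : K ⊆ (extChartAt (𝓡∂ n) q).target := by
    rintro _ ⟨p, hp, rfl⟩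
    exact (extChartAt (𝓡∂ n) q).map_source (hρq hp)
  set σ : EuclideanSpace ℝ (Fin n) → ℝ := fun y =>
    ρ ((extChartAt (𝓡∂ n) q).symm y) * orientationSign (x 0) (ν 0) q y with hσ
  have hσc : ContinuousOn σ K := ((hρ.comp_continuousOn (continuousOn_extChartAt_symm q)).mul
    (hF.continuousOn_orientationSign hT q)).mono hKt
  have hσp : ∀ J : Set ℝ, ContinuousOn (fun z : ℝ × EuclideanSpace ℝ (Fin n) => σ z.2) (J ×ˢ K) :=
    fun J => hσc.comp continuousOn_snd fun z hz => hz.2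
  have hI : ∀ t ∈ Ico 0 T,
      ∫ p, ρ p * (x t p 0 * hypInner (x t p) (E₁ n) (ν t p)) ∂area (x t) =
        ∫ y in K, σ y * volDensity x q t y := by
    intro t ht
    have hc := hF.capillary t ht
    rw [integral_area_eq_of_tsupport (contMDiff_one_of_infty hc.smooth) hc.mem_half hρ hρq
      hc.continuous_mul_hypInner]
    refine setIntegral_congr_fun hKc.measurableSet fun y hy => ?_
    have h1 := hc.areaDensity_mul (hKt hy)
    rw [hF.orientationSign_eq ht (hKt hy)] at h1
    simp only [hσ]
    rw [mul_assoc, ← h1]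
  constructor
  · refine ContinuousOn.congr (continuousOn_integral_Ico hKc (F := fun t y => σ y *
      volDensity x q t y) ?_) hI
    exact (hσp _).mul ((hF.continuousOn_volDensity q).mono (prod_mono subset_rfl hKt))
  · intro t ht
    have hc := hF.capillary t ⟨ht.1.le, ht.2⟩
    have hd := hasDerivAt_integral_Ioo (μ := volume) hKc (F := fun t y => σ y * volDensity x q t y)
      (F' := fun t y => σ y * ((areaForm (x t) (ν t) ((extChartAt (𝓡∂ n) q).symm y)
          fun j => chartDeriv q (x t) y (stdVec n j)) *
        volumeRate (x t) (ν t) (fun p => deriv (fun s => x s p) t)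
          ((extChartAt (𝓡∂ n) q).symm y)))
      ((hσp _).mul ((hF.continuousOn_volDensity q).mono (prod_mono Ioo_subset_Ico_self hKt)))
      ((hσp _).mul ((hF.continuousOn_volDensity_deriv q).mono (prod_mono subset_rfl hKt)))
      (fun t ht y hy => (hF.hasDerivAt_volDensity ht (hKt hy)).const_mul (σ y)) ht
    rw [integral_area_eq_of_tsupport (contMDiff_one_of_infty hc.smooth) hc.mem_half hρ hρq
      (hF.continuous_volumeRate ht)]
    refine (hd.congr_of_eventuallyEq ?_).congr_deriv ?_
    · filter_upwards [Ioo_mem_nhds ht.1 ht.2] with s hs using hI s ⟨hs.1.le, hs.2⟩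
    · refine setIntegral_congr_fun hKc.measurableSet fun y hy => ?_
      simp only [hσ]
      rw [hc.areaDensity_eq_areaForm (hKt hy), hF.orientationSign_eq ⟨ht.1.le, ht.2⟩ (hKt hy)]
      ring

/-- The flow preserves the enclosed volume, written as an integral over the hypersurface. -/
theorem integral_eq (hF : IsCapillaryFlow θ c T x ν) {t : ℝ} (ht : t ∈ Ico 0 T) :
    ∫ p, x t p 0 * hypInner (x t p) (E₁ n) (ν t p) ∂area (x t) =
      ∫ p, x 0 p 0 * hypInner (x 0 p) (E₁ n) (ν 0 p) ∂area (x 0) := by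
  have hT : 0 < T := ht.1.trans_lt ht.2
  obtain ⟨s, ρ, hρ, hρs, hρ1⟩ := exists_partition_charts (n := n) M
  have hch := fun i => hF.exists_chart_integral hT (hρ i).continuous (hρs i)
  have hsplit : ∀ {u : M → E n} {N : M → E n}, IsCapillary θ u N → ∀ f : M → ℝ, Continuous f →
      ∫ p, f p ∂area u = ∑ i, ∫ p, ρ i p * f p ∂area u := by
    intro u N hc f hf
    rw [← integral_finsetSum (f := fun i p => ρ i p * f p) _ fun i _ => integrable_area_of_continuous
      (contMDiff_one_of_infty hc.smooth) hc.mem_half ((hρ i).continuous.mul hf)]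
    refine integral_congr_ae (Eventually.of_forall fun p => ?_)
    simp only [← Finset.sum_mul, hρ1, one_mul]
  set J : ℝ → ℝ := fun t => ∑ i, ∫ p, ρ i p * (x t p 0 * hypInner (x t p) (E₁ n) (ν t p)) ∂area (x t)
    with hJ
  have hIJ : ∀ t ∈ Ico 0 T,
      ∫ p, x t p 0 * hypInner (x t p) (E₁ n) (ν t p) ∂area (x t) = J t := by
    intro t ht
    have hc := hF.capillary t ht
    exact hsplit hc _ hc.continuous_mul_hypInner
  have hJc : ContinuousOn J (Ico 0 T) := continuousOn_finsetSum _ fun i _ => (hch i).1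
  have hJd : ∀ t ∈ Ioo 0 T, HasDerivAt J 0 t := by
    intro t ht
    have hc := hF.capillary t ⟨ht.1.le, ht.2⟩
    have h1 := HasDerivAt.fun_sum (u := Finset.univ) fun i _ => (hch i).2 t ht
    rw [← hsplit hc _ (hF.continuous_volumeRate ht),
      hc.integral_volumeRate (hF.contMDiff_velocity ht) (hF.hypInner_velocity ht)] at h1
    exact h1
  rw [hIJ t ht, hIJ 0 ⟨le_rfl, hT⟩]
  -- The derivative is zero on the open interval and the integral is continuous at `0`, which is all
  -- the mean value theorem asks.
  rcases ht.1.eq_or_lt with h | h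
  · rw [← h]
  · obtain ⟨r, hr, hr'⟩ := exists_hasDerivAt_eq_slope J (fun _ => 0) h
      (hJc.mono fun r hr => ⟨hr.1, hr.2.trans_lt ht.2⟩)
      fun r hr => hJd r ⟨hr.1, hr.2.trans ht.2⟩
    rw [eq_comm, div_eq_zero_iff] at hr'
    rcases hr' with h' | h' <;> linarith

end IsCapillaryFlow

end FlowVolume

end

end HypCapillary

end

theorem mainTheorem2 (n : ℕ) [NeZero n] {M : Type*} [TopologicalSpace M] [T2Space M]
    [CompactSpace M] [ChartedSpace (EuclideanHalfSpace n) M] [IsManifold (𝓡∂ n) ∞ M]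
    [MeasurableSpace M] [BorelSpace M]
    (θ : ℝ) (hθ : θ ∈ Set.Icc 0 Real.pi) (c : ℝ) (hc : 0 < c) :
    (∀ x ν : M → HypCapillary.E n, HypCapillary.IsCapillary θ x ν →
      ∀ k : ℕ, 1 ≤ k → k ≤ n →
        MeasureTheory.Integrable (HypCapillary.minkowskiIntegrand θ c x ν k)
            (HypCapillary.area x) ∧
          ∫ p, HypCapillary.minkowskiIntegrand θ c x ν k p ∂(HypCapillary.area x) = 0) ∧
    (∀ (T : ℝ) (x ν : ℝ → M → HypCapillary.E n) (Ω : ℝ → Set (HypCapillary.E n)),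
      HypCapillary.IsCapillaryFlow θ c T x ν →
      (∀ t ∈ Set.Ico 0 T, HypCapillary.IsEnclosedDomain (x t) (ν t) (Ω t)) →
      ∀ t ∈ Set.Ico 0 T,
        HypCapillary.hypVolume (Ω t) = HypCapillary.hypVolume (Ω 0)) := by
  refine ⟨fun x ν h k hk hkn => h.integral_minkowskiIntegrand c hk hkn, ?_⟩
  intro T x ν Ω hF hΩ t ht
  have h0 : (0 : ℝ) ∈ Set.Ico 0 T := ⟨le_rfl, ht.1.trans_lt ht.2⟩
  -- Both volumes are replaced by integrals over the hypersurface, where conservation has been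
  -- shown.
  rw [(hΩ t ht).hypVolume_eq (hF.capillary t ht) (hF.injective t ht),
    (hΩ 0 h0).hypVolume_eq (hF.capillary 0 h0) (hF.injective 0 h0), hF.integral_eq ht]
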